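/- All graphs are finite and simple; for a vertex $a$ let $N[a]$ denote its closed neighbourhood. Definitions. A graph is *distance hereditary* if every connected induced subgraph $H$ of it preserves the distance between any two vertices of $H$. A vertex set $A$ of $G$ is *asteroidal* if for every $a\in A$ all vertices of $A\setminus\{a\}$ lie in one connected component of $G-N[a]$; the *asteroidal number* $an(G)$ is the maximum size of an asteroidal set. A *2-polygon graph* is a permutation graph: its vertices can be numbered $v_1,\dots,v_n$ so that, for some permutation $\pi$ of $\{1,\dots,n\}$, $v_iv_j$ is an edge if and only if $(i-j)(\pi^{-1}(i)-\pi^{-1}(j))<0$. For $k\ge 3$, a *$k$-polygon graph* is the intersection graph of chords of a convex polygon with $k$ sides, each chord having its endpoints on two distinct sides (all endpoints distinct, and distinct from the corners). The *polygon number* $\psi(G)$ is the least $k\ge 2$ such that $G$ is a $k$-polygon graph. A *split* of $G=(V,E)$ is a partition $\{V_1,V_2\}$ of $V$ with $|V_1|,|V_2|>1$ such that every vertex of $V_1$ that has a neighbour in $V_2$ is adjacent to every vertex of $V_2$ that has a neighbour in $V_1$; a graph without a split is *prime*. The split gives the *simple split decomposition* $\{G_1,G_2\}$, where $G_i$ is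 $G[V_i]$ together with a new vertex $m$ (the *marker*, the same in both graphs) adjacent to those vertices of $V_i$ that have a neighbour in the other part. A *split decomposition* of $G$ is $\{G\}$ or any set of graphs obtained from $\{G\}$ by repeatedly replacing a graph by the two graphs of one of its simple split decompositions, always with a new marker; a decomposition is a *strict refinement* of another one if it is obtained from it by at least one such replacement. A *standard split decomposition* of $G$ is a split decomposition that contains only prime graphs, cliques and stars and is not a strict refinement of another such split decomposition of $G$. The *tree* of a decomposition has the graphs of the decomposition as nodes, two of them being joined by an edge if they share a marker; its leaves are its nodes of degree one. A *pruned decomposition tree* of $G$ is obtained from the tree of a standard split decomposition of $G$ by repeatedly removing a leaf whose marker vertex is universal (adjacent to all other vertices) in the graph at that leaf, until no such leaf remains; when a leaf is removed, the other copy of its marker becomes an ordinary vertex. Theorem. Let $G$ be a connected distance hereditary graph that is not a clique. Then $G$ is a $k$-polygon graph for some $k\ge 2$, $G$ has a pruned decomposition tree, and $$\psi(G)=an(G).$$ Moreover, for every pruned decomposition tree $T'$ of $G$, if $T'$ has at least two nodes, then $\psi(G)=an(G)$ is equal to the number of leaves of $T'$; and if $T'$ has only one node, then $\psi(G)=an(G)=2$.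 -/

import Mathlib

namespace DHPolygon

/-! ### Distance hereditary graphs and asteroidal sets -/

/-- Every connected induced subgraph of `G` is isometric in `G`. -/
def IsDistanceHereditary {V : Type*} (G : SimpleGraph V) : Prop :=
  ∀ S : Set V, (G.induce S).Connected → ∀ x y : S, (G.induce S).dist x y = G.dist x y

/-- The vertex set of `G - N[a]`. -/
def outside {V : Type*} (G : SimpleGraph V) (a : V) : Set V :=
  {x | x ≠ a ∧ ¬ G.Adj a x}

/-- `A` is asteroidal: for every `a ∈ A`, any `x, y ∈ A \ {a}` are vertices of `G - N[a]`
joined by a path in that graph. -/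
def IsAsteroidal {V : Type*} (G : SimpleGraph V) (A : Set V) : Prop :=
  ∀ a ∈ A, ∀ x ∈ A \ {a}, ∀ y ∈ A \ {a},
    ∃ (hx : x ∈ outside G a) (hy : y ∈ outside G a),
      (G.induce (outside G a)).Reachable ⟨x, hx⟩ ⟨y, hy⟩

/-- The largest cardinality of an asteroidal set (of a finite graph). -/
noncomputable def asteroidalNumber {V : Type*} (G : SimpleGraph V) : ℕ :=
  sSup {n | ∃ A : Set V, IsAsteroidal G A ∧ A.ncard = n}

/-! ### Permutation graphs, polygon graphs, the polygon number -/

/-- For some numbering of the vertices and some permutation `π`, the vertices numbered `i` and `j`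
are adjacent exactly when `(i - j) * (π⁻¹ i - π⁻¹ j) < 0`. -/
def IsPermutationGraph {V : Type*} (G : SimpleGraph V) : Prop :=
  ∃ (n : ℕ) (e : V ≃ Fin n) (π : Equiv.Perm (Fin n)), ∀ u v : V,
    G.Adj u v ↔
      (((e u : ℕ) : ℤ) - ((e v : ℕ) : ℤ)) *
        (((π.symm (e u) : ℕ) : ℤ) - ((π.symm (e v) : ℕ) : ℤ)) < 0

/-- Twice the signed area of the triangle `p q r`; it is positive when `p, q, r` is a left turn. -/
def cross (p q r : ℝ × ℝ) : ℝ :=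
  (q.1 - p.1) * (r.2 - p.2) - (q.2 - p.2) * (r.1 - p.1)

/-- The vertices are the corners of a (strictly) convex polygon in counterclockwise order. -/
def IsConvexPolygon {k : ℕ} (P : Polygon (ℝ × ℝ) k) : Prop :=
  ∀ i j l : Fin k, i < j → j < l → 0 < cross (P i) (P j) (P l)

/-- The `i`-th side of the polygon, without its two corners. -/
def openSide {k : ℕ} (P : Polygon (ℝ × ℝ) k) (i : Fin k) : Set (ℝ × ℝ) :=
  openSegment ℝ (P i) (P (finRotate k i))

/-- The segments `[a v, b v]` are chords of the polygon `P`, each with its endpoints on two distinct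
sides, whose intersection graph is `G`. All endpoints are distinct, and none is a corner. -/
structure IsPolygonRepresentation {V : Type*} (G : SimpleGraph V) {k : ℕ}
    (P : Polygon (ℝ × ℝ) k) (a b : V → ℝ × ℝ) : Prop where
  endpoints_on_sides : ∀ v, ∃ i j : Fin k, i ≠ j ∧ a v ∈ openSide P i ∧ b v ∈ openSide P j
  endpoints_distinct : Function.Injective (Sum.elim a b)
  adj_iff : ∀ u v, G.Adj u v ↔ u ≠ v ∧ (segment ℝ (a u) (b u) ∩ segment ℝ (a v) (b v)).Nonempty

/-- `G` is a `k`-polygon graph: a permutation graph if `k = 2`, the intersection graph of chords of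
a convex polygon with `k` sides if `3 ≤ k`. The notion is only used for `2 ≤ k`. -/
def IsPolygonGraph {V : Type*} (k : ℕ) (G : SimpleGraph V) : Prop :=
  (k = 2 ∧ IsPermutationGraph G) ∨
    (3 ≤ k ∧ ∃ (P : Polygon (ℝ × ℝ) k) (a b : V → ℝ × ℝ),
      IsConvexPolygon P ∧ IsPolygonRepresentation G P a b)

/-- The least `k` such that `G` is a `k`-polygon graph (meaningful if there is such a `k`). -/
noncomputable def polygonNumber {V : Type*} (G : SimpleGraph V) : ℕ :=
  sInf {k | IsPolygonGraph k G}

/-! ### Split decompositions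

The graphs of a split decomposition have their vertices in `V ⊕ ℕ`: `Sum.inl v` is the vertex `v` of
the graph that is decomposed, and the elements `Sum.inr m` serve as marker vertices. -/

/-- Graphs on a set of vertices contained in `V ⊕ ℕ`. -/
abbrev Node (V : Type*) : Type _ := (⊤ : SimpleGraph (V ⊕ ℕ)).Subgraph

/-- The neighbourhood of the set `W` in `H`: the vertices outside `W` with a neighbour in `W`. -/
def nbhd {V : Type*} (H : Node V) (W : Set (V ⊕ ℕ)) : Set (V ⊕ ℕ) :=
  {x | x ∈ H.verts \ W ∧ ∃ w ∈ W, H.Adj w x}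

/-- `{A, B}` is a split of `H`. -/
structure IsSplit {V : Type*} (H : Node V) (A B : Set (V ⊕ ℕ)) : Prop where
  union_eq : A ∪ B = H.verts
  disjoint : Disjoint A B
  left_nontrivial : A.Nontrivial
  right_nontrivial : B.Nontrivial
  adj_iff : ∀ x ∈ A, ∀ y ∈ B, H.Adj x y ↔ x ∈ nbhd H B ∧ y ∈ nbhd H A

def IsPrime {V : Type*} (H : Node V) : Prop :=
  ¬ ∃ A B, IsSplit H A B

def IsCliqueNode {V : Type*} (H : Node V) : Prop :=
  ∀ x ∈ H.verts, ∀ y ∈ H.verts, x ≠ y → H.Adj x y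

/-- `H` is a star: its edges are the pairs consisting of a centre `c` and any other vertex. -/
def IsStarNode {V : Type*} (H : Node V) : Prop :=
  ∃ c ∈ H.verts, ∀ x ∈ H.verts, ∀ y ∈ H.verts, H.Adj x y ↔ x ≠ y ∧ (x = c ∨ y = c)

/-- `H[A]` together with the additional vertex `m`, whose neighbourhood is `N`.
It is used with `m ∉ A` and `N ⊆ A`. -/
def addMarker {V : Type*} (H : Node V) (A : Set (V ⊕ ℕ)) (m : V ⊕ ℕ) (N : Set (V ⊕ ℕ)) :
    Node V where
  verts := insert m (A ∩ H.verts)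
  Adj x y :=
    (x ∈ A ∧ y ∈ A ∧ H.Adj x y) ∨
      (x = m ∧ y ≠ m ∧ y ∈ N ∩ A ∩ H.verts) ∨ (y = m ∧ x ≠ m ∧ x ∈ N ∩ A ∩ H.verts)
  adj_sub := by
    rintro x y (⟨-, -, h⟩ | ⟨rfl, h, -⟩ | ⟨rfl, h, -⟩)
    · exact H.adj_sub h
    · exact h.symm
    · exact h
  edge_vert := by
    rintro x y (⟨hx, -, h⟩ | ⟨rfl, -, -⟩ | ⟨-, -, h⟩)
    · exact Or.inr ⟨hx, H.edge_vert h⟩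
    · exact Or.inl rfl
    · exact Or.inr ⟨h.1.2, h.2⟩
  symm := by
    refine ⟨?_⟩
    rintro x y (⟨hx, hy, h⟩ | h | h)
    · exact Or.inl ⟨hy, hx, h.symm⟩
    · exact Or.inr (Or.inr h)
    · exact Or.inr (Or.inl h)

/-- `D'` arises from `D` when one graph `H` of `D` is replaced by the two graphs of one of its simple
split decompositions, with a new marker vertex. -/
def SplitStep {V : Type*} (D D' : Set (Node V)) : Prop :=
  ∃ H ∈ D, ∃ A B : Set (V ⊕ ℕ), IsSplit H A B ∧
    ∃ m : ℕ, (∀ K ∈ D, Sum.inr m ∉ K.verts) ∧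
      D' = (D \ {H}) ∪ {addMarker H A (Sum.inr m) (nbhd H B), addMarker H B (Sum.inr m) (nbhd H A)}

/-- The graph `G`, as a graph on the vertices `Sum.inl v`. -/
def toNode {V : Type*} (G : SimpleGraph V) : Node V where
  verts := Set.range Sum.inl
  Adj x y := ∃ u v, G.Adj u v ∧ Sum.inl u = x ∧ Sum.inl v = y
  adj_sub := by
    rintro _ _ ⟨u, v, h, rfl, rfl⟩
    exact fun e => h.ne (Sum.inl_injective e)
  edge_vert := by
    rintro _ _ ⟨u, v, h, rfl, rfl⟩
    exact ⟨u, rfl⟩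
  symm := by
    refine ⟨?_⟩
    rintro _ _ ⟨u, v, h, rfl, rfl⟩
    exact ⟨v, u, h.symm, rfl, rfl⟩

/-- `D` is a split decomposition of `G`. -/
def IsSplitDecomposition {V : Type*} (G : SimpleGraph V) (D : Set (Node V)) : Prop :=
  Relation.ReflTransGen SplitStep {toNode G} D

/-- `D` is a split decomposition of `G` that contains only prime graphs, cliques and stars. -/
def IsGoodDecomposition {V : Type*} (G : SimpleGraph V) (D : Set (Node V)) : Prop :=
  IsSplitDecomposition G D ∧ ∀ H ∈ D, IsPrime H ∨ IsCliqueNode H ∨ IsStarNode H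

/-- `D` is a standard split decomposition of `G`: it contains only prime graphs, cliques and stars,
and it is not a strict refinement of another such split decomposition of `G`. -/
def IsStandardDecomposition {V : Type*} (G : SimpleGraph V) (D : Set (Node V)) : Prop :=
  IsGoodDecomposition G D ∧
    ¬ ∃ D', IsGoodDecomposition G D' ∧ Relation.TransGen SplitStep D' D

/-! ### The decomposition tree and its pruning -/

/-- The tree of a decomposition: its nodes are the graphs of `D`, and two of them are joined by an
edge if they share a (marker) vertex. -/
def decompositionTree {V : Type*} (D : Set (Node V)) : SimpleGraph D where
  Adj H K := H ≠ K ∧ (H.1.verts ∩ K.1.verts).Nonempty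
  symm := ⟨fun _ _ h => ⟨h.1.symm, by rw [Set.inter_comm]; exact h.2⟩⟩
  loopless := ⟨fun _ h => h.1 rfl⟩

/-- The node `H` has degree one in the decomposition tree. -/
def IsLeaf {V : Type*} (D : Set (Node V)) (H : D) : Prop :=
  ((decompositionTree D).neighborSet H).ncard = 1

/-- The number of leaves (nodes of degree one) of the decomposition tree. -/
noncomputable def numLeaves {V : Type*} (D : Set (Node V)) : ℕ :=
  {H : D | IsLeaf D H}.ncard

/-- `l` is a marker vertex of the graph `H` of `D`: it is shared with another graph of `D`. When a
leaf is removed from `D`, the other copy of its marker vertex thus becomes an ordinary vertex. -/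
def IsMarkerOf {V : Type*} (D : Set (Node V)) (H : Node V) (l : V ⊕ ℕ) : Prop :=
  l ∈ H.verts ∧ ∃ K ∈ D, K ≠ H ∧ l ∈ K.verts

/-- `D'` arises from `D` by the removal of a leaf in which the marker vertex is universal. -/
def PruneStep {V : Type*} (D D' : Set (Node V)) : Prop :=
  ∃ H : D, IsLeaf D H ∧
    (∃ l, IsMarkerOf D H.1 l ∧ ∀ x ∈ H.1.verts, x ≠ l → H.1.Adj l x) ∧ D' = D \ {H.1}

/-- `D` is (the set of nodes of) a pruned decomposition tree of `G`: it results from a standard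
split decomposition of `G` by prune steps, and no further prune step is possible. -/
def IsPrunedDecomposition {V : Type*} (G : SimpleGraph V) (D : Set (Node V)) : Prop :=
  (∃ D₀, IsStandardDecomposition G D₀ ∧ Relation.ReflTransGen PruneStep D₀ D) ∧
    ¬ ∃ D', PruneStep D D'

end DHPolygon

/-!
The lower bound on the polygon number, `an(G) ≤ k` for every `k`-polygon graph `G`, holds for all
graphs: a chord of an asteroidal set has all the other chords of the set on one of its sides,
hence a corner of the polygon to itself on the other side, and in a permutation diagram one of
three pairwise nonadjacent vertices separates the other two
(`asteroidalNumber_le_of_isPolygonGraph`). It remains to show that a pruned decomposition `D` of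
`G` with `k` leaves gives both a representation of `G` in a polygon with `k` sides and an
asteroidal set of size `k`.

Split decompositions are handled through the inverse operation. `glue N₁ N₂ m` joins two graphs at
a common marker `m`, and `Dec N D` says that the graphs in `D` can be glued along a tree to give
`N`. For a connected graph `G`, the split decompositions of `G` are the sets `D` with `Dec (toNode
G) D` (`IsSplitDecomposition.dec`, `Dec.isSplitDecomposition`). Each graph in `D` is an induced
subgraph of `N` (`Dec.node_emb`), every leaf can be split off (`Dec.peel`), and two neighbours in
the tree can be glued (`Dec.merge`). The last fact shows that in a standard decomposition no
marker is a leaf of one star and the centre of another (`IsStandardDecomposition.no_star_star`),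
since the two would form a single star.

A connected distance hereditary graph with at least four vertices has a split
(`IsDistanceHereditary.exists_split`). Thus all graphs of a standard decomposition are cliques and
stars.

*Representation.* A chord diagram on a circle may carry corners next to the ends of the chords of
some tagged vertices (`IsDiagram`). Such a diagram allows twins to be added anywhere and pendant
vertices at tagged vertices, where the tag may move to the new vertex. As a clique or star
attached at a marker `l` arises from `l` in this way (`HasDiagram.attach`), a diagram can be built
along the tree as soon as each leaf has a tag (`Dec.hasDiagram`), and it gives a polygon
representation with as many corners as tags (`isPolygonGraph_of_ends`). The graphs removed by
pruning are attached at a universal vertex and need no additional tag (`IsPruned.step`).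

*Asteroidal set.* A leaf of the pruned tree is a star whose marker is not the centre. A vertex `a`
of this star other than the marker and the centre `c` has the closed neighbourhood `{a, c}`, and
the rest of the tree stays connected without the marker, because the neighbouring graph is not a
star centred at the marker (`Dec.reflTransGen_adjOutside`). One such vertex from each leaf
therefore gives an asteroidal set (`IsPruned.numLeaves_le`).
-/

namespace DHPolygon

/-! ### Asteroidal sets in polygon graphs -/

lemma cross_rotate (p q r : ℝ × ℝ) : cross p q r = cross q r p := by
  simp only [cross]; ring

lemma cross_combo (p q x y : ℝ × ℝ) {s t : ℝ} (h : s + t = 1) :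
    cross p q (s • x + t • y) = s * cross p q x + t * cross p q y := by
  obtain rfl : s = 1 - t := by linarith
  simp only [cross, Prod.fst_add, Prod.snd_add, Prod.smul_fst, Prod.smul_snd, smul_eq_mul]
  ring

lemma cross_self_left (p q : ℝ × ℝ) : cross p q p = 0 := by simp only [cross]; ring

lemma cross_self_right (p q : ℝ × ℝ) : cross p q q = 0 := by simp only [cross]; ring

lemma finRotate_val {k : ℕ} (i : Fin k) :
    (i.1 + 1 < k ∧ (finRotate k i).1 = i.1 + 1) ∨ (i.1 + 1 = k ∧ (finRotate k i).1 = 0) := by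
  obtain ⟨n, rfl⟩ : ∃ n, k = n + 1 := ⟨k - 1, by have := i.2; omega⟩
  rcases lt_or_ge i.1 n with h | h
  · left
    have := finRotate_of_lt (n := n) (k := i.1) h
    refine ⟨by omega, ?_⟩
    have h2 : i = ⟨i.1, h.trans_le n.le_succ⟩ := rfl
    rw [h2, this]
  · right
    have h1 : i = Fin.last n := Fin.ext (by have := i.2; simp; omega)
    subst h1
    simp

lemma IsConvexPolygon.cross_side_pos {k : ℕ} {P : Polygon (ℝ × ℝ) k}
    (hP : IsConvexPolygon P) (i l : Fin k) (h1 : l ≠ i) (h2 : l ≠ finRotate k i) :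
    0 < cross (P i) (P (finRotate k i)) (P l) := by
  have h1' : l.1 ≠ i.1 := fun h => h1 (Fin.ext h)
  have h2' : l.1 ≠ (finRotate k i).1 := fun h => h2 (Fin.ext h)
  rcases finRotate_val i with ⟨h, e⟩ | ⟨h, e⟩
  · rcases lt_or_gt_of_ne h1' with hl | hl
    · rw [← cross_rotate]
      exact hP l i _ hl (by rw [Fin.lt_def]; omega)
    · exact hP i _ l (by rw [Fin.lt_def]; omega) (by rw [Fin.lt_def]; omega)
  · rw [cross_rotate]
    have := l.2
    exact hP _ l i (by rw [Fin.lt_def]; omega) (by rw [Fin.lt_def]; omega)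

lemma IsConvexPolygon.cross_side_nonneg {k : ℕ} {P : Polygon (ℝ × ℝ) k}
    (hP : IsConvexPolygon P) (i l : Fin k) :
    0 ≤ cross (P i) (P (finRotate k i)) (P l) := by
  by_cases h1 : l = i
  · rw [h1, cross_self_left]
  by_cases h2 : l = finRotate k i
  · rw [h2, cross_self_right]
  exact (hP.cross_side_pos i l h1 h2).le

/-- The closed region bounded by a convex polygon, as the intersection of the half planes to the
left of its sides. -/
def region {k : ℕ} (P : Polygon (ℝ × ℝ) k) : Set (ℝ × ℝ) :=
  {x | ∀ i, 0 ≤ cross (P i) (P (finRotate k i)) x}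

lemma region_combo {k : ℕ} {P : Polygon (ℝ × ℝ) k} {x y : ℝ × ℝ} (hx : x ∈ region P)
    (hy : y ∈ region P) {s t : ℝ} (hs : 0 ≤ s) (ht : 0 ≤ t) (h : s + t = 1) :
    s • x + t • y ∈ region P := by
  intro i
  rw [cross_combo _ _ _ _ h]
  have := mul_nonneg hs (hx i)
  have := mul_nonneg ht (hy i)
  linarith

lemma openSide_subset_region {k : ℕ} {P : Polygon (ℝ × ℝ) k} (hP : IsConvexPolygon P)
    (i : Fin k) : openSide P i ⊆ region P := by
  rintro x ⟨s, t, hs, ht, h, rfl⟩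
  exact region_combo (fun j => hP.cross_side_nonneg j _) (fun j => hP.cross_side_nonneg j _)
    hs.le ht.le h

lemma cross_side_openSide_self {k : ℕ} {P : Polygon (ℝ × ℝ) k} {i : Fin k} {p : ℝ × ℝ}
    (hp : p ∈ openSide P i) : cross (P i) (P (finRotate k i)) p = 0 := by
  obtain ⟨s, t, hs, ht, h, rfl⟩ := hp
  rw [cross_combo _ _ _ _ h, cross_self_left, cross_self_right]
  simp

lemma cross_side_openSide_pos {k : ℕ} (hk : 3 ≤ k) {P : Polygon (ℝ × ℝ) k}
    (hP : IsConvexPolygon P) {i j : Fin k} (hij : j ≠ i) {p : ℝ × ℝ} (hp : p ∈ openSide P j) :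
    0 < cross (P i) (P (finRotate k i)) p := by
  obtain ⟨s, t, hs, ht, h, rfl⟩ := hp
  rw [cross_combo _ _ _ _ h]
  have a1 := mul_nonneg hs.le (hP.cross_side_nonneg i j)
  have a2 := mul_nonneg ht.le (hP.cross_side_nonneg i (finRotate k j))
  by_cases h2 : j = finRotate k i
  · have := mul_pos ht (hP.cross_side_pos i (finRotate k j) ?_ ?_)
    · linarith
    · intro h3
      have h3' := congrArg Fin.val h3
      have h2' := congrArg Fin.val h2
      rcases finRotate_val i with ⟨_, _⟩ | ⟨_, _⟩ <;>
        rcases finRotate_val j with ⟨_, _⟩ | ⟨_, _⟩ <;> omega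
    · intro h3
      exact hij ((finRotate k).injective h3)
  · have := mul_pos hs (hP.cross_side_pos i j hij h2)
    linarith

/-- The line through two points on different sides of a convex polygon meets the region of the
polygon only in the chord between them: a point beyond `p` would be on the wrong side of the line
of the side that contains `p`. -/
lemma mem_segment_of_cross_eq_zero {k : ℕ} (hk : 3 ≤ k) {P : Polygon (ℝ × ℝ) k}
    (hP : IsConvexPolygon P) {i j : Fin k} (hij : i ≠ j) {p q x : ℝ × ℝ}
    (hp : p ∈ openSide P i) (hq : q ∈ openSide P j) (hx : x ∈ region P) (h : cross p q x = 0) :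
    x ∈ segment ℝ p q := by
  have hqi := cross_side_openSide_pos hk hP hij.symm hq
  have hpj := cross_side_openSide_pos hk hP hij hp
  have hpi := cross_side_openSide_self hp
  have hqj := cross_side_openSide_self hq
  obtain ⟨t, rfl⟩ : ∃ t : ℝ, x = (1 - t) • p + t • q := by
    by_cases h1 : q.1 - p.1 = 0
    · have h2 : q.2 - p.2 ≠ 0 := by
        intro h2
        have : q = p := Prod.ext (by linarith) (by linarith)
        rw [this, hpi] at hqi
        exact hqi.false
      refine ⟨(x.2 - p.2) / (q.2 - p.2), ?_⟩
      simp only [cross, h1, zero_mul, zero_sub, neg_eq_zero, mul_eq_zero, h2, false_or] at h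
      ext
      · simp only [Prod.fst_add, Prod.smul_fst, smul_eq_mul]
        field_simp
        linear_combination (q.2 - p.2) * h - (x.2 - p.2) * h1
      · simp only [Prod.snd_add, Prod.smul_snd, smul_eq_mul]
        field_simp
        ring
    · refine ⟨(x.1 - p.1) / (q.1 - p.1), ?_⟩
      simp only [cross] at h
      ext
      · simp only [Prod.fst_add, Prod.smul_fst, smul_eq_mul]
        field_simp
        ring
      · simp only [Prod.snd_add, Prod.smul_snd, smul_eq_mul]
        field_simp
        linear_combination h
  have e1 := hx i
  have e2 := hx j
  rw [cross_combo _ _ _ _ (by ring)] at e1 e2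
  rw [hpi, mul_zero, zero_add] at e1
  rw [hqj, mul_zero, add_zero] at e2
  have t0 := nonneg_of_mul_nonneg_left e1 hqi
  have t1 := nonneg_of_mul_nonneg_left e2 hpj
  exact ⟨1 - t, t, t1, t0, by ring, rfl⟩

/-- Each chord has a corner of the polygon strictly on each side: the two ends of the side that
contains an endpoint of the chord. -/
lemma exists_corner_neg {k : ℕ} (hk : 3 ≤ k) {P : Polygon (ℝ × ℝ) k}
    (hP : IsConvexPolygon P) {i j : Fin k} (hij : i ≠ j) {p q : ℝ × ℝ}
    (hp : p ∈ openSide P i) (hq : q ∈ openSide P j) {σ : ℝ} (hσ : σ ≠ 0) :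
    ∃ c, σ * cross p q (P c) < 0 := by
  have hqi := cross_side_openSide_pos hk hP hij.symm hq
  by_contra! hcon
  obtain ⟨s, t, hs, ht, h, rfl⟩ := hp
  have h0 := cross_self_left (s • P i + t • P (finRotate k i)) q
  rw [cross_combo _ _ _ _ h] at h0
  have a1 := mul_nonneg hs.le (hcon i)
  have a2 := mul_nonneg ht.le (hcon (finRotate k i))
  have h0' : s * (σ * cross (s • P i + t • P (finRotate k i)) q (P i)) +
      t * (σ * cross (s • P i + t • P (finRotate k i)) q (P (finRotate k i))) = 0 := by
    linear_combination σ * h0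
  have b1 : s * (σ * cross (s • P i + t • P (finRotate k i)) q (P i)) = 0 := by linarith
  have b2 : cross (s • P i + t • P (finRotate k i)) q (P i) = 0 := by
    rcases mul_eq_zero.1 b1 with h | h
    · exact absurd h hs.ne'
    · exact (mul_eq_zero.1 h).resolve_left hσ
  have b3 : t * cross (P i) (P (finRotate k i)) q = 0 := by
    rw [← b2]
    obtain rfl : s = 1 - t := by linarith
    simp only [cross, Prod.fst_add, Prod.snd_add, Prod.smul_fst, Prod.smul_snd, smul_eq_mul]
    ring
  rcases mul_eq_zero.1 b3 with h | h
  · exact ht.ne' h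
  · exact hqi.ne' h

lemma cross_segment_pos {p q a b : ℝ × ℝ} {σ : ℝ} (ha : 0 < σ * cross p q a)
    (hb : 0 < σ * cross p q b) : ∀ x ∈ segment ℝ a b, 0 < σ * cross p q x := by
  rintro x ⟨s, t, hs, ht, h, rfl⟩
  rw [cross_combo _ _ _ _ h]
  rcases hs.eq_or_lt with rfl | hs
  · obtain rfl : t = 1 := by linarith
    simpa using hb
  · have := mul_pos hs ha
    have := mul_nonneg ht hb.le
    nlinarith

lemma exists_cross_eq_zero {p q a b : ℝ × ℝ} {σ : ℝ} (ha : σ * cross p q a < 0)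
    (hb : 0 < σ * cross p q b) :
    ∃ s t : ℝ, 0 < s ∧ 0 < t ∧ s + t = 1 ∧ cross p q (s • a + t • b) = 0 := by
  have hd : 0 < σ * cross p q b - σ * cross p q a := by linarith
  refine ⟨σ * cross p q b / (σ * cross p q b - σ * cross p q a),
    -(σ * cross p q a) / (σ * cross p q b - σ * cross p q a), by positivity,
    div_pos (by linarith) hd, ?_, ?_⟩
  · rw [← add_div, div_eq_one_iff_eq hd.ne']
    ring
  · rw [cross_combo]
    · field_simp; ring
    · rw [← add_div, div_eq_one_iff_eq hd.ne']
      ring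

/-- A chord that is disjoint from the chord of `a` lies strictly on one side of it, and chords in
one component of `G - N[a]` lie on the same side. -/
lemma IsPolygonRepresentation.exists_side {V : Type*} {G : SimpleGraph V} {k : ℕ} (hk : 3 ≤ k)
    {P : Polygon (ℝ × ℝ) k} {a b : V → ℝ × ℝ} (hP : IsConvexPolygon P)
    (h : IsPolygonRepresentation G P a b) {A : Set V} (hA : IsAsteroidal G A) {v : V}
    (hv : v ∈ A) :
    ∃ σ : ℝ, σ ≠ 0 ∧ ∀ u ∈ A, u ≠ v → ∀ x ∈ segment ℝ (a u) (b u),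
      0 < σ * cross (a v) (b v) x := by
  obtain ⟨i, j, hij, hi, hj⟩ := h.endpoints_on_sides v
  have hreg : ∀ u, ∀ x ∈ segment ℝ (a u) (b u), x ∈ region P := by
    rintro u x ⟨s, t, hs, ht, hst, rfl⟩
    obtain ⟨i, j, hij, hi, hj⟩ := h.endpoints_on_sides u
    exact region_combo (openSide_subset_region hP i hi) (openSide_subset_region hP j hj) hs ht hst
  have hne : ∀ u ∈ outside G v, ∀ x ∈ segment ℝ (a u) (b u), cross (a v) (b v) x ≠ 0 := by
    intro u hu x hx h0
    refine hu.2 ((h.adj_iff v u).2 ⟨hu.1.symm, x, ?_, hx⟩)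
    exact mem_segment_of_cross_eq_zero hk hP hij hi hj (hreg u x hx) h0
  -- a chord that is disjoint from the chord of `v` does not change sides
  have key : ∀ u ∈ outside G v, ∀ σ : ℝ, 0 < σ * cross (a v) (b v) (a u) →
      ∀ x ∈ segment ℝ (a u) (b u), 0 < σ * cross (a v) (b v) x := by
    intro u hu σ hσ
    have hσ0 : σ ≠ 0 := by rintro rfl; simp at hσ
    refine cross_segment_pos hσ ?_
    by_contra! hle
    have hlt : σ * cross (a v) (b v) (b u) < 0 := lt_of_le_of_ne hle
      (mul_ne_zero hσ0 (hne u hu _ (right_mem_segment ℝ _ _)))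
    obtain ⟨s, t, hs, ht, hst, h0⟩ := exists_cross_eq_zero hlt hσ
    refine hne u hu _ ?_ h0
    rw [segment_symm]
    exact ⟨s, t, hs.le, ht.le, hst, rfl⟩
  -- chords that meet lie on the same side
  have conn : ∀ u w : outside G v, (G.induce (outside G v)).Reachable u w →
      ∀ σ : ℝ, 0 < σ * cross (a v) (b v) (a u) → 0 < σ * cross (a v) (b v) (a w) := by
    rintro u w ⟨p⟩ σ
    induction p with
    | nil => exact id
    | @cons u w z hadj p ih =>
      intro hσ
      apply ih
      have hσ0 : σ ≠ 0 := by rintro rfl; simp at hσ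
      obtain ⟨-, x, hx1, hx2⟩ := (h.adj_iff u w).1 hadj
      have h1 := key u u.2 σ hσ x hx1
      by_contra! hle
      have hlt : 0 < (-σ) * cross (a v) (b v) (a w) := by
        have := mul_ne_zero hσ0 (hne w w.2 _ (left_mem_segment ℝ _ (b w)))
        have := lt_of_le_of_ne hle this
        linarith
      have h2 := key w w.2 (-σ) hlt x hx2
      linarith
  by_cases hex : ∃ u ∈ A, u ≠ v
  · obtain ⟨u, hu, huv⟩ := hex
    obtain ⟨hu', -, -⟩ := hA v hv u ⟨hu, huv⟩ u ⟨hu, huv⟩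
    have h0 := hne u hu' _ (left_mem_segment ℝ _ (b u))
    refine ⟨cross (a v) (b v) (a u), h0, fun w hw hwv => ?_⟩
    obtain ⟨hu', hw', hr⟩ := hA v hv u ⟨hu, huv⟩ w ⟨hw, hwv⟩
    exact key w hw' _ (conn _ _ hr _ (mul_self_pos.2 h0))
  · push Not at hex
    exact ⟨1, one_ne_zero, fun u hu huv => absurd (hex u hu) huv⟩

/-- A chord of an asteroidal set has all the others on one side, hence a corner on the other side.
These corners are distinct. -/
lemma IsPolygonRepresentation.asteroidal_ncard_le {V : Type*} {G : SimpleGraph V} {k : ℕ}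
    (hk : 3 ≤ k) {P : Polygon (ℝ × ℝ) k} {a b : V → ℝ × ℝ} (hP : IsConvexPolygon P)
    (h : IsPolygonRepresentation G P a b) {A : Set V} (hA : IsAsteroidal G A) :
    A.ncard ≤ k := by
  have hc : ∀ v : V, ∃ c : Fin k, v ∈ A → ∃ σ : ℝ, σ * cross (a v) (b v) (P c) < 0 ∧
      ∀ u ∈ A, u ≠ v → ∀ x ∈ segment ℝ (a u) (b u), 0 < σ * cross (a v) (b v) x := by
    intro v
    by_cases hv : v ∈ A
    · obtain ⟨σ, hσ, hs⟩ := h.exists_side hk hP hA hv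
      obtain ⟨i, j, hij, hi, hj⟩ := h.endpoints_on_sides v
      obtain ⟨c, hc⟩ := exists_corner_neg hk hP hij hi hj hσ
      exact ⟨c, fun _ => ⟨σ, hc, hs⟩⟩
    · exact ⟨⟨0, by omega⟩, fun h => absurd h hv⟩
  choose c hc using hc
  have := Set.ncard_le_ncard_of_injOn (s := A) (t := (Set.univ : Set (Fin k))) c
    (fun _ _ => Set.mem_univ _) ?_ Set.finite_univ
  · simpa using this
  intro v hv w hw hvw
  by_contra hne
  obtain ⟨σ, h1, h2⟩ := hc v hv
  obtain ⟨τ, h3, h4⟩ := hc w hw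
  rw [← hvw] at h3
  have h5 := h2 w hw (Ne.symm hne) _ (left_mem_segment ℝ _ _)
  obtain ⟨s, t, hs, ht, hst, h0⟩ := exists_cross_eq_zero h1 h5
  obtain ⟨i, j, hij, hi, hj⟩ := h.endpoints_on_sides v
  obtain ⟨i', j', hij', hi', hj'⟩ := h.endpoints_on_sides w
  have hx := mem_segment_of_cross_eq_zero hk hP hij hi hj
    (region_combo (fun l => hP.cross_side_nonneg l _) (openSide_subset_region hP _ hi')
      hs.le ht.le hst) h0
  have h6 := h4 v hv hne _ hx
  rw [cross_combo _ _ _ _ hst, cross_self_left] at h6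
  have := mul_neg_of_pos_of_neg hs h3
  nlinarith

/-- In a permutation diagram, one of three pairwise nonadjacent vertices separates the other two. -/
lemma IsPermutationGraph.asteroidal_ncard_le {V : Type*} [Finite V] {G : SimpleGraph V}
    (h : IsPermutationGraph G) {A : Set V} (hA : IsAsteroidal G A) : A.ncard ≤ 2 := by
  obtain ⟨n, e, π, h⟩ := h
  by_contra! hcon
  rw [Set.two_lt_ncard] at hcon
  set f : V → ℤ := fun v => ((e v : ℕ) : ℤ) with hf
  set g : V → ℤ := fun v => ((π.symm (e v) : ℕ) : ℤ) with hg
  have hfi : Function.Injective f := fun u v huv => e.injective (Fin.ext (by simpa [hf] using huv))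
  have hgi : Function.Injective g := fun u v huv =>
    e.injective (π.symm.injective (Fin.ext (by simpa [hg] using huv)))
  replace h : ∀ u v, G.Adj u v ↔ (f u - f v) * (g u - g v) < 0 := h
  have key : ∀ u v, u ≠ v → (¬ G.Adj u v ↔ (f u < f v ∧ g u < g v) ∨ (f v < f u ∧ g v < g u)) := by
    intro u v huv
    have h1 := hfi.ne huv
    have h2 := hgi.ne huv
    rw [h]
    constructor
    · intro h3
      rcases lt_or_gt_of_ne h1 with h1 | h1 <;> rcases lt_or_gt_of_ne h2 with h2 | h2
      · exact Or.inl ⟨h1, h2⟩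
      · exact absurd (mul_neg_of_neg_of_pos (by linarith) (by linarith)) h3
      · exact absurd (mul_neg_of_pos_of_neg (by linarith) (by linarith)) h3
      · exact Or.inr ⟨h1, h2⟩
    · rintro (⟨h3, h4⟩ | ⟨h3, h4⟩)
      · have := mul_pos_of_neg_of_neg (sub_neg.2 h3) (sub_neg.2 h4)
        linarith
      · have := mul_pos (sub_pos.2 h3) (sub_pos.2 h4)
        linarith
  have sep : ∀ b : V, ∀ x y : outside G b, (G.induce (outside G b)).Reachable x y →
      f x < f b → f y < f b := by
    rintro b x y ⟨p⟩
    induction p with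
    | nil => exact id
    | @cons x y z hadj p ih =>
      intro hx
      apply ih
      by_contra! hle
      have hy := (key b y y.2.1.symm).1 y.2.2
      have hx' := (key b x x.2.1.symm).1 x.2.2
      have := (h x y).1 hadj
      have h1 : g y > g b := by omega
      have h2 : g x < g b := by omega
      nlinarith
  have mid : ∀ b ∈ A, ∀ x ∈ A, ∀ y ∈ A, f x < f b → f b < f y → False := by
    intro b hb x hx y hy h1 h2
    obtain ⟨hx', hy', hr⟩ := hA b hb x ⟨hx, by rintro rfl; omega⟩ y ⟨hy, by rintro rfl; omega⟩
    have := sep b _ _ hr h1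
    simp only at this
    omega
  obtain ⟨x, hx, y, hy, z, hz, hxy, hxz, hyz⟩ := hcon
  have := hfi.ne hxy
  have := hfi.ne hxz
  have := hfi.ne hyz
  have := mid x hx y hy z hz
  have := mid x hx z hz y hy
  have := mid y hy x hx z hz
  have := mid y hy z hz x hx
  have := mid z hz y hy x hx
  have := mid z hz x hx y hy
  grind

theorem asteroidalNumber_le_of_isPolygonGraph {V : Type*} [Finite V] {G : SimpleGraph V} {k : ℕ}
    (h : IsPolygonGraph k G) : asteroidalNumber G ≤ k := by
  refine csSup_le ⟨0, ∅, by simp [IsAsteroidal], by simp⟩ ?_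
  rintro n ⟨A, hA, rfl⟩
  rcases h with ⟨rfl, h⟩ | ⟨hk, P, a, b, hP, h⟩
  · exact h.asteroidal_ncard_le hA
  · exact h.asteroidal_ncard_le hk hP hA

/-! ### From chord diagrams to polygon representations -/

/-- The points `a` and `b` of the real line, taken as a circle with the point `∞`, separate `c`
from `∞`. For distinct points, the chords `{a, b}` and `{c, d}` cross when this holds for exactly
one of `c` and `d`. -/
def Sep (a b c : ℝ) : Prop := ¬ (a < c ↔ b < c)

/-- The `j`-th corner of a polygon with `k` corners on a parabola. The index `k` stands for the
corner `0`. -/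
noncomputable def corner (k j : ℕ) : ℝ × ℝ := if j < k then ((j : ℝ), (j : ℝ) ^ 2) else (0, 0)

/-- The point that divides the `j`-th side of that polygon in the ratio `s : 1 - s`. -/
noncomputable def sidePoint (k j : ℕ) (s : ℝ) : ℝ × ℝ :=
  (1 - s) • corner k j + s • corner k (j + 1)

lemma cross_corner {k a b c : ℕ} (ha : a < k) (hb : b < k) (hc : c < k) :
    cross (corner k a) (corner k b) (corner k c) =
      ((b : ℝ) - a) * ((c : ℝ) - a) * ((c : ℝ) - b) := by
  simp only [cross, corner, ha, hb, hc, if_true]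
  ring

lemma cross_self_first (p q : ℝ × ℝ) : cross p p q = 0 := by simp only [cross]; ring

lemma corner_self {k : ℕ} (hk : 0 < k) : corner k k = corner k 0 := by
  simp [corner, hk]

lemma cross_corner_pos {k a b c : ℕ} (hab : a < b) (hbc : b < c) (hc : c ≤ k)
    (h : ¬ (a = 0 ∧ c = k)) : 0 < cross (corner k a) (corner k b) (corner k c) := by
  have h1 : (a : ℝ) < b := by exact_mod_cast hab
  rcases hc.lt_or_eq with hc | rfl
  · rw [cross_corner (by omega) (by omega) hc]
    have h2 : (b : ℝ) < c := by exact_mod_cast hbc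
    exact mul_pos (mul_pos (by linarith) (by linarith)) (by linarith)
  · rw [corner_self (by omega), ← cross_rotate, cross_corner (by omega) (by omega) (by omega)]
    have h2 : (0 : ℝ) < a := by
      have : 0 < a := by omega
      exact_mod_cast this
    push_cast
    exact mul_pos (mul_pos (by linarith) (by linarith)) (by linarith)

lemma cross_corner_nonneg {k a b c : ℕ} (hab : a ≤ b) (hbc : b ≤ c) (hc : c ≤ k) :
    0 ≤ cross (corner k a) (corner k b) (corner k c) := by
  rcases hab.lt_or_eq with hab | rfl
  · rcases hbc.lt_or_eq with hbc | rfl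
    · by_cases h : a = 0 ∧ c = k
      · obtain ⟨rfl, rfl⟩ := h
        rw [corner_self (by omega), ← cross_rotate, cross_self_first]
      · exact (cross_corner_pos hab hbc hc h).le
    · rw [cross_self_right]
  · rw [← cross_rotate, cross_self_right]

lemma cross_sidePoint_pos {k i j l : ℕ} (hk : 3 ≤ k) (hij : i ≤ j) (hjl : j ≤ l) (hil : i ≠ l)
    (hl : l < k) {s t u : ℝ} (hs : 0 < s) (hs' : s < 1) (ht : 0 < t) (ht' : t < 1) (hu : 0 < u)
    (hu' : u < 1) (hst : i = j → s < t) (htu : j = l → t < u) :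
    0 < cross (sidePoint k i s) (sidePoint k j t) (sidePoint k l u) := by
  have s1 : 0 < 1 - s := by linarith
  have t1 : 0 < 1 - t := by linarith
  have u1 : 0 < 1 - u := by linarith
  -- the area is affine in each point, which reduces the claim to triangles of corners
  rcases hij.lt_or_eq with hij | rfl
  · rcases hjl.lt_or_eq with hjl | rfl
    · rw [show cross (sidePoint k i s) (sidePoint k j t) (sidePoint k l u) =
        (1 - s) * (1 - t) * (1 - u) * cross (corner k i) (corner k j) (corner k l) +
        (1 - s) * (1 - t) * u * cross (corner k i) (corner k j) (corner k (l + 1)) +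
        (1 - s) * t * (1 - u) * cross (corner k i) (corner k (j + 1)) (corner k l) +
        (1 - s) * t * u * cross (corner k i) (corner k (j + 1)) (corner k (l + 1)) +
        s * (1 - t) * (1 - u) * cross (corner k (i + 1)) (corner k j) (corner k l) +
        s * (1 - t) * u * cross (corner k (i + 1)) (corner k j) (corner k (l + 1)) +
        s * t * (1 - u) * cross (corner k (i + 1)) (corner k (j + 1)) (corner k l) +
        s * t * u * cross (corner k (i + 1)) (corner k (j + 1)) (corner k (l + 1)) by
        simp only [cross, sidePoint, Prod.fst_add, Prod.snd_add, Prod.smul_fst, Prod.smul_snd,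
          smul_eq_mul]
        ring]
      have e0 := cross_corner_pos (k := k) hij hjl hl.le (by omega)
      have e1 := cross_corner_nonneg (k := k) (a := i) (b := j) (c := l + 1)
        (by omega) (by omega) (by omega)
      have e2 := cross_corner_nonneg (k := k) (a := i) (b := j + 1) (c := l)
        (by omega) (by omega) (by omega)
      have e3 := cross_corner_nonneg (k := k) (a := i) (b := j + 1) (c := l + 1)
        (by omega) (by omega) (by omega)
      have e4 := cross_corner_nonneg (k := k) (a := i + 1) (b := j) (c := l)
        (by omega) (by omega) (by omega)
      have e5 := cross_corner_nonneg (k := k) (a := i + 1) (b := j) (c := l + 1)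
        (by omega) (by omega) (by omega)
      have e6 := cross_corner_nonneg (k := k) (a := i + 1) (b := j + 1) (c := l)
        (by omega) (by omega) (by omega)
      have e7 := cross_corner_nonneg (k := k) (a := i + 1) (b := j + 1) (c := l + 1)
        (by omega) (by omega) (by omega)
      positivity
    · rw [show cross (sidePoint k i s) (sidePoint k j t) (sidePoint k j u) =
        (u - t) * ((1 - s) * cross (corner k i) (corner k j) (corner k (j + 1)) +
          s * cross (corner k (i + 1)) (corner k j) (corner k (j + 1))) by
        simp only [cross, sidePoint, Prod.fst_add, Prod.snd_add, Prod.smul_fst, Prod.smul_snd,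
          smul_eq_mul]
        ring]
      refine mul_pos (by linarith [htu rfl]) ?_
      by_cases h : i = 0 ∧ j + 1 = k
      · have := cross_corner_pos (k := k) (a := 0) (b := 1) (c := j) (by omega) (by omega)
          (by omega) (by omega)
        obtain ⟨rfl, rfl⟩ := h
        rw [corner_self (by omega), cross_self_left,
          ← cross_rotate (corner _ 0) (corner _ (0 + 1))]
        simp only [zero_add]
        positivity
      · have e1 := cross_corner_pos (k := k) (a := i) (b := j) (c := j + 1) hij (by omega)
          (by omega) h
        have e2 := cross_corner_nonneg (k := k) (a := i + 1) (b := j) (c := j + 1) hij (by omega)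
          (by omega)
        positivity
  · have hjl : i < l := by omega
    rw [show cross (sidePoint k i s) (sidePoint k i t) (sidePoint k l u) =
        (t - s) * ((1 - u) * cross (corner k i) (corner k (i + 1)) (corner k l) +
          u * cross (corner k i) (corner k (i + 1)) (corner k (l + 1))) by
        simp only [cross, sidePoint, Prod.fst_add, Prod.snd_add, Prod.smul_fst, Prod.smul_snd,
          smul_eq_mul]
        ring]
    refine mul_pos (by linarith [hst rfl]) ?_
    by_cases h : i + 1 = l
    · have e1 := cross_corner_pos (k := k) (a := i) (b := i + 1) (c := l + 1) (by omega) (by omega)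
        (by omega) (by omega)
      have e2 := cross_corner_nonneg (k := k) (a := i) (b := i + 1) (c := l) (by omega) (by omega)
        (by omega)
      positivity
    · have e1 := cross_corner_pos (k := k) (a := i) (b := i + 1) (c := l) (by omega) (by omega)
        (by omega) (by omega)
      have e2 := cross_corner_nonneg (k := k) (a := i) (b := i + 1) (c := l + 1) (by omega)
        (by omega) (by omega)
      positivity

lemma segments_meet {p q r s : ℝ × ℝ} (h1 : cross p q r < 0) (h2 : 0 < cross p q s)
    (h3 : 0 < cross r s p) (h4 : cross r s q < 0) :
    (segment ℝ p q ∩ segment ℝ r s).Nonempty := by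
  have d1 : 0 < cross p q s - cross p q r := by linarith
  have d2 : cross r s p - cross r s q = cross p q s - cross p q r := by
    simp only [cross]; ring
  refine ⟨(cross p q s / (cross p q s - cross p q r)) • r +
    (- cross p q r / (cross p q s - cross p q r)) • s, ?_, _, _, by positivity,
      div_nonneg (by linarith) d1.le, ?_, rfl⟩
  · refine ⟨- cross r s q / (cross p q s - cross p q r), cross r s p / (cross p q s - cross p q r),
      div_nonneg (by linarith) d1.le, by positivity, ?_, ?_⟩
    · rw [← add_div, div_eq_one_iff_eq d1.ne']; linarith
    · have d3 := d1.ne'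
      ext
      · simp only [Prod.fst_add, Prod.smul_fst, smul_eq_mul]
        field_simp
        simp only [cross]; ring
      · simp only [Prod.snd_add, Prod.smul_snd, smul_eq_mul]
        field_simp
        simp only [cross]; ring
  · rw [← add_div, div_eq_one_iff_eq d1.ne']; ring

lemma segments_disjoint {p q r s : ℝ × ℝ} {σ : ℝ} (h1 : 0 < σ * cross p q r)
    (h2 : 0 < σ * cross p q s) : ¬ (segment ℝ p q ∩ segment ℝ r s).Nonempty := by
  rintro ⟨x, ⟨a, b, -, -, hab, rfl⟩, hx⟩
  have := cross_segment_pos h1 h2 _ hx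
  rw [cross_combo _ _ _ _ hab, cross_self_left, cross_self_right] at this
  simp at this

/-- The polygon with `k` corners on a parabola. -/
noncomputable def parabolaPolygon (k : ℕ) : Polygon (ℝ × ℝ) k := ⟨fun i => corner k i⟩

lemma parabolaPolygon_convex (k : ℕ) : IsConvexPolygon (parabolaPolygon k) := by
  intro i j l hij hjl
  refine cross_corner_pos hij hjl l.2.le ?_
  have := l.2
  omega

lemma corner_succ {k : ℕ} (i : Fin k) :
    corner k (i + 1) = parabolaPolygon k (finRotate k i) := by
  change _ = corner k (finRotate k i).1
  rcases finRotate_val i with ⟨h, e⟩ | ⟨h, e⟩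
  · rw [e]
  · rw [e, h, corner_self (by omega)]

lemma sidePoint_mem_openSide {k : ℕ} (i : Fin k) {s : ℝ} (hs : 0 < s) (hs' : s < 1) :
    sidePoint k i s ∈ openSide (parabolaPolygon k) i := by
  refine ⟨1 - s, s, by linarith, hs, by ring, ?_⟩
  rw [← corner_succ]
  rfl

lemma sidePoint_injective {k : ℕ} (hk : 3 ≤ k) {i j : ℕ} (hi : i < k) (hj : j < k) {s t : ℝ}
    (hs : 0 < s) (hs' : s < 1) (ht : 0 < t) (ht' : t < 1)
    (h : sidePoint k i s = sidePoint k j t) : i = j ∧ s = t := by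
  by_cases hij : i = j
  · refine ⟨hij, ?_⟩
    subst hij
    have h1 : (s - t) * ((corner k (i + 1)).1 - (corner k i).1) = 0 := by
      have := congrArg Prod.fst h
      simp only [sidePoint, Prod.fst_add, Prod.smul_fst, smul_eq_mul] at this
      linear_combination this
    rcases mul_eq_zero.1 h1 with h1 | h1
    · linarith
    · exfalso
      rcases (show i + 1 ≤ k by omega).lt_or_eq with h2 | h2
      · simp [corner, h2, hi] at h1
      · have : i ≠ 0 := by omega
        simp [corner, h2, hi, this] at h1
  · exfalso
    have e1 := cross_side_openSide_pos hk (parabolaPolygon_convex k) (i := ⟨j, hj⟩) (j := ⟨i, hi⟩)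
      (by simpa [Fin.ext_iff] using hij) (sidePoint_mem_openSide ⟨i, hi⟩ hs hs')
    have e2 := cross_side_openSide_self (sidePoint_mem_openSide ⟨j, hj⟩ ht ht')
    simp only at e1 e2
    rw [h, e2] at e1
    exact e1.false

/-- The image on the polygon of the point `p` of the line: the number of corners before `p`, which
is positive for the points considered, determines the side. -/
noncomputable def linePoint (K : Finset ℝ) (p : ℝ) : ℝ × ℝ :=
  sidePoint K.card ((K.filter (· < p)).card - 1) (Real.sigmoid p)

lemma card_filter_lt_mono (K : Finset ℝ) {p q : ℝ} (h : p ≤ q) :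
    (K.filter (· < p)).card ≤ (K.filter (· < q)).card :=
  Finset.card_le_card fun x hx => by
    simp only [Finset.mem_filter] at hx ⊢
    exact ⟨hx.1, hx.2.trans_le h⟩

lemma card_filter_lt_strict {K : Finset ℝ} {p q x : ℝ} (hx : x ∈ K) (h1 : p ≤ x) (h2 : x < q) :
    (K.filter (· < p)).card < (K.filter (· < q)).card := by
  apply Finset.card_lt_card
  rw [Finset.ssubset_iff_of_subset]
  · exact ⟨x, by simp [hx, h2], by simp [h1]⟩
  · intro y hy
    simp only [Finset.mem_filter] at hy ⊢
    exact ⟨hy.1, hy.2.trans (h1.trans_lt h2)⟩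

lemma cross_linePoint_pos {K : Finset ℝ} (hk : 3 ≤ K.card) {a b c : ℝ} (hab : a < b) (hbc : b < c)
    (ha : 1 ≤ (K.filter (· < a)).card)
    (h : (K.filter (· < a)).card ≠ (K.filter (· < c)).card) :
    0 < cross (linePoint K a) (linePoint K b) (linePoint K c) := by
  have h1 := card_filter_lt_mono K hab.le
  have h2 := card_filter_lt_mono K hbc.le
  have h3 : (K.filter (· < c)).card ≤ K.card := Finset.card_filter_le _ _
  exact cross_sidePoint_pos hk (by omega) (by omega) (by omega) (by omega)
    (Real.sigmoid_pos _) (Real.sigmoid_lt_one _) (Real.sigmoid_pos _) (Real.sigmoid_lt_one _)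
    (Real.sigmoid_pos _) (Real.sigmoid_lt_one _) (fun _ => Real.sigmoid_strictMono hab)
    (fun _ => Real.sigmoid_strictMono hbc)

lemma linePoint_segments_meet_iff {K : Finset ℝ} (hk : 3 ≤ K.card) {a b c d : ℝ}
    (hab : a < b) (hcd : c < d) (hac : a < c) (hbc : b ≠ c) (hbd : b ≠ d)
    (ha : 1 ≤ (K.filter (· < a)).card)
    (h1 : (K.filter (· < a)).card ≠ (K.filter (· < b)).card)
    (h2 : (K.filter (· < c)).card ≠ (K.filter (· < d)).card) :
    (segment ℝ (linePoint K a) (linePoint K b) ∩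
      segment ℝ (linePoint K c) (linePoint K d)).Nonempty ↔ c < b ∧ b < d := by
  have m1 := card_filter_lt_mono K hab.le
  have m2 := card_filter_lt_mono K hac.le
  have m3 := card_filter_lt_mono K hcd.le
  rcases lt_or_gt_of_ne hbc with hbc | hbc
  · have m4 := card_filter_lt_mono K hbc.le
    have e1 := cross_linePoint_pos hk hab hbc ha (by omega)
    have e2 := cross_linePoint_pos hk hab (hbc.trans hcd) ha (by omega)
    refine iff_of_false (segments_disjoint (σ := 1) (by linarith) (by linarith)) ?_
    intro h
    linarith [h.1]
  · rcases lt_or_gt_of_ne hbd with hbd | hbd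
    · have m4 := card_filter_lt_mono K hbd.le
      have e1 := cross_linePoint_pos hk hac hbc ha (by omega)
      have e2 := cross_linePoint_pos hk hab hbd ha (by omega)
      have e3 := cross_linePoint_pos hk hac hcd ha (by omega)
      have e4 := cross_linePoint_pos hk hbc hbd (by omega) (by omega)
      refine iff_of_true (segments_meet ?_ e2 ?_ ?_) ⟨hbc, hbd⟩
      · have : cross (linePoint K a) (linePoint K b) (linePoint K c) =
          - cross (linePoint K a) (linePoint K c) (linePoint K b) := by simp only [cross]; ring
        linarith
      · rwa [← cross_rotate]
      · have : cross (linePoint K c) (linePoint K d) (linePoint K b) =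
          - cross (linePoint K c) (linePoint K b) (linePoint K d) := by simp only [cross]; ring
        linarith
    · have e1 := cross_linePoint_pos hk hac hbc ha (by omega)
      have e2 := cross_linePoint_pos hk (hac.trans hcd) hbd ha (by omega)
      refine iff_of_false (segments_disjoint (σ := -1) ?_ ?_) ?_
      · have : cross (linePoint K a) (linePoint K b) (linePoint K c) =
          - cross (linePoint K a) (linePoint K c) (linePoint K b) := by simp only [cross]; ring
        linarith
      · have : cross (linePoint K a) (linePoint K b) (linePoint K d) =
          - cross (linePoint K a) (linePoint K d) (linePoint K b) := by simp only [cross]; ring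
        linarith
      · intro h
        linarith [h.2]

lemma exists_rank {V : Type*} [Fintype V] {r : V → ℝ} (hr : Function.Injective r) :
    ∃ e : V ≃ Fin (Fintype.card V), ∀ u v, e u < e v ↔ r u < r v := by
  let _ : LinearOrder V := LinearOrder.lift' r hr
  refine ⟨(Fintype.orderIsoFinOfCardEq V rfl).symm.toEquiv, fun u v => ?_⟩
  exact (Fintype.orderIsoFinOfCardEq V rfl).symm.lt_iff_lt

/-- A chord diagram on the line, with lower ends `f` and upper ends `g` after the first of the
corners `K`, gives a polygon representation. -/
lemma isPolygonGraph_of_ordered_ends {V : Type*} [Finite V] {G : SimpleGraph V} {f g : V → ℝ}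
    {K : Finset ℝ} (hK : 2 ≤ K.card) (hf : Function.Injective f) (hg : Function.Injective g)
    (hne : ∀ u v, f u ≠ g v) (hfg : ∀ v, f v < g v)
    (hpos : ∀ v, 1 ≤ (K.filter (· < f v)).card)
    (hdiff : ∀ v, (K.filter (· < f v)).card ≠ (K.filter (· < g v)).card)
    (hadj : ∀ u v, G.Adj u v ↔ u ≠ v ∧ ¬ (Sep (f u) (g u) (f v) ↔ Sep (f u) (g u) (g v))) :
    IsPolygonGraph K.card G := by
  have hle : ∀ p, (K.filter (· < p)).card ≤ K.card := fun p => Finset.card_filter_le _ _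
  rcases hK.eq_or_lt with hK | hK
  · left
    refine ⟨hK.symm, ?_⟩
    have hlt : ∀ u v, f u < g v := by
      intro u v
      by_contra! h
      have := card_filter_lt_mono K h
      have := card_filter_lt_mono K (hfg u).le
      have := card_filter_lt_mono K (hfg v).le
      have := hpos u
      have := hpos v
      have := hdiff u
      have := hdiff v
      have := hle (g u)
      have := hle (g v)
      omega
    have := Fintype.ofFinite V
    obtain ⟨e, he⟩ := exists_rank hf
    obtain ⟨e', he'⟩ := exists_rank (r := fun v => - g v) fun u v h => hg (neg_injective h)
    refine ⟨_, e, (e.symm.trans e').symm, fun u v => ?_⟩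
    rw [hadj]
    simp only [Equiv.symm_symm, Equiv.trans_apply, Equiv.symm_apply_apply]
    by_cases huv : u = v
    · simp [huv]
    have h1 := hf.ne huv
    have h2 := hg.ne huv
    have a1 := he u v
    have a2 := he v u
    have a3 := he' u v
    have a4 := he' v u
    rw [Fin.lt_def] at a1 a2 a3 a4
    have b1 : ¬ g u < f v := (hlt v u).not_gt
    simp only [Sep, hlt, b1, iff_false, not_not, true_iff]
    rw [mul_neg_iff]
    simp only [neg_lt_neg_iff] at a3 a4
    have c1 : (e u : ℕ) ≠ e v := fun h => huv (e.injective (Fin.ext h))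
    have c2 : (e' u : ℕ) ≠ e' v := fun h => huv (e'.injective (Fin.ext h))
    rw [← a1, ← a4]
    simp only [huv, ne_eq, not_false_eq_true, true_and]
    omega
  · right
    have hidx : ∀ p, (K.filter (· < p)).card - 1 < K.card := fun p => by have := hle p; omega
    have hposg : ∀ v, 1 ≤ (K.filter (· < g v)).card := fun v =>
      (hpos v).trans (card_filter_lt_mono K (hfg v).le)
    have hinj : ∀ p q : ℝ, linePoint K p = linePoint K q → p = q := fun p q h =>
      Real.sigmoid_strictMono.injective
        (sidePoint_injective hK (hidx p) (hidx q) (Real.sigmoid_pos _) (Real.sigmoid_lt_one _)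
          (Real.sigmoid_pos _) (Real.sigmoid_lt_one _) h).2
    refine ⟨hK, parabolaPolygon K.card, fun v => linePoint K (f v), fun v => linePoint K (g v),
      parabolaPolygon_convex _, ?_, ?_, ?_⟩
    · intro v
      refine ⟨⟨_, hidx (f v)⟩, ⟨_, hidx (g v)⟩, ?_,
        sidePoint_mem_openSide _ (Real.sigmoid_pos _) (Real.sigmoid_lt_one _),
        sidePoint_mem_openSide _ (Real.sigmoid_pos _) (Real.sigmoid_lt_one _)⟩
      have := hpos v
      have := hposg v
      have := hdiff v
      rw [ne_eq, Fin.mk.injEq]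
      omega
    · refine Function.Injective.sumElim (fun u v h => hf (hinj _ _ h))
        (fun u v h => hg (hinj _ _ h)) fun u v h => hne u v (hinj _ _ h)
    · intro u v
      rw [hadj]
      refine and_congr_right fun huv => ?_
      have h1 := hf.ne huv
      have h2 := hg.ne huv
      have h3 := hne u v
      have h4 := hne v u
      have h5 := hfg u
      have h6 := hfg v
      rcases lt_or_gt_of_ne h1 with h | h
      · rw [linePoint_segments_meet_iff hK h5 h6 h h4.symm h2 (hpos u) (hdiff u) (hdiff v)]
        simp only [Sep]
        grind
      · rw [Set.inter_comm, linePoint_segments_meet_iff hK h6 h5 h h3.symm h2.symm (hpos v)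
          (hdiff v) (hdiff u)]
        simp only [Sep]
        grind

lemma sep_min_max (a b c : ℝ) : Sep (min a b) (max a b) c ↔ Sep a b c := by
  simp only [Sep]
  rcases le_total a b with h | h
  · rw [min_eq_left h, max_eq_right h]
  · rw [min_eq_right h, max_eq_left h, not_iff_not]
    exact iff_comm

lemma iff_iff_of_twist {a b a' b' c : Prop} (h1 : a' ↔ (a ↔ c)) (h2 : b' ↔ (b ↔ c)) :
    (a ↔ b) ↔ (a' ↔ b') := by tauto

lemma min_max_ne {a b c d : ℝ} (h1 : a ≠ c) (h2 : a ≠ d) (h3 : b ≠ c) (h4 : b ≠ d) :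
    min a b ≠ min c d ∧ max a b ≠ max c d ∧ min a b ≠ max c d := by
  refine ⟨?_, ?_, ?_⟩
  · rcases min_choice a b with h | h <;> rcases min_choice c d with h' | h' <;> rwa [h, h']
  · rcases max_choice a b with h | h <;> rcases max_choice c d with h' | h' <;> rwa [h, h']
  · rcases min_choice a b with h | h <;> rcases max_choice c d with h' | h' <;> rwa [h, h']

/-- A chord diagram with ends `f` and `g` in which both sides of each chord contain one of the
corners `K` gives a polygon representation: rotate the circle such that the first corner becomes
the first point. -/
theorem isPolygonGraph_of_ends {V : Type*} [Finite V] {G : SimpleGraph V} {f g : V → ℝ}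
    {K : Finset ℝ} (hK : 2 ≤ K.card) (hf : Function.Injective f) (hg : Function.Injective g)
    (hne : ∀ u v, f u ≠ g v) (hfK : ∀ v, f v ∉ K) (hgK : ∀ v, g v ∉ K)
    (hcorner : ∀ v, ∃ x ∈ K, ∃ y ∈ K, Sep (f v) (g v) x ∧ ¬ Sep (f v) (g v) y)
    (hadj : ∀ u v, G.Adj u v ↔ u ≠ v ∧ ¬ (Sep (f u) (g u) (f v) ↔ Sep (f u) (g u) (g v))) :
    IsPolygonGraph K.card G := by
  have hKne : K.Nonempty := Finset.card_pos.1 (by omega)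
  obtain ⟨κ, hκK, hκle⟩ : ∃ κ ∈ K, ∀ x ∈ K, κ ≤ x :=
    ⟨_, K.min'_mem hKne, fun x hx => K.min'_le x hx⟩
  obtain ⟨S, hSf, fS, gS, KS⟩ : ∃ S : Set ℝ, S.Finite ∧ (∀ v, f v ∈ S) ∧ (∀ v, g v ∈ S) ∧
      ∀ x ∈ K, x ∈ S :=
    ⟨Set.range f ∪ Set.range g ∪ K,
      ((Set.finite_range f).union (Set.finite_range g)).union K.finite_toSet,
      fun v => Or.inl (Or.inl ⟨v, rfl⟩), fun v => Or.inl (Or.inr ⟨v, rfl⟩), fun x hx => Or.inr hx⟩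
  obtain ⟨lo, hlo⟩ := hSf.bddBelow
  obtain ⟨hi, hhi⟩ := hSf.bddAbove
  obtain ⟨sh, hsh⟩ : ∃ sh : ℝ → ℝ, ∀ p, sh p = if p < κ then p + (hi - lo + 1) else p :=
    ⟨_, fun _ => rfl⟩
  have hlt : ∀ p ∈ S, ∀ q ∈ S, p ≠ q → (sh p < sh q ↔ (p < q ↔ (p < κ ↔ q < κ))) := by
    intro p hp q hq hpq
    have := hlo hp
    have := hhi hp
    have := hlo hq
    have := hhi hq
    rw [hsh, hsh]
    clear hlo hhi fS gS KS hadj hcorner hsh hκle hfK hgK hne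
    split_ifs with h1 h2 h2
    · simp [h1, h2]
    · simp only [h1, h2, iff_false, not_true, not_lt]
      exact iff_of_false (by linarith) (by linarith)
    · simp only [h1, h2, iff_true, iff_false]
      exact iff_of_true (by linarith) (by linarith)
    · simp [h1, h2]
  have hshK : ∀ x ∈ K, sh x = x := fun x hx => by rw [hsh, if_neg (hκle x hx).not_gt]
  have hsep : ∀ p ∈ S, ∀ q ∈ S, ∀ x ∈ S, p ≠ x → q ≠ x →
      (Sep (sh p) (sh q) (sh x) ↔ (Sep p q x ↔ (p < κ ↔ q < κ))) := by
    intro p hp q hq x hx h1 h2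
    simp only [Sep]
    rw [hlt p hp x hx h1, hlt q hq x hx h2]
    grind
  have hinj : ∀ p ∈ S, ∀ q ∈ S, sh p = sh q → p = q := by
    intro p hp q hq h
    by_contra hpq
    have h1 := hlt p hp q hq hpq
    have h2 := hlt q hq p hp (Ne.symm hpq)
    grind
  have hpos : ∀ p ∈ S, p ∉ K → κ < sh p := by
    intro p hp hpK
    have h1 : p ≠ κ := fun h => hpK (h ▸ hκK)
    have h2 := hlt κ (KS κ hκK) p hp h1.symm
    rw [hshK κ hκK] at h2
    grind
  have hFpos : ∀ v, κ < min (sh (f v)) (sh (g v)) := fun v =>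
    lt_min (hpos _ (fS v) (hfK v)) (hpos _ (gS v) (hgK v))
  have hfg : ∀ v, sh (f v) ≠ sh (g v) := fun v h => hne _ _ (hinj _ (fS v) _ (gS v) h)
  have hends : ∀ u v, u ≠ v → _ := fun u v huv => min_max_ne
    (fun h => huv (hf (hinj _ (fS u) _ (fS v) h))) (fun h => hne _ _ (hinj _ (fS u) _ (gS v) h))
    (fun h => hne _ _ (hinj _ (fS v) _ (gS u) h.symm))
    (fun h => huv (hg (hinj _ (gS u) _ (gS v) h)))
  refine isPolygonGraph_of_ordered_ends (f := fun v => min (sh (f v)) (sh (g v)))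
    (g := fun v => max (sh (f v)) (sh (g v))) hK ?_ ?_ ?_ ?_ ?_ ?_ ?_
  · intro u v h
    by_contra huv
    exact (hends u v huv).1 h
  · intro u v h
    by_contra huv
    exact (hends u v huv).2.1 h
  · intro u v h
    by_cases huv : u = v
    · subst huv
      exact (min_lt_max.2 (hfg u)).ne h
    · exact (hends u v huv).2.2 h
  · exact fun v => min_lt_max.2 (hfg v)
  · intro v
    exact Finset.card_pos.2 ⟨κ, by simp only [Finset.mem_filter]; exact ⟨hκK, hFpos v⟩⟩
  · intro v
    obtain ⟨x, hx, y, hy, h1, h2⟩ := hcorner v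
    have n1 : ∀ z ∈ K, f v ≠ z := fun z hz h => hfK v (h ▸ hz)
    have n2 : ∀ z ∈ K, g v ≠ z := fun z hz h => hgK v (h ▸ hz)
    have h3 := hsep _ (fS v) _ (gS v) x (KS x hx) (n1 x hx) (n2 x hx)
    have h4 := hsep _ (fS v) _ (gS v) y (KS y hy) (n1 y hy) (n2 y hy)
    obtain ⟨z, hz, hzs⟩ : ∃ z ∈ K, Sep (sh (f v)) (sh (g v)) (sh z) := by
      by_cases h5 : Sep (sh (f v)) (sh (g v)) (sh x)
      · exact ⟨x, hx, h5⟩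
      · exact ⟨y, hy, h4.2 (iff_of_false h2 fun h => h5 (h3.2 (iff_of_true h1 h)))⟩
    have m1 := fun h => n1 z hz (hinj _ (fS v) _ (KS z hz) h)
    have m2 := fun h => n2 z hz (hinj _ (gS v) _ (KS z hz) h)
    rw [← sep_min_max, Sep] at hzs
    rw [hshK z hz] at hzs m1 m2
    refine (card_filter_lt_strict hz ?_ ?_).ne <;> grind
  · intro u v
    rw [hadj]
    refine and_congr_right fun huv => ?_
    simp only [sep_min_max]
    have e1 := hsep _ (fS u) _ (gS u) _ (fS v) (hf.ne huv) (hne v u).symm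
    have e2 := hsep _ (fS u) _ (gS u) _ (gS v) (hne u v) (hg.ne huv)
    rcases min_choice (sh (f v)) (sh (g v)) with h | h
    · have h' : max (sh (f v)) (sh (g v)) = sh (g v) := max_eq_right (min_eq_left_iff.1 h)
      rw [h, h']
      exact not_iff_not.2 (iff_iff_of_twist e1 e2)
    · have h' : max (sh (f v)) (sh (g v)) = sh (f v) := max_eq_left (min_eq_right_iff.1 h)
      rw [h, h']
      exact not_iff_not.2 (iff_comm.trans (iff_iff_of_twist e2 e1))

/-! ### Chord diagrams with corners at tagged vertices -/

section Diagram

variable {α : Type*}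

/-- A chord diagram of the graph with vertex set `W` and adjacency relation `R`: the vertex `v` is
the chord with ends `f v` and `g v`. Each `x ∈ X` carries a corner `κ x`, which is adjacent to `f x`
in the sense that no other end or corner lies between them. Both sides of each chord contain a
corner. -/
structure IsDiagram (W : Set α) (R : α → α → Prop) (X : Set α) (f g κ : α → ℝ) : Prop where
  finite : W.Finite
  subset : X ⊆ W
  f_inj : ∀ u ∈ W, ∀ v ∈ W, u ≠ v → f u ≠ f v
  g_inj : ∀ u ∈ W, ∀ v ∈ W, u ≠ v → g u ≠ g v
  f_ne_g : ∀ u ∈ W, ∀ v ∈ W, f u ≠ g v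
  κ_inj : ∀ x ∈ X, ∀ y ∈ X, x ≠ y → κ x ≠ κ y
  κ_ne_f : ∀ x ∈ X, ∀ v ∈ W, κ x ≠ f v
  κ_ne_g : ∀ x ∈ X, ∀ v ∈ W, κ x ≠ g v
  near_f : ∀ x ∈ X, ∀ v ∈ W, v ≠ x → (f v < κ x ↔ f v < f x)
  near_g : ∀ x ∈ X, ∀ v ∈ W, (g v < κ x ↔ g v < f x)
  near_κ : ∀ x ∈ X, ∀ y ∈ X, y ≠ x → (κ y < κ x ↔ κ y < f x)
  adj_iff : ∀ u ∈ W, ∀ v ∈ W, u ≠ v →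
    (R u v ↔ ¬ (Sep (f u) (g u) (f v) ↔ Sep (f u) (g u) (g v)))
  corner : ∀ v ∈ W, ∃ x ∈ X, ∃ y ∈ X, Sep (f v) (g v) (κ x) ∧ ¬ Sep (f v) (g v) (κ y)

/-- The graph `(W, R)` has a chord diagram with corners at the tagged vertices `X`. -/
def HasDiagram (W : Set α) (R : α → α → Prop) (X : Set α) : Prop :=
  ∃ f g κ : α → ℝ, IsDiagram W R X f g κ

/-- There is a point next to `p`, on a prescribed side of it. -/
lemma exists_near {S : Set ℝ} (hS : S.Finite) (p : ℝ) (s : Prop) :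
    ∃ q, (p < q ↔ s) ∧ (q < p ↔ ¬ s) ∧
      ∀ a ∈ S, a ≠ q ∧ (a ≠ p → ((a < q ↔ a < p) ∧ (q < a ↔ p < a))) := by
  by_cases hs : s
  · have h1 : ∀ᶠ q in nhdsWithin p (Set.Ioi p), ∀ a ∈ S, a ≠ p → ((a < q ↔ a < p) ∧ (q < a ↔ p < a))
        ∧ a ≠ q := by
      rw [Filter.eventually_all_finite hS]
      intro a _
      by_cases hap : a = p
      · exact Filter.Eventually.of_forall fun q h => absurd hap h
      rcases lt_or_gt_of_ne hap with h | h
      · filter_upwards [self_mem_nhdsWithin] with q hq _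
        have : p < q := hq
        grind
      · filter_upwards [self_mem_nhdsWithin,
          mem_nhdsWithin_of_mem_nhds (Iio_mem_nhds h)] with q hq hq' _
        have : p < q := hq
        have : q < a := hq'
        grind
    obtain ⟨q, hq, hpq⟩ := (h1.and self_mem_nhdsWithin).exists
    have : p < q := hpq
    refine ⟨q, by grind, by grind, fun a ha => ?_⟩
    by_cases hap : a = p
    · grind
    · grind
  · have h1 : ∀ᶠ q in nhdsWithin p (Set.Iio p), ∀ a ∈ S, a ≠ p → ((a < q ↔ a < p) ∧ (q < a ↔ p < a))
        ∧ a ≠ q := by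
      rw [Filter.eventually_all_finite hS]
      intro a _
      by_cases hap : a = p
      · exact Filter.Eventually.of_forall fun q h => absurd hap h
      rcases lt_or_gt_of_ne hap with h | h
      · filter_upwards [self_mem_nhdsWithin,
          mem_nhdsWithin_of_mem_nhds (Ioi_mem_nhds h)] with q hq hq' _
        have : q < p := hq
        have : a < q := hq'
        grind
      · filter_upwards [self_mem_nhdsWithin] with q hq _
        have : q < p := hq
        grind
    obtain ⟨q, hq, hpq⟩ := (h1.and self_mem_nhdsWithin).exists
    have : q < p := hpq
    refine ⟨q, by grind, by grind, fun a ha => ?_⟩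
    by_cases hap : a = p
    · grind
    · grind

/-- The ends and corners of a diagram. -/
def points (W X : Set α) (f g κ : α → ℝ) : Set ℝ := f '' W ∪ g '' W ∪ κ '' X

lemma IsDiagram.points_finite {W X : Set α} {R : α → α → Prop} {f g κ : α → ℝ}
    (h : IsDiagram W R X f g κ) : (points W X f g κ).Finite :=
  ((h.finite.image f).union (h.finite.image g)).union ((h.finite.subset h.subset).image κ)

lemma f_mem_points {W X : Set α} {f g κ : α → ℝ} {v : α} (hv : v ∈ W) :
    f v ∈ points W X f g κ := Or.inl (Or.inl ⟨v, hv, rfl⟩)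

lemma g_mem_points {W X : Set α} {f g κ : α → ℝ} {v : α} (hv : v ∈ W) :
    g v ∈ points W X f g κ := Or.inl (Or.inr ⟨v, hv, rfl⟩)

lemma κ_mem_points {W X : Set α} {f g κ : α → ℝ} {v : α} (hv : v ∈ X) :
    κ v ∈ points W X f g κ := Or.inr ⟨v, hv, rfl⟩

/-- An additional corner does no harm: as there is no corner at `f x` yet, it may be placed next to
`f x`. -/
lemma HasDiagram.insert_tag {W : Set α} {R : α → α → Prop} {X : Set α} (h : HasDiagram W R X)
    {x : α} (hx : x ∈ W) : HasDiagram W R (insert x X) := by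
  classical
  by_cases hxX : x ∈ X
  · rwa [Set.insert_eq_of_mem hxX]
  obtain ⟨f, g, κ, h⟩ := h
  obtain ⟨q, h1, h2, h3⟩ := exists_near h.points_finite (f x) True
  have hf := fun v hv => h3 (f v) (f_mem_points hv)
  have hg := fun v hv => h3 (g v) (g_mem_points hv)
  have hκ := fun v hv => h3 (κ v) (κ_mem_points hv)
  have hne : ∀ y ∈ X, y ≠ x := fun y hy h => hxX (h ▸ hy)
  have e1 : Function.update κ x q x = q := Function.update_self ..
  have e2 : ∀ y ∈ X, Function.update κ x q y = κ y :=
    fun y hy => Function.update_of_ne (hne y hy) ..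
  refine ⟨f, g, Function.update κ x q, h.finite, Set.insert_subset hx h.subset, h.f_inj, h.g_inj,
    h.f_ne_g, ?_, ?_, ?_, ?_, ?_, ?_, h.adj_iff, ?_⟩
  · rintro a (rfl | ha) b (rfl | hb) hab
    · exact absurd rfl hab
    · rw [e1, e2 b hb]; exact (hκ b hb).1.symm
    · rw [e1, e2 a ha]; exact (hκ a ha).1
    · rw [e2 a ha, e2 b hb]; exact h.κ_inj a ha b hb hab
  · rintro a (rfl | ha) v hv
    · rw [e1]; exact (hf v hv).1.symm
    · rw [e2 a ha]; exact h.κ_ne_f a ha v hv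
  · rintro a (rfl | ha) v hv
    · rw [e1]; exact (hg v hv).1.symm
    · rw [e2 a ha]; exact h.κ_ne_g a ha v hv
  · rintro a (rfl | ha) v hv hva
    · rw [e1]; exact ((hf v hv).2 (h.f_inj v hv a hx hva)).1
    · rw [e2 a ha]; exact h.near_f a ha v hv hva
  · rintro a (rfl | ha) v hv
    · rw [e1]; exact ((hg v hv).2 (h.f_ne_g a hx v hv).symm).1
    · rw [e2 a ha]; exact h.near_g a ha v hv
  · rintro a (rfl | ha) b (rfl | hb) hab
    · exact absurd rfl hab
    · rw [e1, e2 b hb]; exact ((hκ b hb).2 (h.κ_ne_f b hb a hx)).1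
    · rw [e1, e2 a ha, ((hκ a ha).2 (h.κ_ne_f a ha b hx)).2, ((hf a (h.subset ha)).2
        (h.f_inj _ (h.subset ha) b hx hab.symm)).2]
      have := h.near_f a ha b hx hab
      exact this
    · rw [e2 a ha, e2 b hb]; exact h.near_κ a ha b hb hab
  · intro v hv
    obtain ⟨a, ha, b, hb, h4, h5⟩ := h.corner v hv
    exact ⟨a, Or.inr ha, b, Or.inr hb, by rwa [e2 a ha], by rwa [e2 b hb]⟩

lemma HasDiagram.union_tags {W : Set α} {R : α → α → Prop} {X Y : Set α} (h : HasDiagram W R X)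
    (hY : Y ⊆ W) : HasDiagram W R (X ∪ Y) := by
  have hfin : Y.Finite := by
    obtain ⟨f, g, κ, h⟩ := h
    exact h.finite.subset hY
  induction Y, hfin using Set.Finite.induction_on with
  | empty => simpa
  | @insert y Y hy _ ih =>
    rw [Set.union_insert]
    exact (ih ((Set.subset_insert _ _).trans hY)).insert_tag (hY (Set.mem_insert _ _))

lemma twin_cross_iff {a b c : Prop} : c ↔ ¬ (¬ (a ↔ b) ↔ ¬ (¬ b ↔ (a ↔ c))) := by tauto

lemma twin_cross_iff' {a b c : Prop} : c ↔ ¬ (¬ (¬ a ↔ b) ↔ ¬ (¬ b ↔ ¬ (a ↔ c))) := by tauto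

lemma pendant_cross_iff {a n : Prop} : n ↔ ¬ ((a ↔ ¬ n) ↔ a) := by tauto

lemma pendant_sep_iff {a c n : Prop} (hn : ¬ n) : ¬ (¬ a ↔ c) ↔ (¬ (a ↔ c) ↔ n) := by tauto

lemma sep_congr {a b c a' b' c' : ℝ} (h1 : a' < c' ↔ a < c) (h2 : b' < c' ↔ b < c) :
    Sep a' b' c' ↔ Sep a b c := by
  rw [Sep, Sep, h1, h2]

/-- A twin `y` of `l` is a chord next to that of `l`: its first end is inserted next to `f l`, away
from the corner at `f l`, and the side on which its second end is inserted next to `g l` decides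
whether the two chords cross. -/
lemma HasDiagram.insert_twin {W : Set α} {R : α → α → Prop} {X : Set α} (h : HasDiagram W R X)
    (hsymm : ∀ u v, R u v ↔ R v u) {l y : α} (hl : l ∈ W) (hy : y ∉ W)
    (hR : ∀ u ∈ W, u ≠ l → (R y u ↔ R l u)) : HasDiagram (insert y W) R X := by
  classical
  obtain ⟨f, g, κ, h⟩ := h
  obtain ⟨p, p1, p2, p3⟩ := exists_near h.points_finite (f l) (κ l < f l)
  obtain ⟨q, q1, q2, q3⟩ := exists_near (h.points_finite.insert p) (g l) (κ l < f l ↔ R l y)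
  have hqp : p ≠ q := (q3 p (Set.mem_insert _ _)).1
  have pf := fun v hv => p3 (f v) (f_mem_points hv)
  have pg := fun v hv => p3 (g v) (g_mem_points hv)
  have pκ := fun v hv => p3 (κ v) (κ_mem_points hv)
  have qf := fun v hv => q3 (f v) (Set.mem_insert_of_mem _ (f_mem_points hv))
  have qg := fun v hv => q3 (g v) (Set.mem_insert_of_mem _ (g_mem_points hv))
  have qκ := fun v hv => q3 (κ v) (Set.mem_insert_of_mem _ (κ_mem_points hv))
  clear p3 q3
  have hne : ∀ v ∈ W, v ≠ y := fun v hv h => hy (h ▸ hv)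
  have ef : Function.update f y p y = p := Function.update_self ..
  have eg : Function.update g y q y = q := Function.update_self ..
  have ef' : ∀ v ∈ W, Function.update f y p v = f v :=
    fun v hv => Function.update_of_ne (hne v hv) ..
  have eg' : ∀ v ∈ W, Function.update g y q v = g v :=
    fun v hv => Function.update_of_ne (hne v hv) ..
  have hXW := h.subset
  refine ⟨Function.update f y p, Function.update g y q, κ, h.finite.insert y,
    h.subset.trans (Set.subset_insert _ _), ?_, ?_, ?_, h.κ_inj, ?_, ?_, ?_, ?_, ?_, ?_, ?_⟩
  · rintro u (rfl | hu) v (rfl | hv) huv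
    · exact absurd rfl huv
    · rw [ef, ef' v hv]; exact (pf v hv).1.symm
    · rw [ef, ef' u hu]; exact (pf u hu).1
    · rw [ef' u hu, ef' v hv]; exact h.f_inj u hu v hv huv
  · rintro u (rfl | hu) v (rfl | hv) huv
    · exact absurd rfl huv
    · rw [eg, eg' v hv]; exact (qg v hv).1.symm
    · rw [eg, eg' u hu]; exact (qg u hu).1
    · rw [eg' u hu, eg' v hv]; exact h.g_inj u hu v hv huv
  · rintro u (rfl | hu) v (rfl | hv)
    · rwa [ef, eg]
    · rw [ef, eg' v hv]; exact (pg v hv).1.symm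
    · rw [eg, ef' u hu]; exact (qf u hu).1
    · rw [ef' u hu, eg' v hv]; exact h.f_ne_g u hu v hv
  · rintro x hx v (rfl | hv)
    · rw [ef]; exact (pκ x hx).1
    · rw [ef' v hv]; exact h.κ_ne_f x hx v hv
  · rintro x hx v (rfl | hv)
    · rw [eg]; exact (qκ x hx).1
    · rw [eg' v hv]; exact h.κ_ne_g x hx v hv
  · rintro x hx v (rfl | hv) hvx
    · rw [ef, ef' x (hXW hx), ((pκ x hx).2 (h.κ_ne_f x hx l hl)).2]
      by_cases hxl : x = l
      · subst hxl
        rw [p2, not_lt]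
        exact ⟨le_of_lt, fun h' => lt_of_le_of_ne h' (h.κ_ne_f x hx x hl).symm⟩
      · rw [((pf x (hXW hx)).2 (h.f_inj x (hXW hx) l hl hxl)).2]
        exact h.near_f x hx l hl (Ne.symm hxl)
    · rw [ef' v hv, ef' x (hXW hx)]; exact h.near_f x hx v hv hvx
  · rintro x hx v (rfl | hv)
    · rw [eg, ef' x (hXW hx), ((qκ x hx).2 (h.κ_ne_g x hx l hl)).2,
        ((qf x (hXW hx)).2 (h.f_ne_g x (hXW hx) l hl)).2]
      exact h.near_g x hx l hl
    · rw [eg' v hv, ef' x (hXW hx)]; exact h.near_g x hx v hv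
  · intro x hx z hz hzx
    rw [ef' x (hXW hx)]; exact h.near_κ x hx z hz hzx
  · have fg : f l < g l ↔ ¬ g l < f l := by
      have := h.f_ne_g l hl l hl
      grind
    have a1 := (pg l hl).2 (h.f_ne_g l hl l hl).symm
    have a2 := (qf l hl).2 (h.f_ne_g l hl l hl)
    -- the chord of a vertex other than `l` does not tell `y` from `l`
    have out : ∀ v ∈ W, v ≠ l → (Sep p q (f v) ↔ Sep (f l) (g l) (f v)) ∧
        (Sep p q (g v) ↔ Sep (f l) (g l) (g v)) ∧ (Sep (f v) (g v) p ↔ Sep (f v) (g v) (f l)) ∧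
        (Sep (f v) (g v) q ↔ Sep (f v) (g v) (g l)) := by
      intro v hv hvl
      have b1 := (pf v hv).2 (h.f_inj v hv l hl hvl)
      have b2 := (pg v hv).2 (h.f_ne_g l hl v hv).symm
      have b3 := (qf v hv).2 (h.f_ne_g v hv l hl)
      have b4 := (qg v hv).2 (h.g_inj v hv l hl hvl)
      exact ⟨sep_congr b1.2 b3.2, sep_congr b2.2 b4.2, sep_congr b1.1 b2.1, sep_congr b3.1 b4.1⟩
    rintro u (rfl | hu) v (rfl | hv) huv
    · exact absurd rfl huv
    · rw [ef, eg, ef' v hv, eg' v hv]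
      by_cases hvl : v = l
      · subst hvl
        rw [hsymm, Sep, Sep, p2, a1.2, a2.2, q2, fg]
        exact twin_cross_iff'
      · rw [hR v hv hvl, (out v hv hvl).1, (out v hv hvl).2.1]
        exact h.adj_iff l hl v hv (Ne.symm hvl)
    · rw [ef, eg, ef' u hu, eg' u hu]
      by_cases hul : u = l
      · subst hul
        rw [Sep, Sep, p1, a1.1, a2.1, q1, fg]
        exact twin_cross_iff
      · rw [hsymm, hR u hu hul, hsymm, (out u hu hul).2.2.1, (out u hu hul).2.2.2]
        exact h.adj_iff u hu l hl hul
    · rw [ef' u hu, eg' u hu, ef' v hv, eg' v hv]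
      exact h.adj_iff u hu v hv huv
  · rintro v (rfl | hv)
    · rw [ef, eg]
      obtain ⟨a, ha, b, hb, h4, h5⟩ := h.corner l hl
      refine ⟨a, ha, b, hb, ?_, ?_⟩
      · rwa [sep_congr ((pκ a ha).2 (h.κ_ne_f a ha l hl)).2 ((qκ a ha).2 (h.κ_ne_g a ha l hl)).2]
      · rwa [sep_congr ((pκ b hb).2 (h.κ_ne_f b hb l hl)).2 ((qκ b hb).2 (h.κ_ne_g b hb l hl)).2]
    · rw [ef' v hv, eg' v hv]
      exact h.corner v hv

lemma HasDiagram.union_twins {W : Set α} {R : α → α → Prop} {X Z : Set α} (h : HasDiagram W R X)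
    (hsymm : ∀ u v, R u v ↔ R v u) (hZ : Z.Finite) {l : α} (hl : l ∈ W)
    (hR : ∀ y ∈ Z, ∀ u ∈ W ∪ Z, u ≠ l → u ≠ y → (R y u ↔ R l u)) : HasDiagram (W ∪ Z) R X := by
  induction Z, hZ using Set.Finite.induction_on with
  | empty => simpa
  | @insert y Z hy _ ih =>
    rw [Set.union_insert]
    have h' := ih fun z hz u hu hul huz => hR z (Or.inr hz) u
      (hu.imp id (Set.mem_insert_of_mem _)) hul huz
    by_cases hyW : y ∈ W ∪ Z
    · rwa [Set.insert_eq_of_mem hyW]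
    · exact h'.insert_twin hsymm (Or.inl hl) hyW fun u hu hul => hR y (Set.mem_insert _ _) u
        (hu.imp id (Set.mem_insert_of_mem _)) hul fun h => hyW (h ▸ hu)

/-- A pendant vertex `y` at a tagged vertex `l` is a short chord around `f l` and the corner next to
it. The corner may then be counted as a corner of `l` or of `y`. -/
lemma HasDiagram.insert_pendant {W : Set α} {R : α → α → Prop} {X : Set α} {l y : α}
    (h : HasDiagram W R (insert l X)) (hlX : l ∉ X)
    (hsymm : ∀ u v, R u v ↔ R v u) (hy : y ∉ W) (hR : ∀ u ∈ W, (R y u ↔ u = l)) :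
    HasDiagram (insert y W) R (insert l X) ∧ HasDiagram (insert y W) R (insert y X) := by
  classical
  obtain ⟨f, g, κ, h⟩ := h
  have lX : l ∈ insert l X := Set.mem_insert _ _
  have hl : l ∈ W := h.subset lX
  -- the new chord from `q` to `p` has only `f l` and the corner `κ l` on its short side
  obtain ⟨p, p1, p2, p3⟩ := exists_near h.points_finite (f l) (κ l < f l)
  obtain ⟨q, q1, q2, q3⟩ := exists_near (h.points_finite.insert p) (κ l) (¬ κ l < f l)
  have hqp := q3 p (Set.mem_insert _ _)
  have pf := fun v hv => p3 (f v) (f_mem_points hv)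
  have pg := fun v hv => p3 (g v) (g_mem_points hv)
  have pκ := fun v hv => p3 (κ v) (κ_mem_points hv)
  have qf := fun v hv => q3 (f v) (Set.mem_insert_of_mem _ (f_mem_points hv))
  have qg := fun v hv => q3 (g v) (Set.mem_insert_of_mem _ (g_mem_points hv))
  have qκ := fun v hv => q3 (κ v) (Set.mem_insert_of_mem _ (κ_mem_points hv))
  clear p3 q3
  have hne : ∀ v ∈ W, v ≠ y := fun v hv h => hy (h ▸ hv)
  have ef : Function.update f y q y = q := Function.update_self ..
  have eg : Function.update g y p y = p := Function.update_self ..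
  have ef' : ∀ v ∈ W, Function.update f y q v = f v :=
    fun v hv => Function.update_of_ne (hne v hv) ..
  have eg' : ∀ v ∈ W, Function.update g y p v = g v :=
    fun v hv => Function.update_of_ne (hne v hv) ..
  have hXW := h.subset
  have κf : (f l < κ l ↔ ¬ κ l < f l) := by
    have := h.κ_ne_f l lX l hl
    grind
  -- seen from the other points, `f l` and the corner at `f l` coincide
  have nf : ∀ v ∈ W, v ≠ l → (κ l < f v ↔ f l < f v) := by
    intro v hv hvl
    have := h.near_f l lX v hv hvl
    have := h.κ_ne_f l lX v hv
    have := h.f_inj v hv l hl hvl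
    grind
  have ng : ∀ v ∈ W, (κ l < g v ↔ f l < g v) := by
    intro v hv
    have := h.near_g l lX v hv
    have := h.κ_ne_g l lX v hv
    have := h.f_ne_g l hl v hv
    grind
  have nκ : ∀ x ∈ insert l X, x ≠ l → (κ l < κ x ↔ f l < κ x) := by
    intro x hx hxl
    have := h.near_κ l lX x hx hxl
    have := h.κ_inj l lX x hx hxl.symm
    have := h.κ_ne_f x hx l hl
    grind
  have in_f : Sep q p (f l) := by
    rw [Sep, ((qf l hl).2 (h.κ_ne_f l lX l hl).symm).2, p2]
    exact iff_not_self
  have in_κ : Sep q p (κ l) := by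
    rw [Sep, ((pκ l lX).2 (h.κ_ne_f l lX l hl)).2, q2, κf]
    exact not_iff_self
  have out_f : ∀ v ∈ W, v ≠ l → ¬ Sep q p (f v) := by
    intro v hv hvl
    rw [Sep, ((qf v hv).2 (h.κ_ne_f l lX v hv).symm).2,
      ((pf v hv).2 (h.f_inj v hv l hl hvl)).2, nf v hv hvl]
    exact not_not.2 Iff.rfl
  have out_g : ∀ v ∈ W, ¬ Sep q p (g v) := by
    intro v hv
    rw [Sep, ((qg v hv).2 (h.κ_ne_g l lX v hv).symm).2,
      ((pg v hv).2 (h.f_ne_g l hl v hv).symm).2, ng v hv]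
    exact not_not.2 Iff.rfl
  have out_κ : ∀ x ∈ insert l X, x ≠ l → ¬ Sep q p (κ x) := by
    intro x hx hxl
    rw [Sep, ((qκ x hx).2 (h.κ_inj x hx l lX hxl)).2,
      ((pκ x hx).2 (h.κ_ne_f x hx l hl)).2, nκ x hx hxl]
    exact not_not.2 Iff.rfl
  have near_p : ∀ v ∈ W, (Sep (f v) (g v) q ↔ (Sep (f v) (g v) p ↔ v ≠ l)) := by
    intro v hv
    rw [Sep, Sep, ((qf v hv).2 (h.κ_ne_f l lX v hv).symm).1,
      ((qg v hv).2 (h.κ_ne_g l lX v hv).symm).1,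
      ((pg v hv).2 (h.f_ne_g l hl v hv).symm).1, ← h.near_g l lX v hv]
    by_cases hvl : v = l
    · subst hvl
      rw [p1, κf]
      exact pendant_sep_iff (not_not.2 rfl)
    · rw [((pf v hv).2 (h.f_inj v hv l hl hvl)).1, h.near_f l lX v hv hvl]
      exact ⟨fun h => iff_of_true h hvl, fun h => h.2 hvl⟩
  have main : IsDiagram (insert y W) R (insert l X) (Function.update f y q)
      (Function.update g y p) κ := by
    refine ⟨h.finite.insert y, h.subset.trans (Set.subset_insert _ _), ?_, ?_, ?_, h.κ_inj,
      ?_, ?_, ?_, ?_, ?_, ?_, ?_⟩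
    · rintro u (rfl | hu) v (rfl | hv) huv
      · exact absurd rfl huv
      · rw [ef, ef' v hv]; exact (qf v hv).1.symm
      · rw [ef, ef' u hu]; exact (qf u hu).1
      · rw [ef' u hu, ef' v hv]; exact h.f_inj u hu v hv huv
    · rintro u (rfl | hu) v (rfl | hv) huv
      · exact absurd rfl huv
      · rw [eg, eg' v hv]; exact (pg v hv).1.symm
      · rw [eg, eg' u hu]; exact (pg u hu).1
      · rw [eg' u hu, eg' v hv]; exact h.g_inj u hu v hv huv
    · rintro u (rfl | hu) v (rfl | hv)
      · rw [ef, eg]; exact hqp.1.symm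
      · rw [ef, eg' v hv]; exact (qg v hv).1.symm
      · rw [eg, ef' u hu]; exact (pf u hu).1
      · rw [ef' u hu, eg' v hv]; exact h.f_ne_g u hu v hv
    · rintro x hx v (rfl | hv)
      · rw [ef]; exact (qκ x hx).1
      · rw [ef' v hv]; exact h.κ_ne_f x hx v hv
    · rintro x hx v (rfl | hv)
      · rw [eg]; exact (pκ x hx).1
      · rw [eg' v hv]; exact h.κ_ne_g x hx v hv
    · rintro x hx v (rfl | hv) hvx
      · rw [ef, ef' x (hXW hx), ((qf x (hXW hx)).2 (h.κ_ne_f l lX x (hXW hx)).symm).2]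
        by_cases hxl : x = l
        · subst hxl
          rw [q2, not_not]
        · rw [((qκ x hx).2 (h.κ_inj x hx l lX hxl)).2]
          exact h.near_κ x hx l lX (Ne.symm hxl)
      · rw [ef' v hv, ef' x (hXW hx)]; exact h.near_f x hx v hv hvx
    · rintro x hx v (rfl | hv)
      · rw [eg, ef' x (hXW hx), ((pκ x hx).2 (h.κ_ne_f x hx l hl)).2]
        by_cases hxl : x = l
        · subst hxl
          rw [p2, κf]
        · rw [((pf x (hXW hx)).2 (h.f_inj x (hXW hx) l hl hxl)).2]
          exact h.near_f x hx l hl (Ne.symm hxl)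
      · rw [eg' v hv, ef' x (hXW hx)]; exact h.near_g x hx v hv
    · intro x hx z hz hzx
      rw [ef' x (hXW hx)]; exact h.near_κ x hx z hz hzx
    · rintro u (rfl | hu) v (rfl | hv) huv
      · exact absurd rfl huv
      · rw [ef, eg, ef' v hv, eg' v hv, hR v hv]
        by_cases hvl : v = l
        · subst hvl
          exact iff_of_true rfl fun h' => out_g v hv (h'.1 in_f)
        · exact iff_of_false hvl (not_not.2 (iff_of_false (out_f v hv hvl) (out_g v hv)))
      · rw [ef, eg, ef' u hu, eg' u hu, hsymm, hR u hu, near_p u hu]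
        exact pendant_cross_iff
      · rw [ef' u hu, eg' u hu, ef' v hv, eg' v hv]
        exact h.adj_iff u hu v hv huv
    · rintro v (rfl | hv)
      · rw [ef, eg]
        obtain ⟨a, ha, b, hb, h4, h5⟩ := h.corner l hl
        by_cases hal : a = l
        · refine ⟨l, lX, b, hb, in_κ, out_κ b hb ?_⟩
          rintro rfl
          subst hal
          exact h5 h4
        · exact ⟨l, lX, a, ha, in_κ, out_κ a ha hal⟩
      · rw [ef' v hv, eg' v hv]
        exact h.corner v hv
  refine ⟨⟨_, _, _, main⟩, Function.update f y q, Function.update g y p,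
    Function.update κ y (κ l), ?_⟩
  have hneX : ∀ x ∈ X, x ≠ y := fun x hx => hne x (hXW (Set.mem_insert_of_mem _ hx))
  have eκ : Function.update κ y (κ l) y = κ l := Function.update_self ..
  have eκ' : ∀ x ∈ X, Function.update κ y (κ l) x = κ x :=
    fun x hx => Function.update_of_ne (hneX x hx) ..
  have hX : ∀ x ∈ X, x ∈ insert l X := fun x hx => Set.mem_insert_of_mem _ hx
  have hXl : ∀ x ∈ X, x ≠ l := fun x hx h => hlX (h ▸ hx)
  refine ⟨main.finite, ?_, main.f_inj, main.g_inj, main.f_ne_g, ?_, ?_, ?_, ?_, ?_, ?_,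
    main.adj_iff, ?_⟩
  · exact Set.insert_subset_insert ((Set.subset_insert _ _).trans hXW)
  · rintro x (rfl | hx) z (rfl | hz) hxz
    · exact absurd rfl hxz
    · rw [eκ, eκ' z hz]; exact h.κ_inj l lX z (hX z hz) (hXl z hz).symm
    · rw [eκ, eκ' x hx]; exact h.κ_inj x (hX x hx) l lX (hXl x hx)
    · rw [eκ' x hx, eκ' z hz]; exact h.κ_inj x (hX x hx) z (hX z hz) hxz
  · rintro x (rfl | hx) v hv
    · rw [eκ]; exact main.κ_ne_f l lX v hv
    · rw [eκ' x hx]; exact main.κ_ne_f x (hX x hx) v hv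
  · rintro x (rfl | hx) v hv
    · rw [eκ]; exact main.κ_ne_g l lX v hv
    · rw [eκ' x hx]; exact main.κ_ne_g x (hX x hx) v hv
  · rintro x (rfl | hx) v hv hvx
    · have hv : v ∈ W := hv.resolve_left hvx
      rw [eκ, ef, ef' v hv, ((qf v hv).2 (h.κ_ne_f l lX v hv).symm).1]
    · rw [eκ' x hx]; exact main.near_f x (hX x hx) v hv hvx
  · rintro x (rfl | hx) v hv
    · rw [eκ, ef]
      rcases hv with rfl | hv
      · rw [eg, (hqp.2 (pκ l lX).1.symm).1]
      · rw [eg' v hv, ((qg v hv).2 (h.κ_ne_g l lX v hv).symm).1]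
    · rw [eκ' x hx]; exact main.near_g x (hX x hx) v hv
  · rintro x (rfl | hx) z (rfl | hz) hzx
    · exact absurd rfl hzx
    · rw [eκ, ef, eκ' z hz, ((qκ z (hX z hz)).2 (h.κ_inj z (hX z hz) l lX (hXl z hz))).1]
    · rw [eκ, eκ' x hx]; exact main.near_κ x (hX x hx) l lX (hXl x hx).symm
    · rw [eκ' x hx, eκ' z hz]; exact main.near_κ x (hX x hx) z (hX z hz) hzx
  · have key : ∀ x ∈ insert l X, ∃ z ∈ insert y X, Function.update κ y (κ l) z = κ x := by
      rintro x (rfl | hx)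
      · exact ⟨y, Set.mem_insert _ _, eκ⟩
      · exact ⟨x, Set.mem_insert_of_mem _ hx, eκ' x hx⟩
    intro v hv
    obtain ⟨a, ha, b, hb, h4, h5⟩ := main.corner v hv
    obtain ⟨a', ha', ea⟩ := key a ha
    obtain ⟨b', hb', eb⟩ := key b hb
    exact ⟨a', ha', b', hb', by rwa [ea], by rwa [eb]⟩

/-- A single edge, with both vertices tagged: the chords `(1, 4)` and `(3, 5)` cross, and the corners
are `0` and `7 / 2`. -/
lemma hasDiagram_edge {R : α → α → Prop} {x y : α} (hxy : x ≠ y) (h1 : R x y) (h2 : R y x) :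
    HasDiagram {x, y} R {x, y} := by
  classical
  refine ⟨fun v => if v = x then 1 else 3, fun v => if v = x then 4 else 5,
    fun v => if v = x then 0 else 7 / 2, Set.toFinite _, subset_rfl, ?_, ?_, ?_, ?_, ?_, ?_, ?_, ?_,
    ?_,
    ?_, ?_⟩
  all_goals simp only [Set.mem_insert_iff, Set.mem_singleton_iff, forall_eq_or_imp, forall_eq,
    exists_eq_or_imp, exists_eq_left, ne_eq, hxy, hxy.symm, not_true, not_false_eq_true, if_true,
    if_false, Sep, h1, h2]
  all_goals norm_num

/-- Renaming the vertex `l` to `y`. -/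
lemma HasDiagram.rename {W : Set α} {R R' : α → α → Prop} {X : Set α} (h : HasDiagram W R X)
    {l y : α} (hl : l ∈ W) (hy : y ∉ W)
    (h1 : ∀ u ∈ W, u ≠ l → ∀ v ∈ W, v ≠ l → (R' u v ↔ R u v))
    (h2 : ∀ u ∈ W, u ≠ l → (R' y u ↔ R l u)) (h3 : ∀ u ∈ W, u ≠ l → (R' u y ↔ R u l)) :
    HasDiagram (insert y (W \ {l})) R' {x | (x = y ∧ l ∈ X) ∨ (x ∈ X ∧ x ≠ l)} := by
  classical
  obtain ⟨f, g, κ, h⟩ := h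
  obtain ⟨τ, hτ⟩ : ∃ τ : α → α, τ = fun x => if x = y then l else x := ⟨_, rfl⟩
  have ty : τ y = l := by simp [hτ]
  have tv : ∀ v ∈ W, τ v = v := fun v hv => by
    rw [hτ]
    exact if_neg (by rintro rfl; exact hy hv)
  have hW : ∀ v ∈ insert y (W \ {l}), τ v ∈ W := by
    rintro v (rfl | hv)
    · rwa [ty]
    · rw [tv v hv.1]; exact hv.1
  have inj : ∀ u ∈ insert y (W \ {l}), ∀ v ∈ insert y (W \ {l}), u ≠ v → τ u ≠ τ v := by
    rintro u (rfl | hu) v (rfl | hv) huv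
    · exact absurd rfl huv
    · rw [ty, tv v hv.1]; exact Ne.symm hv.2
    · rw [ty, tv u hu.1]; exact hu.2
    · rwa [tv u hu.1, tv v hv.1]
  have hX : {x | (x = y ∧ l ∈ X) ∨ (x ∈ X ∧ x ≠ l)} = τ ⁻¹' X ∩ insert y (W \ {l}) := by
    ext x
    simp only [Set.mem_ofPred_eq, Set.mem_inter_iff, Set.mem_preimage]
    constructor
    · rintro (⟨rfl, hx⟩ | ⟨hx, hxl⟩)
      · rw [ty]; exact ⟨hx, Set.mem_insert _ _⟩
      · rw [tv x (h.subset hx)]; exact ⟨hx, Or.inr ⟨h.subset hx, hxl⟩⟩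
    · rintro ⟨hx, rfl | hxW⟩
      · rw [ty] at hx; exact Or.inl ⟨rfl, hx⟩
      · rw [tv x hxW.1] at hx; exact Or.inr ⟨hx, hxW.2⟩
  rw [hX]
  refine ⟨f ∘ τ, g ∘ τ, κ ∘ τ, (h.finite.sdiff).insert y, Set.inter_subset_right, ?_, ?_, ?_, ?_,
    ?_, ?_, ?_, ?_, ?_, ?_, ?_⟩
  · exact fun u hu v hv huv => h.f_inj _ (hW u hu) _ (hW v hv) (inj u hu v hv huv)
  · exact fun u hu v hv huv => h.g_inj _ (hW u hu) _ (hW v hv) (inj u hu v hv huv)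
  · exact fun u hu v hv => h.f_ne_g _ (hW u hu) _ (hW v hv)
  · exact fun u hu v hv huv => h.κ_inj _ hu.1 _ hv.1 (inj u hu.2 v hv.2 huv)
  · exact fun u hu v hv => h.κ_ne_f _ hu.1 _ (hW v hv)
  · exact fun u hu v hv => h.κ_ne_g _ hu.1 _ (hW v hv)
  · exact fun u hu v hv huv => h.near_f _ hu.1 _ (hW v hv) (inj v hv u hu.2 huv)
  · exact fun u hu v hv => h.near_g _ hu.1 _ (hW v hv)
  · exact fun u hu v hv huv => h.near_κ _ hu.1 _ hv.1 (inj v hv.2 u hu.2 huv)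
  · intro u hu v hv huv
    have := h.adj_iff _ (hW u hu) _ (hW v hv) (inj u hu v hv huv)
    refine Iff.trans ?_ this
    rcases hu with rfl | hu <;> rcases hv with rfl | hv
    · exact absurd rfl huv
    · rw [ty, tv v hv.1]; exact h2 v hv.1 hv.2
    · rw [ty, tv u hu.1]; exact h3 u hu.1 hu.2
    · rw [tv u hu.1, tv v hv.1]; exact h1 u hu.1 hu.2 v hv.1 hv.2
  · have key : ∀ x ∈ X, ∃ z ∈ τ ⁻¹' X ∩ insert y (W \ {l}), τ z = x := by
      intro x hx
      by_cases hxl : x = l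
      · subst hxl
        exact ⟨y, ⟨by rwa [Set.mem_preimage, ty], Set.mem_insert _ _⟩, ty⟩
      · have hxW := h.subset hx
        exact ⟨x, ⟨by rwa [Set.mem_preimage, tv x hxW], Or.inr ⟨hxW, hxl⟩⟩, tv x hxW⟩
    intro v hv
    obtain ⟨a, ha, b, hb, h4, h5⟩ := h.corner _ (hW v hv)
    obtain ⟨a', ha', rfl⟩ := key a ha
    obtain ⟨b', hb', rfl⟩ := key b hb
    exact ⟨a', ha', b', hb', h4, h5⟩

end Diagram

/-! ### Gluing graphs at a marker -/

section Glue

variable {V : Type*}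

/-- The graph with a split whose two parts are `N₁` and `N₂` with marker `m`: the neighbours of `m`
in `N₁` are joined to the neighbours of `m` in `N₂`. -/
def glue (N₁ N₂ : Node V) (m : V ⊕ ℕ) : Node V where
  verts := (N₁.verts ∪ N₂.verts) \ {m}
  Adj x y := x ≠ y ∧ x ≠ m ∧ y ≠ m ∧
    (N₁.Adj x y ∨ N₂.Adj x y ∨ (N₁.Adj x m ∧ N₂.Adj m y) ∨ (N₂.Adj x m ∧ N₁.Adj m y))
  adj_sub := fun h => h.1
  edge_vert := by
    rintro x y ⟨-, hx, -, h | h | h | h⟩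
    · exact ⟨Or.inl (N₁.edge_vert h), hx⟩
    · exact ⟨Or.inr (N₂.edge_vert h), hx⟩
    · exact ⟨Or.inl (N₁.edge_vert h.1), hx⟩
    · exact ⟨Or.inr (N₂.edge_vert h.1), hx⟩
  symm := by
    refine ⟨?_⟩
    rintro x y ⟨hxy, hx, hy, h⟩
    refine ⟨hxy.symm, hy, hx, ?_⟩
    rcases h with h | h | h | h
    · exact Or.inl h.symm
    · exact Or.inr (Or.inl h.symm)
    · exact Or.inr (Or.inr (Or.inr ⟨h.2.symm, h.1.symm⟩))
    · exact Or.inr (Or.inr (Or.inl ⟨h.2.symm, h.1.symm⟩))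

lemma glue_comm (N₁ N₂ : Node V) (m : V ⊕ ℕ) : glue N₁ N₂ m = glue N₂ N₁ m := by
  ext x y
  · simp only [glue, Set.union_comm]
  · simp only [glue]
    tauto

/-- The two markers `l` and `m` belong to the middle graph `N₁`. -/
lemma glue_right_comm {N₁ N₂ N₃ : Node V} {l m : V ⊕ ℕ} (hlm : l ≠ m) (hl : l ∉ N₃.verts)
    (hm : m ∉ N₂.verts) (hd : Disjoint N₂.verts N₃.verts) :
    glue (glue N₁ N₂ l) N₃ m = glue (glue N₁ N₃ m) N₂ l := by
  have hd' : ∀ x, x ∈ N₂.verts → x ∈ N₃.verts → False := fun x h h' => Set.disjoint_left.1 hd h h'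
  have a1 : ∀ x, ¬ N₃.Adj x l := fun x h => hl h.snd_mem
  have a2 : ∀ x, ¬ N₃.Adj l x := fun x h => hl h.fst_mem
  have a3 : ∀ x, ¬ N₂.Adj x m := fun x h => hm h.snd_mem
  have a4 : ∀ x, ¬ N₂.Adj m x := fun x h => hm h.fst_mem
  have e1 : ∀ x y, N₂.Adj x y → x ∈ N₂.verts := fun x y h => h.fst_mem
  have e2 : ∀ x y, N₃.Adj x y → x ∈ N₃.verts := fun x y h => h.fst_mem
  have e3 : ∀ x y, N₂.Adj x y → y ∈ N₂.verts := fun x y h => h.snd_mem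
  have e4 : ∀ x y, N₃.Adj x y → y ∈ N₃.verts := fun x y h => h.snd_mem
  ext x y
  · simp only [glue, Set.mem_sdiff, Set.mem_union, Set.mem_singleton_iff]
    have : x = l → x ∉ N₃.verts := by rintro rfl; exact hl
    have : x = m → x ∉ N₂.verts := by rintro rfl; exact hm
    tauto
  · simp only [glue, a1, a2, a3, a4, hlm, hlm.symm, ne_eq, false_and, and_false, or_false, false_or,
      not_false_eq_true, true_and]
    by_cases hxl : x = l
    · subst hxl; simp [a2]
    by_cases hxm : x = m
    · subst hxm; simp [a4]
    by_cases hyl : y = l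
    · subst hyl; simp [a1]
    by_cases hym : y = m
    · subst hym; simp [a3]
    simp only [hxl, hxm, hyl, hym, not_false_eq_true, true_and]
    have := hd' x
    have := hd' y
    have := e1 x l
    have := e2 x m
    have := e3 l y
    have := e4 m y
    clear hd hd' a1 a2 a3 a4 e1 e2 e3 e4 hlm hl hm hxl hxm hyl hym
    by_cases hxy : x = y
    · simp [hxy]
    grind

/-- Any two vertices of `N` are joined by a path. -/
def Conn (N : Node V) : Prop :=
  ∀ x ∈ N.verts, ∀ y ∈ N.verts, Relation.ReflTransGen N.Adj x y

/-- `N` has at least three vertices, in a form that allows for a marker `x` to be discounted. -/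
def Big (N : Node V) : Prop := ∀ x, (N.verts \ {x}).Nontrivial

lemma big_of_nontrivial {N : Node V} {m : V ⊕ ℕ} (hm : m ∈ N.verts)
    (h : (N.verts \ {m}).Nontrivial) : Big N := by
  intro x
  obtain ⟨a, ha, b, hb, hab⟩ := h
  have ham : a ≠ m := ha.2
  have hbm : b ≠ m := hb.2
  by_cases hxa : a = x
  · subst hxa
    exact ⟨m, ⟨hm, ham.symm⟩, b, ⟨hb.1, hab.symm⟩, hbm.symm⟩
  · by_cases hxb : b = x
    · subst hxb
      exact ⟨m, ⟨hm, hbm.symm⟩, a, ⟨ha.1, hab⟩, ham.symm⟩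
    · exact ⟨a, ⟨ha.1, hxa⟩, b, ⟨hb.1, hxb⟩, hab⟩

/-- The vertices of the graphs in `D`, including the markers. -/
def carrier (D : Set (Node V)) : Set (V ⊕ ℕ) := {x | ∃ H ∈ D, x ∈ H.verts}

/-- `D` is a tree of finite connected graphs which gives `N` when its members are glued together at
the markers. -/
inductive Dec : Node V → Set (Node V) → Prop
  | single {N : Node V} (hf : N.verts.Finite) (hc : Conn N) : Dec N {N}
  | join {N₁ N₂ : Node V} {D₁ D₂ : Set (Node V)} {m : ℕ} (h₁ : Dec N₁ D₁) (h₂ : Dec N₂ D₂)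
      (m₁ : Sum.inr m ∈ N₁.verts) (m₂ : Sum.inr m ∈ N₂.verts)
      (t₁ : (N₁.verts \ {Sum.inr m}).Nontrivial) (t₂ : (N₂.verts \ {Sum.inr m}).Nontrivial)
      (hd : ∀ x ∈ carrier D₁, x ∈ carrier D₂ → x = Sum.inr m) :
      Dec (glue N₁ N₂ (Sum.inr m)) (D₁ ∪ D₂)

/-- The hypotheses under which two decompositions may be glued. -/
structure Compat (N₁ N₂ : Node V) (D₁ D₂ : Set (Node V)) (m : ℕ) : Prop where
  h₁ : Dec N₁ D₁
  h₂ : Dec N₂ D₂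
  m₁ : Sum.inr m ∈ N₁.verts
  m₂ : Sum.inr m ∈ N₂.verts
  t₁ : (N₁.verts \ {Sum.inr m}).Nontrivial
  t₂ : (N₂.verts \ {Sum.inr m}).Nontrivial
  hd : ∀ x ∈ carrier D₁, x ∈ carrier D₂ → x = Sum.inr m

lemma Compat.dec {N₁ N₂ : Node V} {D₁ D₂ : Set (Node V)} {m : ℕ} (c : Compat N₁ N₂ D₁ D₂ m) :
    Dec (glue N₁ N₂ (Sum.inr m)) (D₁ ∪ D₂) :=
  .join c.h₁ c.h₂ c.m₁ c.m₂ c.t₁ c.t₂ c.hd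

lemma Compat.symm {N₁ N₂ : Node V} {D₁ D₂ : Set (Node V)} {m : ℕ} (c : Compat N₁ N₂ D₁ D₂ m) :
    Compat N₂ N₁ D₂ D₁ m :=
  ⟨c.h₂, c.h₁, c.m₂, c.m₁, c.t₂, c.t₁, fun x h h' => c.hd x h' h⟩

/-- Induction over a decomposition, with the hypotheses of the gluing step bundled. -/
lemma Dec.rec' {P : Node V → Set (Node V) → Prop}
    (single : ∀ N : Node V, N.verts.Finite → Conn N → P N {N})
    (join : ∀ (N₁ N₂ : Node V) (D₁ D₂ : Set (Node V)) (m : ℕ), Compat N₁ N₂ D₁ D₂ m → P N₁ D₁ →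
      P N₂ D₂ → P (glue N₁ N₂ (Sum.inr m)) (D₁ ∪ D₂)) {N : Node V} {D : Set (Node V)}
    (h : Dec N D) : P N D := by
  induction h with
  | single hf hc => exact single _ hf hc
  | join h₁ h₂ m₁ m₂ t₁ t₂ hd ih₁ ih₂ => exact join _ _ _ _ _ ⟨h₁, h₂, m₁, m₂, t₁, t₂, hd⟩ ih₁ ih₂

lemma mem_glue {N₁ N₂ : Node V} {m x : V ⊕ ℕ} :
    x ∈ (glue N₁ N₂ m).verts ↔ (x ∈ N₁.verts ∨ x ∈ N₂.verts) ∧ x ≠ m := Iff.rfl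

lemma carrier_union (D₁ D₂ : Set (Node V)) (x : V ⊕ ℕ) :
    x ∈ carrier (D₁ ∪ D₂) ↔ x ∈ carrier D₁ ∨ x ∈ carrier D₂ := by
  simp only [carrier, Set.mem_ofPred_eq, Set.mem_union, or_and_right, exists_or]

lemma mem_carrier {D : Set (Node V)} {H : Node V} (hH : H ∈ D) {x : V ⊕ ℕ} (hx : x ∈ H.verts) :
    x ∈ carrier D := ⟨H, hH, hx⟩

lemma Dec.subset_carrier {N : Node V} {D : Set (Node V)} (h : Dec N D) {x : V ⊕ ℕ}
    (hx : x ∈ N.verts) : x ∈ carrier D := by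
  revert x
  apply Dec.rec' ?_ ?_ h
  · exact fun N _ _ x hx => ⟨N, rfl, hx⟩
  · intro N₁ N₂ D₁ D₂ m _ ih₁ ih₂ x hx
    rw [carrier_union]
    exact hx.1.imp (ih₁ ·) (ih₂ ·)

lemma Dec.finite {N : Node V} {D : Set (Node V)} (h : Dec N D) : D.Finite := by
  apply Dec.rec' ?_ ?_ h
  · exact fun N _ _ => Set.finite_singleton N
  · exact fun _ _ _ _ _ _ h₁ h₂ => h₁.union h₂

lemma Dec.nonempty {N : Node V} {D : Set (Node V)} (h : Dec N D) : D.Nonempty := by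
  apply Dec.rec' ?_ ?_ h
  · exact fun N _ _ => Set.singleton_nonempty N
  · exact fun _ _ _ _ _ _ h₁ _ => h₁.mono Set.subset_union_left

lemma Dec.verts_finite {N : Node V} {D : Set (Node V)} (h : Dec N D) : N.verts.Finite := by
  apply Dec.rec' ?_ ?_ h
  · exact fun N h _ => h
  · exact fun _ _ _ _ _ _ h₁ h₂ => (h₁.union h₂).sdiff

lemma Dec.node_finite {N : Node V} {D : Set (Node V)} (h : Dec N D) {H : Node V} (hH : H ∈ D) :
    H.verts.Finite := by
  revert H
  apply Dec.rec' ?_ ?_ h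
  · rintro N h _ _ rfl; exact h
  · rintro _ _ _ _ _ _ h₁ h₂ H (h | h)
    exacts [h₁ h, h₂ h]

lemma Dec.node_conn {N : Node V} {D : Set (Node V)} (h : Dec N D) {H : Node V} (hH : H ∈ D) :
    Conn H := by
  revert H
  apply Dec.rec' ?_ ?_ h
  · rintro N _ h _ rfl; exact h
  · rintro _ _ _ _ _ _ h₁ h₂ H (h | h)
    exacts [h₁ h, h₂ h]

lemma Compat.big₁ {N₁ N₂ : Node V} {D₁ D₂ : Set (Node V)} {m : ℕ} (c : Compat N₁ N₂ D₁ D₂ m) :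
    Big N₁ := big_of_nontrivial c.m₁ c.t₁

lemma Dec.node_big {N : Node V} {D : Set (Node V)} (h : Dec N D) (hN : Big N) {H : Node V}
    (hH : H ∈ D) : Big H := by
  revert hN H
  apply Dec.rec' ?_ ?_ h
  · rintro N _ _ hN _ rfl; exact hN
  · rintro _ _ _ _ _ c h₁ h₂ - H (h | h)
    exacts [h₁ c.big₁ h, h₂ c.symm.big₁ h]

lemma Compat.not_mem₂ {N₁ N₂ : Node V} {D₁ D₂ : Set (Node V)} {m : ℕ} (c : Compat N₁ N₂ D₁ D₂ m)
    {H : Node V} (hH : H ∈ D₁) : H ∉ D₂ := by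
  intro hH'
  obtain ⟨x, hx, -⟩ := (c.h₁.node_big c.big₁ hH) (Sum.inr m)
  exact hx.2 (c.hd x (mem_carrier hH hx.1) (mem_carrier hH' hx.1))

lemma Compat.not_mem_verts {N₁ N₂ : Node V} {D₁ D₂ : Set (Node V)} {m : ℕ}
    (c : Compat N₁ N₂ D₁ D₂ m) {H : Node V} (hH : H ∈ D₁) {x : V ⊕ ℕ} (hx : x ∈ H.verts)
    (hxm : x ≠ Sum.inr m) : x ∉ N₂.verts := fun hx' =>
  hxm (c.hd x (mem_carrier hH hx) (c.h₂.subset_carrier hx'))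

/-- A vertex of `N` belongs to only one of the graphs in `D`. -/
lemma Dec.unique_node {N : Node V} {D : Set (Node V)} (h : Dec N D) {x : V ⊕ ℕ} (hx : x ∈ N.verts)
    {H K : Node V} (hH : H ∈ D) (hK : K ∈ D) (xH : x ∈ H.verts) (xK : x ∈ K.verts) : H = K := by
  revert x H K
  apply Dec.rec' ?_ ?_ h
  · rintro N _ _ x _ H K rfl rfl _ _; rfl
  · intro N₁ N₂ D₁ D₂ m c ih₁ ih₂ x hx H K hH hK xH xK
    obtain ⟨hx, hxm⟩ := hx
    rcases hH with hH | hH <;> rcases hK with hK | hK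
    · refine ih₁ (hx.resolve_right fun h => ?_) hH hK xH xK
      exact c.not_mem_verts hH xH hxm h
    · exact absurd (c.hd x (mem_carrier hH xH) (mem_carrier hK xK)) hxm
    · exact absurd (c.hd x (mem_carrier hK xK) (mem_carrier hH xH)) hxm
    · refine ih₂ (hx.resolve_left fun h => ?_) hH hK xH xK
      exact c.symm.not_mem_verts hH xH hxm h

lemma isMarkerOf_mono {D D' : Set (Node V)} (h : D ⊆ D') {H : Node V} {l : V ⊕ ℕ}
    (hl : IsMarkerOf D H l) : IsMarkerOf D' H l := by
  obtain ⟨h1, K, hK, h2⟩ := hl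
  exact ⟨h1, K, h hK, h2⟩

lemma Compat.isMarkerOf_iff {N₁ N₂ : Node V} {D₁ D₂ : Set (Node V)} {m : ℕ}
    (c : Compat N₁ N₂ D₁ D₂ m) {H : Node V} (hH : H ∈ D₁) {l : V ⊕ ℕ} :
    IsMarkerOf (D₁ ∪ D₂) H l ↔ IsMarkerOf D₁ H l ∨ (l = Sum.inr m ∧ l ∈ H.verts) := by
  constructor
  · rintro ⟨hl, K, hK | hK, hKH, hlK⟩
    · exact Or.inl ⟨hl, K, hK, hKH, hlK⟩
    · exact Or.inr ⟨c.hd l (mem_carrier hH hl) (mem_carrier hK hlK), hl⟩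
  · rintro (h | ⟨rfl, hl⟩)
    · exact isMarkerOf_mono Set.subset_union_left h
    · obtain ⟨K, hK, hlK⟩ := c.h₂.subset_carrier c.m₂
      refine ⟨hl, K, Or.inr hK, ?_, hlK⟩
      rintro rfl
      exact c.not_mem₂ hH hK

lemma Compat.isMarkerOf_iff₂ {N₁ N₂ : Node V} {D₁ D₂ : Set (Node V)} {m : ℕ}
    (c : Compat N₁ N₂ D₁ D₂ m) {H : Node V} (hH : H ∈ D₂) {l : V ⊕ ℕ} :
    IsMarkerOf (D₁ ∪ D₂) H l ↔ IsMarkerOf D₂ H l ∨ (l = Sum.inr m ∧ l ∈ H.verts) := by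
  rw [Set.union_comm]
  exact c.symm.isMarkerOf_iff hH

lemma Dec.not_isMarkerOf {N : Node V} {D : Set (Node V)} (h : Dec N D) {x : V ⊕ ℕ}
    (hx : x ∈ N.verts) {H : Node V} (hH : H ∈ D) : ¬ IsMarkerOf D H x := by
  rintro ⟨h1, K, hK, hKH, hxK⟩
  exact hKH (h.unique_node hx hK hH hxK h1)

/-- The vertices of the graphs in `D` other than the markers are the vertices of `N`. -/
lemma Dec.mem_verts {N : Node V} {D : Set (Node V)} (h : Dec N D) {H : Node V} (hH : H ∈ D)
    {x : V ⊕ ℕ} (hx : x ∈ H.verts) (hm : ¬ IsMarkerOf D H x) : x ∈ N.verts := by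
  revert H x
  apply Dec.rec' ?_ ?_ h
  · rintro N _ _ _ rfl x hx _; exact hx
  · rintro N₁ N₂ D₁ D₂ m c ih₁ ih₂ H (hH | hH) x hx hm
    · rw [c.isMarkerOf_iff hH] at hm
      push Not at hm
      exact ⟨Or.inl (ih₁ hH hx hm.1), fun h => hm.2 h hx⟩
    · rw [c.isMarkerOf_iff₂ hH] at hm
      push Not at hm
      exact ⟨Or.inr (ih₂ hH hx hm.1), fun h => hm.2 h hx⟩

lemma Dec.marker_inr {N : Node V} {D : Set (Node V)} (h : Dec N D) {H : Node V} (hH : H ∈ D)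
    {l : V ⊕ ℕ} (hm : IsMarkerOf D H l) : ∃ m : ℕ, l = Sum.inr m := by
  revert H
  apply Dec.rec' ?_ ?_ h
  · rintro N _ _ _ rfl ⟨-, K, rfl, h, -⟩; exact absurd rfl h
  · rintro N₁ N₂ D₁ D₂ m c ih₁ ih₂ H (hH | hH) hm
    · rw [c.isMarkerOf_iff hH] at hm
      exact hm.elim (ih₁ hH) fun h => ⟨m, h.1⟩
    · rw [c.isMarkerOf_iff₂ hH] at hm
      exact hm.elim (ih₂ hH) fun h => ⟨m, h.1⟩

/-- Two graphs of a decomposition share at most one marker. -/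
lemma Dec.shared_unique {N : Node V} {D : Set (Node V)} (h : Dec N D) {H K : Node V}
    (hH : H ∈ D) (hK : K ∈ D) (hHK : H ≠ K) {x y : V ⊕ ℕ} (xH : x ∈ H.verts) (xK : x ∈ K.verts)
    (yH : y ∈ H.verts) (yK : y ∈ K.verts) : x = y := by
  revert H K
  apply Dec.rec' ?_ ?_ h
  · rintro N _ _ H K rfl rfl h; exact absurd rfl h
  · rintro N₁ N₂ D₁ D₂ m c ih₁ ih₂ H K (hH | hH) (hK | hK) hHK xH xK yH yK
    · exact ih₁ hH hK hHK xH xK yH yK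
    · exact (c.hd x (mem_carrier hH xH) (mem_carrier hK xK)).trans
        (c.hd y (mem_carrier hH yH) (mem_carrier hK yK)).symm
    · exact (c.hd x (mem_carrier hK xK) (mem_carrier hH xH)).trans
        (c.hd y (mem_carrier hK yK) (mem_carrier hH yH)).symm
    · exact ih₂ hH hK hHK xH xK yH yK

/-- A marker belongs to only two graphs of a decomposition. -/
lemma Dec.marker_two {N : Node V} {D : Set (Node V)} (h : Dec N D) {H K L : Node V}
    (hH : H ∈ D) (hK : K ∈ D) (hL : L ∈ D) {x : V ⊕ ℕ} (xH : x ∈ H.verts) (xK : x ∈ K.verts)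
    (xL : x ∈ L.verts) : H = K ∨ H = L ∨ K = L := by
  revert H K L
  apply Dec.rec' ?_ ?_ h
  · rintro N _ _ H K L rfl rfl _ _ _ _; exact Or.inl rfl
  · intro N₁ N₂ D₁ D₂ m c ih₁ ih₂ H K L hH hK hL xH xK xL
    have two : ∀ {N₁ N₂ : Node V} {D₁ D₂ : Set (Node V)}, Compat N₁ N₂ D₁ D₂ m →
        ∀ {A B C : Node V}, A ∈ D₁ → B ∈ D₁ → C ∈ D₂ → x ∈ A.verts → x ∈ B.verts → x ∈ C.verts →
        A = B := by
      intro N₁ N₂ D₁ D₂ c A B C hA hB hC xA xB xC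
      obtain rfl := c.hd x (mem_carrier hA xA) (mem_carrier hC xC)
      exact c.h₁.unique_node c.m₁ hA hB xA xB
    rcases hH with hH | hH <;> rcases hK with hK | hK <;> rcases hL with hL | hL
    · exact ih₁ hH hK hL xH xK xL
    · exact Or.inl (two c hH hK hL xH xK xL)
    · exact Or.inr (Or.inl (two c hH hL hK xH xL xK))
    · exact Or.inr (Or.inr (two c.symm hK hL hH xK xL xH))
    · exact Or.inr (Or.inr (two c hK hL hH xK xL xH))
    · exact Or.inr (Or.inl (two c.symm hH hL hK xH xL xK))
    · exact Or.inl (two c.symm hH hK hL xH xK xL)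
    · exact ih₂ hH hK hL xH xK xL

lemma Dec.eq_singleton {N H : Node V} (h : Dec N {H}) : N = H := by
  have : ∀ N D, Dec N D → D = {H} → N = H := by
    intro N D h
    apply Dec.rec' ?_ ?_ h
    · exact fun N _ _ h => Set.singleton_injective h
    · intro N₁ N₂ D₁ D₂ m c _ _ h
      obtain ⟨K, hK⟩ := c.h₁.nonempty
      obtain ⟨L, hL⟩ := c.h₂.nonempty
      have e1 : K = H := by
        have : K ∈ D₁ ∪ D₂ := Or.inl hK
        rwa [h] at this
      have e2 : L = H := by
        have : L ∈ D₁ ∪ D₂ := Or.inr hL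
        rwa [h] at this
      subst e1 e2
      exact absurd hL (c.not_mem₂ hK)
  exact this N _ h rfl

lemma Dec.exists_marker {N : Node V} {D : Set (Node V)} (h : Dec N D) {H : Node V}
    (hH : H ∈ D) (hD : D ≠ {H}) : ∃ l, IsMarkerOf D H l := by
  revert H
  apply Dec.rec' ?_ ?_ h
  · rintro N _ _ _ rfl h; exact absurd rfl h
  · have key : ∀ {N₁ N₂ : Node V} {D₁ D₂ : Set (Node V)} {m : ℕ}, Compat N₁ N₂ D₁ D₂ m →
        (∀ ⦃H : Node V⦄, H ∈ D₁ → D₁ ≠ {H} → ∃ l, IsMarkerOf D₁ H l) →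
        ∀ ⦃H : Node V⦄, H ∈ D₁ → ∃ l, IsMarkerOf (D₁ ∪ D₂) H l := by
      intro N₁ N₂ D₁ D₂ m c ih H hH
      by_cases hD : D₁ = {H}
      · have := c.m₁
        have hc := c.h₁
        rw [hD] at hc
        rw [hc.eq_singleton] at this
        exact ⟨_, (c.isMarkerOf_iff hH).2 (Or.inr ⟨rfl, this⟩)⟩
      · obtain ⟨l, hl⟩ := ih hH hD
        exact ⟨l, isMarkerOf_mono Set.subset_union_left hl⟩
    rintro N₁ N₂ D₁ D₂ m c ih₁ ih₂ H (hH | hH) -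
    · exact key c (fun _ => ih₁) hH
    · rw [Set.union_comm]
      exact key c.symm (fun _ => ih₂) hH

/-- `H` is a graph of `D` with exactly one marker `l`. -/
def IsEnd (D : Set (Node V)) (H : Node V) (l : V ⊕ ℕ) : Prop :=
  H ∈ D ∧ ∀ x, IsMarkerOf D H x ↔ x = l

/-- A decomposition with several graphs has a leaf that does not contain the vertex `z`. -/
lemma Dec.exists_end {N : Node V} {D : Set (Node V)} (h : Dec N D) (hD : D.Nontrivial)
    {z : V ⊕ ℕ} (hz : z ∈ N.verts) : ∃ H l, IsEnd D H l ∧ z ∉ H.verts := by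
  revert hD z
  apply Dec.rec' ?_ ?_ h
  · rintro N _ _ h; exact absurd h Set.not_nontrivial_singleton
  · have key : ∀ {N₁ N₂ : Node V} {D₁ D₂ : Set (Node V)} {m : ℕ}, Compat N₁ N₂ D₁ D₂ m →
        (D₂.Nontrivial → ∀ ⦃z⦄, z ∈ N₂.verts → ∃ H l, IsEnd D₂ H l ∧ z ∉ H.verts) →
        ∀ ⦃z⦄, z ∈ N₁.verts → z ≠ Sum.inr m → ∃ H l, IsEnd (D₁ ∪ D₂) H l ∧ z ∉ H.verts := by
      intro N₁ N₂ D₁ D₂ m c ih z hz hzm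
      have hz1 := c.h₁.subset_carrier hz
      by_cases hD : D₂.Nontrivial
      · obtain ⟨H, l, ⟨hH, hl⟩, hm⟩ := ih hD c.m₂
        refine ⟨H, l, ⟨Or.inr hH, fun x => ?_⟩, fun h => hzm (c.hd z hz1 (mem_carrier hH h))⟩
        rw [c.isMarkerOf_iff₂ hH, hl]
        exact or_iff_left fun h => hm (h.1 ▸ h.2)
      · obtain ⟨H, rfl⟩ := (Set.not_nontrivial_iff.1 hD).eq_empty_or_singleton.resolve_left
          c.h₂.nonempty.ne_empty
        obtain rfl := c.h₂.eq_singleton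
        refine ⟨N₂, Sum.inr m, ⟨Or.inr rfl, fun x => ?_⟩,
          fun h => hzm (c.hd z hz1 ⟨N₂, rfl, h⟩)⟩
        rw [c.isMarkerOf_iff₂ rfl]
        constructor
        · rintro (⟨-, K, rfl, h, -⟩ | h)
          · exact absurd rfl h
          · exact h.1
        · rintro rfl
          exact Or.inr ⟨rfl, c.m₂⟩
    rintro N₁ N₂ D₁ D₂ m c ih₁ ih₂ - z ⟨hz | hz, hzm⟩
    · exact key c ih₂ hz hzm
    · rw [Set.union_comm]
      exact key c.symm ih₁ hz hzm

end Glue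

section Glue2

variable {V : Type*}

lemma Conn.exists_adj {N : Node V} (h : Conn N) {m : V ⊕ ℕ} (hm : m ∈ N.verts)
    (hne : (N.verts \ {m}).Nonempty) : ∃ b, N.Adj m b := by
  obtain ⟨x, hx, hxm⟩ := hne
  rcases (h m hm x hx).cases_head with h | ⟨b, hb, -⟩
  · exact absurd h.symm hxm
  · exact ⟨b, hb⟩

/-- A path of `N₁` becomes a path of the glued graph: a passage through the marker `m` is replaced
by a passage through a neighbour of `m` in `N₂`. -/
lemma glue_path {N₁ N₂ : Node V} {m b : V ⊕ ℕ} (hd : ∀ x ∈ N₁.verts, x ∈ N₂.verts → x = m)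
    (hb : N₂.Adj m b) {x y : V ⊕ ℕ} (h : Relation.ReflTransGen N₁.Adj x y) (hx : x ≠ m) :
    (y ≠ m → Relation.ReflTransGen (glue N₁ N₂ m).Adj x y) ∧
      (y = m → Relation.ReflTransGen (glue N₁ N₂ m).Adj x b) := by
  have hbm : b ≠ m := hb.ne.symm
  have cross : ∀ y, N₁.Adj y m → (glue N₁ N₂ m).Adj y b := fun y hy =>
    ⟨fun h => hbm (hd b (h ▸ hy.fst_mem) hb.snd_mem), hy.ne, hbm, Or.inr (Or.inr (Or.inl ⟨hy, hb⟩))⟩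
  induction h with
  | refl => exact ⟨fun _ => .refl, fun h => absurd h hx⟩
  | @tail y z _ hyz ih =>
    by_cases hy : y = m
    · subst hy
      exact ⟨fun hz => (ih.2 rfl).tail (cross z hyz.symm).symm, fun hz => absurd hz.symm hyz.ne⟩
    · refine ⟨fun hz => (ih.1 hy).tail ⟨hyz.ne, hy, hz, Or.inl hyz⟩, ?_⟩
      rintro rfl
      exact (ih.1 hy).tail (cross y hyz)

lemma Conn.glue {N₁ N₂ : Node V} {m : V ⊕ ℕ} (h₁ : Conn N₁) (h₂ : Conn N₂) (m₁ : m ∈ N₁.verts)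
    (m₂ : m ∈ N₂.verts) (n₁ : (N₁.verts \ {m}).Nonempty) (n₂ : (N₂.verts \ {m}).Nonempty)
    (hd : ∀ x ∈ N₁.verts, x ∈ N₂.verts → x = m) : Conn (glue N₁ N₂ m) := by
  have key : ∀ {N₁ N₂ : Node V}, Conn N₁ → Conn N₂ → m ∈ N₁.verts → m ∈ N₂.verts →
      (N₂.verts \ {m}).Nonempty → (∀ x ∈ N₁.verts, x ∈ N₂.verts → x = m) →
      ∀ x ∈ N₁.verts, x ≠ m → ∀ y ∈ (DHPolygon.glue N₁ N₂ m).verts,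
        Relation.ReflTransGen (DHPolygon.glue N₁ N₂ m).Adj x y := by
    intro N₁ N₂ h₁ h₂ m₁ m₂ n₂ hd x hx hxm y hy
    obtain ⟨b, hb⟩ := h₂.exists_adj m₂ n₂
    rcases hy with ⟨hy | hy, hym⟩
    · exact (glue_path hd hb (h₁ x hx y hy) hxm).1 hym
    · obtain ⟨a, ha⟩ := h₁.exists_adj m₁ ⟨x, hx, hxm⟩
      refine ((glue_path hd hb (h₁ x hx m m₁) hxm).2 rfl).trans ?_
      rw [glue_comm]
      exact (glue_path (fun x h h' => hd x h' h) ha (h₂ b hb.snd_mem y hy) hb.ne.symm).1 hym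
  rintro x ⟨hx | hx, hxm⟩ y hy
  · exact key h₁ h₂ m₁ m₂ n₂ hd x hx hxm y hy
  · rw [glue_comm] at hy ⊢
    exact key h₂ h₁ m₂ m₁ n₁ (fun x h h' => hd x h' h) x hx hxm y hy

lemma Compat.hd' {N₁ N₂ : Node V} {D₁ D₂ : Set (Node V)} {m : ℕ} (c : Compat N₁ N₂ D₁ D₂ m) :
    ∀ x ∈ N₁.verts, x ∈ N₂.verts → x = Sum.inr m :=
  fun x h h' => c.hd x (c.h₁.subset_carrier h) (c.h₂.subset_carrier h')

lemma Dec.conn {N : Node V} {D : Set (Node V)} (h : Dec N D) : Conn N := by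
  apply Dec.rec' ?_ ?_ h
  · exact fun N _ h => h
  · exact fun N₁ N₂ D₁ D₂ m c h₁ h₂ =>
      h₁.glue h₂ c.m₁ c.m₂ c.t₁.nonempty c.t₂.nonempty c.hd'

lemma Compat.exists_adj₂ {N₁ N₂ : Node V} {D₁ D₂ : Set (Node V)} {m : ℕ}
    (c : Compat N₁ N₂ D₁ D₂ m) : ∃ b, N₂.Adj (Sum.inr m) b :=
  c.h₂.conn.exists_adj c.m₂ c.t₂.nonempty

/-- The deletion of a vertex `l` of the glued graph leaves it connected if it leaves the graph of
`D` with the vertex `l` connected. -/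
lemma Dec.conn_deleteVerts {N : Node V} {D : Set (Node V)} (h : Dec N D) {K : Node V} (hK : K ∈ D)
    {l : V ⊕ ℕ} (hl : l ∈ N.verts) (hlK : l ∈ K.verts) (hc : Conn (K.deleteVerts {l})) :
    Conn (N.deleteVerts {l}) := by
  revert hK hl
  apply Dec.rec' ?_ ?_ h
  · rintro N _ _ rfl _; exact hc
  · have key : ∀ {N₁ N₂ : Node V} {D₁ D₂ : Set (Node V)} {m : ℕ}, Compat N₁ N₂ D₁ D₂ m →
        (K ∈ D₁ → l ∈ N₁.verts → Conn (N₁.deleteVerts {l})) →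
        K ∈ D₁ → l ∈ (glue N₁ N₂ (Sum.inr m)).verts →
        Conn ((glue N₁ N₂ (Sum.inr m)).deleteVerts {l}) := by
      intro N₁ N₂ D₁ D₂ m c ih hK hl
      obtain ⟨hl, hlm⟩ := hl
      have hl2 := c.not_mem_verts hK hlK hlm
      have hl1 : l ∈ N₁.verts := hl.resolve_right hl2
      have e : (glue N₁ N₂ (Sum.inr m)).deleteVerts {l} =
          glue (N₁.deleteVerts {l}) N₂ (Sum.inr m) := by
        have a1 : ∀ x, ¬ N₂.Adj l x := fun x h => hl2 h.fst_mem
        have a2 : ∀ x, ¬ N₂.Adj x l := fun x h => hl2 h.snd_mem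
        have hlm' : l ≠ Sum.inr m := hlm
        have b1 : ∀ x y, (N₁.deleteVerts {l}).Adj x y ↔ x ≠ l ∧ y ≠ l ∧ N₁.Adj x y := by
          intro x y
          rw [SimpleGraph.Subgraph.deleteVerts_adj]
          simp only [Set.mem_singleton_iff]
          exact ⟨fun h => ⟨h.2.1, h.2.2.2.1, h.2.2.2.2⟩,
            fun h => ⟨h.2.2.fst_mem, h.1, h.2.2.snd_mem, h.2.1, h.2.2⟩⟩
        have b2 : ∀ x y, ((glue N₁ N₂ (Sum.inr m)).deleteVerts {l}).Adj x y ↔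
            x ≠ l ∧ y ≠ l ∧ (glue N₁ N₂ (Sum.inr m)).Adj x y := by
          intro x y
          rw [SimpleGraph.Subgraph.deleteVerts_adj]
          simp only [Set.mem_singleton_iff]
          exact ⟨fun h => ⟨h.2.1, h.2.2.2.1, h.2.2.2.2⟩,
            fun h => ⟨h.2.2.fst_mem, h.1, h.2.2.snd_mem, h.2.1, h.2.2⟩⟩
        ext x y
        · simp only [SimpleGraph.Subgraph.deleteVerts_verts, glue, Set.mem_sdiff, Set.mem_union,
            Set.mem_singleton_iff]
          have : x = l → x ∉ N₂.verts := by rintro rfl; exact hl2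
          tauto
        · rw [b2]
          simp only [glue, b1]
          by_cases hx : x = l
          · subst hx; simp [a1]
          by_cases hy : y = l
          · subst hy; simp [a2]
          simp [hx, hy, hlm'.symm]
      rw [e]
      refine (ih hK hl1).glue c.h₂.conn ⟨c.m₁, fun h => hlm h.symm⟩ c.m₂ ?_ c.t₂.nonempty
        fun x hx => c.hd' x hx.1
      obtain ⟨x, hx, hxl⟩ := c.t₁.exists_ne l
      exact ⟨x, ⟨hx.1, hxl⟩, hx.2⟩
    rintro N₁ N₂ D₁ D₂ m c ih₁ ih₂ (hK | hK) hl
    · exact key c ih₁ hK hl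
    · rw [glue_comm] at hl ⊢
      exact key c.symm ih₂ hK hl

/-- `N` is isomorphic to an induced subgraph of `N'`. -/
def Emb (N N' : Node V) : Prop :=
  ∃ φ : V ⊕ ℕ → V ⊕ ℕ, (∀ x ∈ N.verts, φ x ∈ N'.verts) ∧
    (∀ x ∈ N.verts, ∀ y ∈ N.verts, φ x = φ y → x = y) ∧
    ∀ x ∈ N.verts, ∀ y ∈ N.verts, (N'.Adj (φ x) (φ y) ↔ N.Adj x y)

lemma Emb.refl (N : Node V) : Emb N N :=
  ⟨id, fun _ h => h, fun _ _ _ _ h => h, fun _ _ _ _ => Iff.rfl⟩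

lemma Emb.trans {N N' N'' : Node V} (h : Emb N N') (h' : Emb N' N'') : Emb N N'' := by
  obtain ⟨φ, h1, h2, h3⟩ := h
  obtain ⟨ψ, g1, g2, g3⟩ := h'
  exact ⟨ψ ∘ φ, fun x hx => g1 _ (h1 x hx), fun x hx y hy h => h2 x hx y hy
    (g2 _ (h1 x hx) _ (h1 y hy) h), fun x hx y hy => (g3 _ (h1 x hx) _ (h1 y hy)).trans
    (h3 x hx y hy)⟩

/-- In the glued graph, a neighbour of `m` in `N₂` may serve as the marker of `N₁`. -/
lemma emb_glue {N₁ N₂ : Node V} {m b : V ⊕ ℕ} (hd : ∀ x ∈ N₁.verts, x ∈ N₂.verts → x = m)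
    (hb : N₂.Adj m b) : Emb N₁ (glue N₁ N₂ m) := by
  classical
  have hbm : b ≠ m := hb.ne.symm
  have hb1 : b ∉ N₁.verts := fun h => hbm (hd b h hb.snd_mem)
  have hN2 : ∀ x y, N₂.Adj x y → x ∈ N₁.verts → y ∈ N₁.verts → False := by
    intro x y h hx hy
    rw [hd x hx h.fst_mem, hd y hy h.snd_mem] at h
    exact h.ne rfl
  have hN2' : ∀ x y, N₂.Adj x y → x ∈ N₁.verts → x = m := fun x y h hx => hd x hx h.fst_mem
  have hu : ∀ x, x ≠ m → Function.update id m b x = x := fun x hx => Function.update_of_ne hx ..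
  have hum : Function.update id m b m = b := Function.update_self ..
  refine ⟨Function.update id m b, ?_, ?_, ?_⟩
  · intro x hx
    by_cases hxm : x = m
    · rw [hxm, hum]; exact ⟨Or.inr hb.snd_mem, hbm⟩
    · rw [hu x hxm]; exact ⟨Or.inl hx, hxm⟩
  · intro x hx y hy h
    by_cases hxm : x = m <;> by_cases hym : y = m
    · rw [hxm, hym]
    · rw [hxm, hum, hu y hym] at h
      exact absurd (h ▸ hy) hb1
    · rw [hym, hum, hu x hxm] at h
      exact absurd (h ▸ hx) hb1
    · rwa [hu x hxm, hu y hym] at h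
  · have hb2 : ∀ y ∈ N₁.verts, y ≠ m → ((glue N₁ N₂ m).Adj b y ↔ N₁.Adj m y) := by
      intro y hy hym
      constructor
      · rintro ⟨-, -, -, h | h | h | h⟩
        · exact absurd h.fst_mem hb1
        · exact absurd (hd y hy h.snd_mem) hym
        · exact absurd h.1.fst_mem hb1
        · exact h.2
      · intro h
        exact ⟨fun e => hb1 (e ▸ hy), hbm, hym, Or.inr (Or.inr (Or.inr ⟨hb.symm, h⟩))⟩
    intro x hx y hy
    by_cases hxm : x = m <;> by_cases hym : y = m
    · rw [hxm, hym]
      exact iff_of_false (fun h => h.ne rfl) fun h => h.ne rfl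
    · rw [hxm, hum, hu y hym]; exact hb2 y hy hym
    · rw [hym, hum, hu x hxm, (glue N₁ N₂ m).adj_comm, N₁.adj_comm]; exact hb2 x hx hxm
    · rw [hu x hxm, hu y hym]
      constructor
      · rintro ⟨-, -, -, h | h | h | h⟩
        · exact h
        · exact (hN2 x y h hx hy).elim
        · exact absurd (hN2' y m h.2.symm hy) hym
        · exact absurd (hN2' x m h.1 hx) hxm
      · exact fun h => ⟨h.ne, hxm, hym, Or.inl h⟩

lemma Dec.node_emb {N : Node V} {D : Set (Node V)} (h : Dec N D) {H : Node V} (hH : H ∈ D) :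
    Emb H N := by
  revert hH
  apply Dec.rec' ?_ ?_ h
  · rintro N _ _ rfl; exact .refl _
  · rintro N₁ N₂ D₁ D₂ m c ih₁ ih₂ (hH | hH)
    · obtain ⟨b, hb⟩ := c.exists_adj₂
      exact (ih₁ hH).trans (emb_glue c.hd' hb)
    · obtain ⟨b, hb⟩ := c.symm.exists_adj₂
      rw [glue_comm]
      exact (ih₂ hH).trans (emb_glue c.symm.hd' hb)

lemma carrier_mono {D D' : Set (Node V)} (h : D ⊆ D') {x : V ⊕ ℕ} (hx : x ∈ carrier D) :
    x ∈ carrier D' := by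
  obtain ⟨H, hH, hx⟩ := hx
  exact ⟨H, h hH, hx⟩

/-- A leaf can be split off: it is one side of a gluing. -/
lemma Dec.peel {N : Node V} {D : Set (Node V)} (h : Dec N D) {H : Node V} {l : V ⊕ ℕ}
    (hH : IsEnd D H l) : ∃ N' m, l = Sum.inr m ∧ N = glue N' H l ∧ Compat N' H (D \ {H}) {H} m := by
  revert hH
  apply Dec.rec' ?_ ?_ h
  · rintro N _ _ ⟨rfl, hl⟩
    obtain ⟨-, K, rfl, h, -⟩ := (hl l).2 rfl
    exact absurd rfl h
  · have key : ∀ {N₁ N₂ : Node V} {D₁ D₂ : Set (Node V)} {m : ℕ}, Compat N₁ N₂ D₁ D₂ m →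
        (IsEnd D₁ H l →
          ∃ N' m, l = Sum.inr m ∧ N₁ = glue N' H l ∧ Compat N' H (D₁ \ {H}) {H} m) →
        H ∈ D₁ → IsEnd (D₁ ∪ D₂) H l → ∃ N' m', l = Sum.inr m' ∧
          glue N₁ N₂ (Sum.inr m) = glue N' H l ∧ Compat N' H ((D₁ ∪ D₂) \ {H}) {H} m' := by
      rintro N₁ N₂ D₁ D₂ m c ih hH ⟨-, hl⟩
      have hH2 := c.not_mem₂ hH
      by_cases hD : D₁ = {H}
      · subst hD
        obtain rfl := c.h₁.eq_singleton
        have : Sum.inr m = l := (hl _).1 ((c.isMarkerOf_iff hH).2 (Or.inr ⟨rfl, c.m₁⟩))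
        subst this
        refine ⟨N₂, m, rfl, glue_comm _ _ _, ?_⟩
        have e : ({N₁} ∪ D₂) \ {N₁} = D₂ := by
          ext x
          simp only [Set.mem_sdiff, Set.mem_union, Set.mem_singleton_iff]
          constructor
          · rintro ⟨h | h, h'⟩
            exacts [absurd h h', h]
          · exact fun h => ⟨Or.inr h, fun h' => hH2 (h' ▸ h)⟩
        rw [e]
        exact c.symm
      · obtain ⟨l', hl'⟩ := c.h₁.exists_marker hH hD
        have hll : l' = l := (hl _).1 (isMarkerOf_mono Set.subset_union_left hl')
        subst hll
        have hmH : Sum.inr m ∉ H.verts := by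
          intro hm
          have : Sum.inr m = l' := (hl _).1 ((c.isMarkerOf_iff hH).2 (Or.inr ⟨rfl, hm⟩))
          rw [← this] at hl'
          exact c.h₁.not_isMarkerOf c.m₁ hH hl'
        have hend : IsEnd D₁ H l' := by
          refine ⟨hH, fun x => ⟨fun h => (hl x).1 (isMarkerOf_mono Set.subset_union_left h), ?_⟩⟩
          rintro rfl
          exact hl'
        obtain ⟨N', m', rfl, rfl, c'⟩ := ih hend
        have hm1 : Sum.inr m ∈ N'.verts := c.m₁.1.resolve_right hmH
        have hmm : (Sum.inr m : V ⊕ ℕ) ≠ Sum.inr m' := c.m₁.2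
        have hl2 : Sum.inr m' ∉ N₂.verts := c.not_mem_verts hH hl'.1 hmm.symm
        have hdis : ∀ x ∈ H.verts, x ∉ N₂.verts := fun x hx =>
          c.not_mem_verts hH hx fun h => hmH (h ▸ hx)
        have c'' : Compat N' N₂ (D₁ \ {H}) D₂ m := ⟨c'.h₁, c.h₂, hm1, c.m₂, c'.big₁ _, c.t₂,
          fun x hx => c.hd x (carrier_mono Set.sdiff_subset hx)⟩
        refine ⟨glue N' N₂ (Sum.inr m), m', rfl, ?_, ?_, c'.h₂, ?_, c'.m₂, ?_, c'.t₂, ?_⟩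
        · exact glue_right_comm hmm.symm hl2 hmH (Set.disjoint_left.2 hdis)
        · have e : (D₁ ∪ D₂) \ {H} = D₁ \ {H} ∪ D₂ := by
            rw [Set.union_sdiff_distrib, Set.sdiff_singleton_eq_self hH2]
          rw [e]
          exact c''.dec
        · exact ⟨Or.inl c'.m₁, hmm.symm⟩
        · obtain ⟨a, ha, b, hb, hab⟩ := c.t₂
          exact ⟨a, ⟨⟨Or.inr ha.1, ha.2⟩, fun h => hl2 (h ▸ ha.1)⟩, b,
            ⟨⟨Or.inr hb.1, hb.2⟩, fun h => hl2 (h ▸ hb.1)⟩, hab⟩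
        · rintro x ⟨K, hK, hxK⟩ ⟨_, rfl, hxH⟩
          exact (hl x).1 ⟨hxH, K, hK.1, hK.2, hxK⟩
    rintro N₁ N₂ D₁ D₂ m c ih₁ ih₂ hH
    rcases hH.1 with hH1 | hH1
    · exact key c ih₁ hH1 hH
    · rw [glue_comm]
      rw [Set.union_comm] at hH ⊢
      exact key c.symm ih₂ hH1 hH

/-- The gluing of two graphs at a common marker commutes with the gluing at the other markers on
the side of `N₁`. -/
lemma merge_aux {N₂ K : Node V} {D₂ : Set (Node V)} {m : ℕ} (hK : K ∈ D₂)
    (base : ∀ H, Compat H N₂ {H} D₂ m →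
      Dec (glue H N₂ (Sum.inr m)) (D₂ \ {K} ∪ {glue H K (Sum.inr m)})) {N₁ : Node V}
    {D₁ : Set (Node V)} (h : Dec N₁ D₁) {H : Node V} (hH : H ∈ D₁) (mH : Sum.inr m ∈ H.verts)
    (c : Compat N₁ N₂ D₁ D₂ m) : Dec (glue N₁ N₂ (Sum.inr m))
      (D₁ \ {H} ∪ (D₂ \ {K} ∪ {glue H K (Sum.inr m)})) := by
  revert hH c
  apply Dec.rec' ?_ ?_ h
  · rintro N _ _ rfl c
    rw [Set.sdiff_self, Set.empty_union]
    exact base _ c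
  · have key : ∀ {N₁ N₃ : Node V} {D₁ D₃ : Set (Node V)} {l : ℕ}, Compat N₁ N₃ D₁ D₃ l →
        (H ∈ D₁ → Compat N₁ N₂ D₁ D₂ m → Dec (glue N₁ N₂ (Sum.inr m))
          (D₁ \ {H} ∪ (D₂ \ {K} ∪ {glue H K (Sum.inr m)}))) →
        H ∈ D₁ → Compat (glue N₁ N₃ (Sum.inr l)) N₂ (D₁ ∪ D₃) D₂ m →
        Dec (glue (glue N₁ N₃ (Sum.inr l)) N₂ (Sum.inr m))
          ((D₁ ∪ D₃) \ {H} ∪ (D₂ \ {K} ∪ {glue H K (Sum.inr m)})) := by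
      intro N₁ N₃ D₁ D₃ l c ih hH c'
      obtain ⟨hm, hml⟩ := c'.m₁
      have hm3 : Sum.inr m ∉ N₃.verts := c.not_mem_verts hH mH hml
      have hm1 := hm.resolve_right hm3
      have hlm : (Sum.inr l : V ⊕ ℕ) ≠ Sum.inr m := fun h => hml h.symm
      have hl2 : Sum.inr l ∉ N₂.verts := fun h =>
        hlm (c'.hd _ ((carrier_union _ _ _).2 (Or.inl (c.h₁.subset_carrier c.m₁)))
          (c'.h₂.subset_carrier h))
      have hdis : ∀ x ∈ N₃.verts, x ∉ N₂.verts := fun x hx hx' => by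
        have := c'.hd x ((carrier_union _ _ _).2 (Or.inr (c.h₂.subset_carrier hx)))
          (c'.h₂.subset_carrier hx')
        exact hm3 (this ▸ hx)
      have c12 : Compat N₁ N₂ D₁ D₂ m := ⟨c.h₁, c'.h₂, hm1, c'.m₂, c.big₁ _, c'.t₂,
        fun x hx => c'.hd x ((carrier_union _ _ _).2 (Or.inl hx))⟩
      rw [glue_right_comm hlm hl2 hm3 (Set.disjoint_left.2 hdis)]
      have e : (D₁ ∪ D₃) \ {H} ∪ (D₂ \ {K} ∪ {glue H K (Sum.inr m)}) =
          (D₁ \ {H} ∪ (D₂ \ {K} ∪ {glue H K (Sum.inr m)})) ∪ D₃ := by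
        rw [Set.union_sdiff_distrib, Set.sdiff_singleton_eq_self (c.not_mem₂ hH),
          Set.union_right_comm]
      rw [e]
      refine .join (ih hH c12) c.h₂ ⟨Or.inl c.m₁, hlm⟩ c.m₂ ?_ c.t₂ ?_
      · obtain ⟨a, ha, b, hb, hab⟩ := c'.t₂
        exact ⟨a, ⟨⟨Or.inr ha.1, ha.2⟩, fun h => hl2 (h ▸ ha.1)⟩, b,
          ⟨⟨Or.inr hb.1, hb.2⟩, fun h => hl2 (h ▸ hb.1)⟩, hab⟩
      · intro x hx hx3
        have hx' : x ∈ carrier D₁ ∨ x ∈ carrier D₂ := by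
          obtain ⟨L, hL | hL | rfl, hxL⟩ := hx
          · exact Or.inl ⟨L, hL.1, hxL⟩
          · exact Or.inr ⟨L, hL.1, hxL⟩
          · exact hxL.1.imp (fun h => ⟨H, hH, h⟩) fun h => ⟨K, hK, h⟩
        rcases hx' with hx' | hx'
        · exact c.hd x hx' hx3
        · obtain rfl := c'.hd x ((carrier_union _ _ _).2 (Or.inr hx3)) hx'
          exact c.hd _ (mem_carrier hH mH) hx3
    rintro N₁ N₃ D₁ D₃ l c ih₁ ih₃ (hH | hH) c'
    · exact key c ih₁ hH c'
    · rw [glue_comm N₁ N₃] at c' ⊢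
      rw [Set.union_comm D₁] at c' ⊢
      exact key c.symm ih₃ hH c'

/-- Two graphs of a decomposition that share a marker may be replaced by the glued graph. -/
lemma Dec.merge {N : Node V} {D : Set (Node V)} (h : Dec N D) {H K : Node V} (hH : H ∈ D)
    (hK : K ∈ D) (hHK : H ≠ K) {l : V ⊕ ℕ} (lH : l ∈ H.verts) (lK : l ∈ K.verts) :
    Dec N (D \ {H, K} ∪ {glue H K l}) := by
  revert H K
  apply Dec.rec' ?_ ?_ h
  · rintro N _ _ H K rfl rfl h; exact absurd rfl h
  · have same : ∀ {N₁ N₂ H K : Node V} {D₁ D₂ : Set (Node V)} {m : ℕ}, Compat N₁ N₂ D₁ D₂ m →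
        H ∈ D₁ → K ∈ D₁ → Dec N₁ (D₁ \ {H, K} ∪ {glue H K l}) →
        Dec (glue N₁ N₂ (Sum.inr m)) ((D₁ ∪ D₂) \ {H, K} ∪ {glue H K l}) := by
      intro N₁ N₂ H K D₁ D₂ m c hH hK ih
      have e : (D₁ ∪ D₂) \ {H, K} ∪ {glue H K l} = (D₁ \ {H, K} ∪ {glue H K l}) ∪ D₂ := by
        have : D₂ \ {H, K} = D₂ := by
          rw [sdiff_eq_left, Set.disjoint_right]
          rintro _ (rfl | rfl)
          exacts [c.not_mem₂ hH, c.not_mem₂ hK]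
        rw [Set.union_sdiff_distrib, this, Set.union_right_comm]
      rw [e]
      refine .join ih c.h₂ c.m₁ c.m₂ c.t₁ c.t₂ fun x hx => c.hd x ?_
      obtain ⟨L, hL | rfl, hxL⟩ := hx
      · exact ⟨L, hL.1, hxL⟩
      · exact hxL.1.elim (fun h => ⟨H, hH, h⟩) fun h => ⟨K, hK, h⟩
    have cross : ∀ {N₁ N₂ H K : Node V} {D₁ D₂ : Set (Node V)} {m : ℕ}, Compat N₁ N₂ D₁ D₂ m →
        H ∈ D₁ → K ∈ D₂ → l ∈ H.verts → l ∈ K.verts →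
        Dec (glue N₁ N₂ (Sum.inr m)) ((D₁ ∪ D₂) \ {H, K} ∪ {glue H K l}) := by
      intro N₁ N₂ H K D₁ D₂ m c hH hK lH lK
      obtain rfl := c.hd l (mem_carrier hH lH) (mem_carrier hK lK)
      have e : (D₁ ∪ D₂) \ {H, K} = D₁ \ {H} ∪ D₂ \ {K} := by
        have h1 := c.not_mem₂ hH
        have h2 := c.symm.not_mem₂ hK
        ext x
        simp only [Set.mem_sdiff, Set.mem_union, Set.mem_insert_iff, Set.mem_singleton_iff]
        have : x = H → x ∉ D₂ := by rintro rfl; exact h1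
        have : x = K → x ∉ D₁ := by rintro rfl; exact h2
        tauto
      rw [e, Set.union_assoc]
      refine merge_aux hK (fun H' c' => ?_) c.h₁ hH lH c
      rw [glue_comm, glue_comm H']
      have := merge_aux (Set.mem_singleton H') (fun K' c'' => ?_) c.h₂ hK lK c'.symm
      · rwa [Set.sdiff_self, Set.empty_union] at this
      · rw [Set.sdiff_self, Set.empty_union]
        exact .single c''.dec.verts_finite c''.dec.conn
    rintro N₁ N₂ D₁ D₂ m c ih₁ ih₂ H K (hH | hH) (hK | hK) hHK lH lK
    · exact same c hH hK (ih₁ hH hK hHK lH lK)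
    · exact cross c hH hK lH lK
    · rw [glue_comm, Set.union_comm D₁]
      exact cross c.symm hH hK lH lK
    · rw [glue_comm N₁, Set.union_comm D₁]
      exact same c.symm hH hK (ih₂ hH hK hHK lH lK)

end Glue2

/-! ### Split decompositions as gluings -/

section Split

variable {V : Type*}

lemma IsSplit.left_subset {H : Node V} {A B : Set (V ⊕ ℕ)} (h : IsSplit H A B) : A ⊆ H.verts :=
  h.union_eq ▸ Set.subset_union_left

lemma IsSplit.right_subset {H : Node V} {A B : Set (V ⊕ ℕ)} (h : IsSplit H A B) : B ⊆ H.verts :=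
  h.union_eq ▸ Set.subset_union_right

lemma IsSplit.not_mem_right {H : Node V} {A B : Set (V ⊕ ℕ)} (h : IsSplit H A B) {x : V ⊕ ℕ}
    (hx : x ∈ A) : x ∉ B := fun h' => Set.disjoint_left.1 h.disjoint hx h'

lemma IsSplit.symm {H : Node V} {A B : Set (V ⊕ ℕ)} (h : IsSplit H A B) : IsSplit H B A :=
  ⟨by rw [Set.union_comm]; exact h.union_eq, h.disjoint.symm, h.right_nontrivial,
    h.left_nontrivial, fun x hx y hy => by rw [H.adj_comm, h.adj_iff y hy x hx, and_comm]⟩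

lemma IsSplit.mem_nbhd {H : Node V} {A B : Set (V ⊕ ℕ)} (h : IsSplit H A B) {x : V ⊕ ℕ}
    (hx : x ∈ A) : x ∈ nbhd H B ↔ ∃ b ∈ B, H.Adj x b :=
  ⟨fun h => let ⟨b, hb, hbx⟩ := h.2; ⟨b, hb, hbx.symm⟩,
    fun ⟨b, hb, hxb⟩ => ⟨⟨h.left_subset hx, h.not_mem_right hx⟩, b, hb, hxb.symm⟩⟩

lemma addMarker_adj_mem {H : Node V} {A N : Set (V ⊕ ℕ)} {m x y : V ⊕ ℕ} (hm : m ∉ A)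
    (hx : x ∈ A) (hy : y ∈ A) : (addMarker H A m N).Adj x y ↔ H.Adj x y := by
  have hxm : x ≠ m := fun h => hm (h ▸ hx)
  have hym : y ≠ m := fun h => hm (h ▸ hy)
  simp [addMarker, hx, hy, hxm, hym]

lemma addMarker_adj_left {H : Node V} {A N : Set (V ⊕ ℕ)} {m y : V ⊕ ℕ} (hm : m ∉ A) :
    (addMarker H A m N).Adj m y ↔ y ∈ N ∩ A ∩ H.verts := by
  constructor
  · rintro (⟨h, -⟩ | ⟨-, -, h⟩ | ⟨-, h, -⟩)
    exacts [absurd h hm, h, absurd rfl h]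
  · exact fun h => Or.inr (Or.inl ⟨rfl, fun e => hm (e ▸ h.1.2), h⟩)

lemma IsSplit.addMarker_verts {H : Node V} {A B N : Set (V ⊕ ℕ)} (h : IsSplit H A B)
    {m : V ⊕ ℕ} : (addMarker H A m N).verts = insert m A := by
  change insert m (A ∩ H.verts) = _
  rw [Set.inter_eq_left.2 h.left_subset]

/-- A graph with a split is glued from the two graphs of the simple split decomposition. -/
lemma IsSplit.eq_glue {H : Node V} {A B : Set (V ⊕ ℕ)} (h : IsSplit H A B) {m : V ⊕ ℕ}
    (hm : m ∉ H.verts) :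
    glue (addMarker H A m (nbhd H B)) (addMarker H B m (nbhd H A)) m = H := by
  have hA : m ∉ A := fun h' => hm (h.left_subset h')
  have hB : m ∉ B := fun h' => hm (h.right_subset h')
  have vA := h.addMarker_verts (N := nbhd H B) (m := m)
  have vB := h.symm.addMarker_verts (N := nbhd H A) (m := m)
  have nA : ∀ x, x ≠ m → x ∉ A → ∀ y, ¬ (addMarker H A m (nbhd H B)).Adj x y := by
    intro x hx hxA y hxy
    have := hxy.fst_mem
    rw [vA] at this
    exact this.elim hx hxA
  have nB : ∀ x, x ≠ m → x ∉ B → ∀ y, ¬ (addMarker H B m (nbhd H A)).Adj x y := by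
    intro x hx hxB y hxy
    have := hxy.fst_mem
    rw [vB] at this
    exact this.elim hx hxB
  have mA : ∀ x ∈ A, (addMarker H A m (nbhd H B)).Adj m x ↔ x ∈ nbhd H B := fun x hx => by
    rw [addMarker_adj_left hA]
    exact ⟨fun h => h.1.1, fun h' => ⟨⟨h', hx⟩, h.left_subset hx⟩⟩
  have mB : ∀ x ∈ B, (addMarker H B m (nbhd H A)).Adj m x ↔ x ∈ nbhd H A := fun x hx => by
    rw [addMarker_adj_left hB]
    exact ⟨fun h => h.1.1, fun h' => ⟨⟨h', hx⟩, h.right_subset hx⟩⟩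
  ext x y
  · rw [mem_glue, vA, vB, ← h.union_eq]
    constructor
    · rintro ⟨(h | h) | (h | h), h'⟩
      exacts [absurd h h', Or.inl h, absurd h h', Or.inr h]
    · rintro (h | h)
      · exact ⟨Or.inl (Or.inr h), fun e => hA (e ▸ h)⟩
      · exact ⟨Or.inr (Or.inr h), fun e => hB (e ▸ h)⟩
  · constructor
    · rintro ⟨hxy, hx, hy, h' | h' | ⟨h1, h2⟩ | ⟨h1, h2⟩⟩
      · have hxA : x ∈ A := by_contra fun hxA => nA x hx hxA y h'
        have hyA : y ∈ A := by_contra fun hyA => nA y hy hyA x h'.symm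
        exact (addMarker_adj_mem hA hxA hyA).1 h'
      · have hxA : x ∈ B := by_contra fun hxA => nB x hx hxA y h'
        have hyA : y ∈ B := by_contra fun hyA => nB y hy hyA x h'.symm
        exact (addMarker_adj_mem hB hxA hyA).1 h'
      · have hxA : x ∈ A := by_contra fun hxA => nA x hx hxA m h1
        have hyA : y ∈ B := by_contra fun hyA => nB y hy hyA m h2.symm
        exact (h.adj_iff x hxA y hyA).2 ⟨(mA x hxA).1 h1.symm, (mB y hyA).1 h2⟩
      · have hxA : x ∈ B := by_contra fun hxA => nB x hx hxA m h1
        have hyA : y ∈ A := by_contra fun hyA => nA y hy hyA m h2.symm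
        exact ((h.adj_iff y hyA x hxA).2 ⟨(mA y hyA).1 h2, (mB x hxA).1 h1.symm⟩).symm
    · intro hxy
      have hx : x ≠ m := fun e => hm (e ▸ hxy.fst_mem)
      have hy : y ≠ m := fun e => hm (e ▸ hxy.snd_mem)
      have hx' := hxy.fst_mem
      have hy' := hxy.snd_mem
      rw [← h.union_eq] at hx' hy'
      refine ⟨hxy.ne, hx, hy, ?_⟩
      rcases hx' with hxA | hxB <;> rcases hy' with hyA | hyB
      · exact Or.inl ((addMarker_adj_mem hA hxA hyA).2 hxy)
      · have := (h.adj_iff x hxA y hyB).1 hxy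
        exact Or.inr (Or.inr (Or.inl ⟨((mA x hxA).2 this.1).symm, (mB y hyB).2 this.2⟩))
      · have := (h.adj_iff y hyA x hxB).1 hxy.symm
        exact Or.inr (Or.inr (Or.inr ⟨((mB x hxB).2 this.2).symm, (mA y hyA).2 this.1⟩))
      · exact Or.inr (Or.inl ((addMarker_adj_mem hB hxB hyB).2 hxy))

/-- Collapsing the other side of the split to the marker maps paths to paths. -/
lemma IsSplit.conn_addMarker {H : Node V} {A B : Set (V ⊕ ℕ)} (h : IsSplit H A B) (hc : Conn H)
    {m : V ⊕ ℕ} (hm : m ∉ H.verts) : Conn (addMarker H A m (nbhd H B)) := by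
  classical
  have hA : m ∉ A := fun h' => hm (h.left_subset h')
  obtain ⟨r, hr⟩ : ∃ r : V ⊕ ℕ → V ⊕ ℕ, r = fun x => if x ∈ A then x else m := ⟨_, rfl⟩
  have rA : ∀ x ∈ A, r x = x := fun x hx => by simp [hr, hx]
  have rB : ∀ x ∈ B, r x = m := fun x hx => by simp [hr, h.symm.not_mem_right hx]
  have step : ∀ x y, H.Adj x y → Relation.ReflTransGen (addMarker H A m (nbhd H B)).Adj (r x)
      (r y) := by
    intro x y hxy
    have hx' := hxy.fst_mem
    have hy' := hxy.snd_mem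
    have key : ∀ x ∈ A, ∀ y ∈ B, H.Adj x y → (addMarker H A m (nbhd H B)).Adj m x :=
      fun x hx y hy hxy => (addMarker_adj_left hA).2
        ⟨⟨(h.mem_nbhd hx).2 ⟨y, hy, hxy⟩, hx⟩, h.left_subset hx⟩
    rw [← h.union_eq] at hx' hy'
    rcases hx' with hxA | hxB <;> rcases hy' with hyA | hyB
    · rw [rA x hxA, rA y hyA]
      exact .single ((addMarker_adj_mem hA hxA hyA).2 hxy)
    · rw [rA x hxA, rB y hyB]
      exact .single (key x hxA y hyB hxy).symm
    · rw [rB x hxB, rA y hyA]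
      exact .single (key y hyA x hxB hxy.symm)
    · rw [rB x hxB, rB y hyB]
  have path : ∀ x y, Relation.ReflTransGen H.Adj x y →
      Relation.ReflTransGen (addMarker H A m (nbhd H B)).Adj (r x) (r y) := by
    intro x y hxy
    induction hxy with
    | refl => exact .refl
    | tail _ hyz ih => exact ih.trans (step _ _ hyz)
  have surj : ∀ x ∈ (addMarker H A m (nbhd H B)).verts, ∃ x' ∈ H.verts, r x' = x := by
    intro x hx
    rw [h.addMarker_verts] at hx
    rcases hx with rfl | hx
    · obtain ⟨b, hb⟩ := h.right_nontrivial.nonempty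
      exact ⟨b, h.right_subset hb, rB b hb⟩
    · exact ⟨x, h.left_subset hx, rA x hx⟩
  intro x hx y hy
  obtain ⟨x', hx', rfl⟩ := surj x hx
  obtain ⟨y', hy', rfl⟩ := surj y hy
  exact path _ _ (hc x' hx' y' hy')

lemma nontrivial_insert_sdiff {A : Set (V ⊕ ℕ)} (h : A.Nontrivial) {m : V ⊕ ℕ} (hm : m ∉ A) :
    (insert m A \ {m}).Nontrivial := by
  rwa [Set.insert_sdiff_self_of_notMem hm]

/-- The two graphs of a simple split decomposition form a decomposition. -/
lemma IsSplit.compat {H : Node V} {A B : Set (V ⊕ ℕ)} (h : IsSplit H A B) (hf : H.verts.Finite)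
    (hc : Conn H) {m : ℕ} (hm : Sum.inr m ∉ H.verts) :
    Compat (addMarker H A (Sum.inr m) (nbhd H B)) (addMarker H B (Sum.inr m) (nbhd H A))
      {addMarker H A (Sum.inr m) (nbhd H B)} {addMarker H B (Sum.inr m) (nbhd H A)} m := by
  have hA : Sum.inr m ∉ A := fun h' => hm (h.left_subset h')
  have hB : Sum.inr m ∉ B := fun h' => hm (h.right_subset h')
  have vA := h.addMarker_verts (N := nbhd H B) (m := Sum.inr m)
  have vB := h.symm.addMarker_verts (N := nbhd H A) (m := Sum.inr m)
  refine ⟨.single ?_ (h.conn_addMarker hc hm), .single ?_ (h.symm.conn_addMarker hc hm), ?_, ?_,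
    ?_, ?_, ?_⟩
  · rw [vA]; exact (hf.subset h.left_subset).insert _
  · rw [vB]; exact (hf.subset h.right_subset).insert _
  · rw [vA]; exact Set.mem_insert _ _
  · rw [vB]; exact Set.mem_insert _ _
  · rw [vA]; exact nontrivial_insert_sdiff h.left_nontrivial hA
  · rw [vB]; exact nontrivial_insert_sdiff h.right_nontrivial hB
  · rintro x ⟨_, rfl, hx⟩ ⟨_, rfl, hx'⟩
    rw [vA] at hx
    rw [vB] at hx'
    rcases hx with hx | hx
    · exact hx
    · exact hx'.resolve_right (h.not_mem_right hx)

/-- A decomposition may be refined by a split of one of its graphs. -/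
lemma Dec.refine {N : Node V} {D : Set (Node V)} (h : Dec N D) {H : Node V} (hH : H ∈ D)
    {A B : Set (V ⊕ ℕ)} (hs : IsSplit H A B) {m : ℕ} (hm : ∀ K ∈ D, Sum.inr m ∉ K.verts) :
    Dec N ((D \ {H}) ∪
      {addMarker H A (Sum.inr m) (nbhd H B), addMarker H B (Sum.inr m) (nbhd H A)}) := by
  revert hH hm
  apply Dec.rec' ?_ ?_ h
  · rintro N hf hc rfl hm
    have c := hs.compat hf hc (hm H rfl)
    have := c.dec
    rw [hs.eq_glue (hm H rfl)] at this
    rwa [Set.sdiff_self, Set.empty_union, Set.insert_eq]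
  · have key : ∀ {N₁ N₂ : Node V} {D₁ D₂ : Set (Node V)} {l : ℕ}, Compat N₁ N₂ D₁ D₂ l →
        (H ∈ D₁ → (∀ K ∈ D₁, Sum.inr m ∉ K.verts) → Dec N₁ ((D₁ \ {H}) ∪
          {addMarker H A (Sum.inr m) (nbhd H B), addMarker H B (Sum.inr m) (nbhd H A)})) →
        H ∈ D₁ → (∀ K ∈ D₁ ∪ D₂, Sum.inr m ∉ K.verts) →
        Dec (glue N₁ N₂ (Sum.inr l)) (((D₁ ∪ D₂) \ {H}) ∪
          {addMarker H A (Sum.inr m) (nbhd H B), addMarker H B (Sum.inr m) (nbhd H A)}) := by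
      intro N₁ N₂ D₁ D₂ l c ih hH hm
      rw [Set.union_sdiff_distrib, Set.sdiff_singleton_eq_self (c.not_mem₂ hH),
        Set.union_right_comm]
      refine .join (ih hH fun K hK => hm K (Or.inl hK)) c.h₂ c.m₁ c.m₂ c.t₁ c.t₂ ?_
      intro x hx hx2
      obtain ⟨L, hL | rfl | rfl, hxL⟩ := hx
      · exact c.hd x ⟨L, hL.1, hxL⟩ hx2
      · rcases hxL with rfl | hxL
        · obtain ⟨K, hK, hxK⟩ := hx2
          exact absurd hxK (hm K (Or.inr hK))
        · exact c.hd x ⟨H, hH, hxL.2⟩ hx2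
      · rcases hxL with rfl | hxL
        · obtain ⟨K, hK, hxK⟩ := hx2
          exact absurd hxK (hm K (Or.inr hK))
        · exact c.hd x ⟨H, hH, hxL.2⟩ hx2
    rintro N₁ N₂ D₁ D₂ l c ih₁ ih₂ (hH | hH) hm
    · exact key c ih₁ hH hm
    · rw [glue_comm]
      rw [Set.union_comm D₁] at hm ⊢
      exact key c.symm ih₂ hH hm

lemma Dec.of_splitStep {N : Node V} {D D' : Set (Node V)} (h : Dec N D) (hs : SplitStep D D') :
    Dec N D' := by
  obtain ⟨H, hH, A, B, hs, m, hm, rfl⟩ := hs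
  exact h.refine hH hs hm

lemma toNode_conn {G : SimpleGraph V} (h : G.Connected) : Conn (toNode G) := by
  rintro _ ⟨x, rfl⟩ _ ⟨y, rfl⟩
  have := h.preconnected x y
  rw [SimpleGraph.reachable_iff_reflTransGen] at this
  induction this with
  | refl => exact .refl
  | tail _ h ih => exact ih.tail ⟨_, _, h, rfl, rfl⟩

lemma IsSplitDecomposition.dec [Finite V] {G : SimpleGraph V} (hG : G.Connected)
    {D : Set (Node V)} (h : IsSplitDecomposition G D) : Dec (toNode G) D := by
  induction h with
  | refl => exact .single (Set.finite_range _) (toNode_conn hG)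
  | tail _ h ih => exact ih.of_splitStep h

/-- The two sides of a gluing form a split. -/
lemma isSplit_glue {N₁ N₂ : Node V} {m : V ⊕ ℕ} (h₁ : Conn N₁) (h₂ : Conn N₂)
    (m₁ : m ∈ N₁.verts) (m₂ : m ∈ N₂.verts) (t₁ : (N₁.verts \ {m}).Nontrivial)
    (t₂ : (N₂.verts \ {m}).Nontrivial) (hd : ∀ x ∈ N₁.verts, x ∈ N₂.verts → x = m) :
    IsSplit (glue N₁ N₂ m) (N₁.verts \ {m}) (N₂.verts \ {m}) ∧
      addMarker (glue N₁ N₂ m) (N₁.verts \ {m}) m (nbhd (glue N₁ N₂ m) (N₂.verts \ {m})) = N₁ ∧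
      addMarker (glue N₁ N₂ m) (N₂.verts \ {m}) m (nbhd (glue N₁ N₂ m) (N₁.verts \ {m})) = N₂ := by
  have cross : ∀ {N₁ N₂ : Node V}, (∀ x ∈ N₁.verts, x ∈ N₂.verts → x = m) →
      ∀ x ∈ N₁.verts \ {m}, ∀ y ∈ N₂.verts \ {m},
        ((glue N₁ N₂ m).Adj x y ↔ N₁.Adj m x ∧ N₂.Adj m y) := by
    intro N₁ N₂ hd x hx y hy
    constructor
    · rintro ⟨-, -, -, h | h | h | h⟩
      · exact absurd (hd y h.snd_mem hy.1) hy.2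
      · exact absurd (hd x hx.1 h.fst_mem) hx.2
      · exact ⟨h.1.symm, h.2⟩
      · exact absurd (hd x hx.1 h.1.fst_mem) hx.2
    · rintro ⟨h, h'⟩
      refine ⟨?_, hx.2, hy.2, Or.inr (Or.inr (Or.inl ⟨h.symm, h'⟩))⟩
      rintro rfl
      exact hx.2 (hd x hx.1 hy.1)
  have nb : ∀ {N₁ N₂ : Node V}, Conn N₂ → m ∈ N₂.verts → (N₂.verts \ {m}).Nontrivial →
      (∀ x ∈ N₁.verts, x ∈ N₂.verts → x = m) →
      ∀ x ∈ N₁.verts \ {m}, (x ∈ nbhd (glue N₁ N₂ m) (N₂.verts \ {m}) ↔ N₁.Adj m x) := by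
    intro N₁ N₂ h₂ m₂ t₂ hd x hx
    constructor
    · rintro ⟨-, y, hy, h⟩
      exact ((cross hd x hx y hy).1 h.symm).1
    · intro h
      obtain ⟨b, hb⟩ := h₂.exists_adj m₂ t₂.nonempty
      have hb' : b ∈ N₂.verts \ {m} := ⟨hb.snd_mem, hb.ne.symm⟩
      exact ⟨⟨⟨Or.inl hx.1, hx.2⟩, fun h => hx.2 (hd x hx.1 h.1)⟩, b, hb',
        ((cross hd x hx b hb').2 ⟨h, hb⟩).symm⟩
  have hd' : ∀ x ∈ N₂.verts, x ∈ N₁.verts → x = m := fun x h h' => hd x h' h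
  have mark : ∀ {N₁ N₂ : Node V}, Conn N₂ → m ∈ N₁.verts → m ∈ N₂.verts →
      (N₂.verts \ {m}).Nontrivial → (∀ x ∈ N₁.verts, x ∈ N₂.verts → x = m) →
      addMarker (glue N₁ N₂ m) (N₁.verts \ {m}) m (nbhd (glue N₁ N₂ m) (N₂.verts \ {m})) = N₁ := by
    intro N₁ N₂ h₂ m₁ m₂ t₂ hd
    have hm : m ∉ N₁.verts \ {m} := fun h => h.2 rfl
    have hv : (addMarker (glue N₁ N₂ m) (N₁.verts \ {m}) m
        (nbhd (glue N₁ N₂ m) (N₂.verts \ {m}))).verts = N₁.verts := by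
      ext x
      constructor
      · rintro (rfl | hx)
        exacts [m₁, hx.1.1]
      · intro hx
        by_cases hxm : x = m
        · exact Or.inl hxm
        · exact Or.inr ⟨⟨hx, hxm⟩, Or.inl hx, hxm⟩
    have hma : ∀ y, (addMarker (glue N₁ N₂ m) (N₁.verts \ {m}) m
        (nbhd (glue N₁ N₂ m) (N₂.verts \ {m}))).Adj m y ↔ N₁.Adj m y := by
      intro y
      rw [addMarker_adj_left hm]
      constructor
      · exact fun h => (nb h₂ m₂ t₂ hd y h.1.2).1 h.1.1
      · intro h
        have hy : y ∈ N₁.verts \ {m} := ⟨h.snd_mem, h.ne.symm⟩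
        exact ⟨⟨(nb h₂ m₂ t₂ hd y hy).2 h, hy⟩, Or.inl hy.1, hy.2⟩
    ext x y
    · rw [hv]
    · by_cases hxm : x = m
      · rw [hxm, hma]
      by_cases hym : y = m
      · rw [hym, SimpleGraph.Subgraph.adj_comm, hma, N₁.adj_comm]
      by_cases hx : x ∈ N₁.verts
      · by_cases hy : y ∈ N₁.verts
        · rw [addMarker_adj_mem hm ⟨hx, hxm⟩ ⟨hy, hym⟩]
          constructor
          · rintro ⟨-, -, -, h | h | h | h⟩
            · exact h
            · exact absurd (hd x hx h.fst_mem) hxm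
            · exact absurd (hd y hy h.2.snd_mem) hym
            · exact absurd (hd x hx h.1.fst_mem) hxm
          · exact fun h => ⟨h.ne, hxm, hym, Or.inl h⟩
        · exact iff_of_false (fun h => hy (hv ▸ h.snd_mem)) fun h => hy h.snd_mem
      · exact iff_of_false (fun h => hx (hv ▸ h.fst_mem)) fun h => hx h.fst_mem
  refine ⟨⟨?_, ?_, t₁, t₂, ?_⟩, mark h₂ m₁ m₂ t₂ hd, ?_⟩
  · rw [← Set.union_sdiff_distrib]
    rfl
  · exact Set.disjoint_left.2 fun x hx hx' => hx.2 (hd x hx.1 hx'.1)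
  · intro x hx y hy
    rw [cross hd x hx y hy, nb h₂ m₂ t₂ hd x hx, glue_comm, nb h₁ m₁ t₁ hd' y hy]
  · rw [glue_comm]
    exact mark h₁ m₂ m₁ t₁ hd'

/-- A decomposition arises by splits; the graphs in `E` are not affected. -/
lemma Dec.splitSteps {N : Node V} {D : Set (Node V)} (h : Dec N D) {E : Set (Node V)}
    (h1 : ∀ x ∈ carrier D, ∀ K ∈ E, x ∈ K.verts → x ∈ N.verts)
    (h2 : ∀ K ∈ E, (N.verts ∩ K.verts).Subsingleton) :
    Relation.ReflTransGen SplitStep ({N} ∪ E) (D ∪ E) := by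
  revert E
  apply Dec.rec' ?_ ?_ h
  · exact fun _ _ _ _ _ _ => .refl
  · intro N₁ N₂ D₁ D₂ m c ih₁ ih₂ E h1 h2
    have h1' : ∀ x, x ∈ carrier D₁ ∨ x ∈ carrier D₂ → ∀ K ∈ E, x ∈ K.verts →
        x ∈ (glue N₁ N₂ (Sum.inr m)).verts := fun x hx =>
      h1 x ((carrier_union _ _ _).2 hx)
    have hE : glue N₁ N₂ (Sum.inr m) ∉ E := by
      intro hE
      have := h2 _ hE
      rw [Set.inter_self] at this
      obtain ⟨a, ha, b, hb, hab⟩ := c.t₁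
      exact hab (this ⟨Or.inl ha.1, ha.2⟩ ⟨Or.inl hb.1, hb.2⟩)
    obtain ⟨s1, s2, s3⟩ := isSplit_glue c.h₁.conn c.h₂.conn c.m₁ c.m₂ c.t₁ c.t₂ c.hd'
    have step : SplitStep ({glue N₁ N₂ (Sum.inr m)} ∪ E) ({N₁} ∪ ({N₂} ∪ E)) := by
      refine ⟨_, Or.inl rfl, _, _, s1, m, ?_, ?_⟩
      · rintro K (rfl | hK) hm
        · exact hm.2 rfl
        · exact (h1' _ (Or.inl (c.h₁.subset_carrier c.m₁)) K hK hm).2 rfl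
      · rw [s2, s3, Set.union_sdiff_distrib, Set.sdiff_self, Set.empty_union,
          Set.sdiff_singleton_eq_self hE, ← Set.union_assoc, Set.insert_eq, Set.union_comm E]
    have sub : ∀ {N₁ N₂ : Node V} {D₁ D₂ : Set (Node V)}, Compat N₁ N₂ D₁ D₂ m →
        (∀ x ∈ carrier D₁, ∀ K ∈ E, x ∈ K.verts → x ∈ (glue N₁ N₂ (Sum.inr m)).verts) →
        ∀ x ∈ carrier D₁, ∀ K ∈ E, x ∈ K.verts → x ∈ N₁.verts := by
      intro N₁ N₂ D₁ D₂ c h1 x hx K hK hxK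
      obtain ⟨h, h'⟩ := h1 x hx K hK hxK
      exact h.resolve_right fun hx2 => h' (c.hd x hx (c.h₂.subset_carrier hx2))
    have single : ∀ {A B : Set (V ⊕ ℕ)}, (∀ x ∈ A, x ∈ B → x = Sum.inr m) →
        (A ∩ B).Subsingleton := fun h x hx y hy => (h x hx.1 hx.2).trans (h y hy.1 hy.2).symm
    have sub1 := sub c fun x hx => h1' x (Or.inl hx)
    have sub2 := sub c.symm fun x hx => by rw [glue_comm]; exact h1' x (Or.inr hx)
    refine .head step ((ih₁ (E := {N₂} ∪ E) ?_ ?_).trans ?_)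
    · rintro x hx K (rfl | hK) hxK
      · rw [c.hd x hx (c.h₂.subset_carrier hxK)]
        exact c.m₁
      · exact sub1 x hx K hK hxK
    · rintro K (rfl | hK)
      · exact single c.hd'
      · intro x hx y hy
        have hx' := h1' x (Or.inl (c.h₁.subset_carrier hx.1)) K hK hx.2
        have hy' := h1' y (Or.inl (c.h₁.subset_carrier hy.1)) K hK hy.2
        exact h2 K hK ⟨hx', hx.2⟩ ⟨hy', hy.2⟩
    · have e1 : D₁ ∪ ({N₂} ∪ E) = {N₂} ∪ (D₁ ∪ E) := Set.union_left_comm _ _ _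
      have e2 : D₁ ∪ D₂ ∪ E = D₂ ∪ (D₁ ∪ E) := by rw [← Set.union_assoc, Set.union_comm D₁]
      rw [e1, e2]
      refine ih₂ ?_ ?_
      · rintro x hx K (hK | hK) hxK
        · rw [c.hd x ⟨K, hK, hxK⟩ hx]
          exact c.m₂
        · exact sub2 x hx K hK hxK
      · rintro K (hK | hK)
        · exact single fun x hx hxK => c.hd x ⟨K, hK, hxK⟩ (c.h₂.subset_carrier hx)
        · intro x hx y hy
          have hx' := h1' x (Or.inr (c.h₂.subset_carrier hx.1)) K hK hx.2
          have hy' := h1' y (Or.inr (c.h₂.subset_carrier hy.1)) K hK hy.2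
          exact h2 K hK ⟨hx', hx.2⟩ ⟨hy', hy.2⟩

lemma Dec.isSplitDecomposition {G : SimpleGraph V} {D : Set (Node V)} (h : Dec (toNode G) D) :
    IsSplitDecomposition G D := by
  have := h.splitSteps (E := ∅) (fun _ _ _ h => h.elim) fun _ h => h.elim
  rwa [Set.union_empty, Set.union_empty] at this

/-- In contrast to `Dec.node_big`, nothing is assumed about the number of vertices of `N`. -/
lemma Dec.node_big' {N : Node V} {D : Set (Node V)} (h : Dec N D) (hD : D.Nontrivial) {H : Node V}
    (hH : H ∈ D) : Big H := by
  revert hD hH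
  apply Dec.rec' ?_ ?_ h
  · exact fun N _ _ h => absurd h Set.not_nontrivial_singleton
  · rintro N₁ N₂ D₁ D₂ m c - - - (hH | hH)
    exacts [c.h₁.node_big c.big₁ hH, c.h₂.node_big c.symm.big₁ hH]

/-- `H` is a star with centre `c`. -/
def StarAt (H : Node V) (c : V ⊕ ℕ) : Prop :=
  c ∈ H.verts ∧ ∀ x ∈ H.verts, ∀ y ∈ H.verts, (H.Adj x y ↔ x ≠ y ∧ (x = c ∨ y = c))

/-- Two stars glued at a marker that is a leaf of one and the centre of the other form a star. -/
lemma StarAt.glue {H K : Node V} {c l : V ⊕ ℕ} (hH : StarAt H c) (hK : StarAt K l) (hl : l ∈ H.verts)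
    (hcl : c ≠ l) (hd : ∀ x ∈ H.verts, x ∈ K.verts → x = l) : StarAt (glue H K l) c := by
  have hcK : c ∉ K.verts := fun h => hcl (hd c hH.1 h)
  have hcl' : H.Adj c l := (hH.2 c hH.1 l hl).2 ⟨hcl, Or.inl rfl⟩
  have key : ∀ y ∈ (DHPolygon.glue H K l).verts, c ≠ y → (DHPolygon.glue H K l).Adj c y := by
    rintro y ⟨hy | hy, hyl⟩ hcy
    · exact ⟨hcy, hcl, hyl, Or.inl ((hH.2 c hH.1 y hy).2 ⟨hcy, Or.inl rfl⟩)⟩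
    · exact ⟨hcy, hcl, hyl, Or.inr (Or.inr (Or.inl
        ⟨hcl', (hK.2 l hK.1 y hy).2 ⟨fun h => hyl h.symm, Or.inl rfl⟩⟩))⟩
  refine ⟨⟨Or.inl hH.1, hcl⟩, fun x hx y hy => ⟨?_, ?_⟩⟩
  · have two : ∀ x, H.Adj x l → x ≠ l → x = c := fun x h hxl =>
      ((hH.2 x h.fst_mem l hl).1 h).2.resolve_right fun h => hcl h.symm
    rintro ⟨hxy, hxl, hyl, h | h | h | h⟩
    · exact ⟨hxy, ((hH.2 x h.fst_mem y h.snd_mem).1 h).2⟩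
    · exact absurd ((hK.2 x h.fst_mem y h.snd_mem).1 h).2 (not_or.2 ⟨hxl, hyl⟩)
    · exact ⟨hxy, Or.inl (two x h.1 hxl)⟩
    · exact ⟨hxy, Or.inr (two y h.2.symm hyl)⟩
  · rintro ⟨hxy, rfl | rfl⟩
    · exact key y hy hxy
    · exact (key x hx hxy.symm).symm

/-- In a standard decomposition, no marker is a leaf of one star and the centre of another. -/
lemma IsStandardDecomposition.no_star_star [Finite V] {G : SimpleGraph V} (hG : G.Connected)
    {D : Set (Node V)} (h : IsStandardDecomposition G D) {H K : Node V} (hH : H ∈ D) (hK : K ∈ D)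
    (hHK : H ≠ K) {c l : V ⊕ ℕ} (hlH : l ∈ H.verts) (hcl : c ≠ l) (sH : StarAt H c) :
    ¬ StarAt K l := by
  intro sK
  obtain ⟨⟨hsd, hgood⟩, hmin⟩ := h
  have hdec := hsd.dec hG
  have hlK := sK.1
  obtain ⟨m, rfl⟩ := hdec.marker_inr hH ⟨hlH, K, hK, hHK.symm, hlK⟩
  have hDn : D.Nontrivial := ⟨H, hH, K, hK, hHK⟩
  have hd : ∀ x ∈ H.verts, x ∈ K.verts → x = Sum.inr m := fun x hx hx' =>
    hdec.shared_unique hH hK hHK hx hx' hlH hlK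
  have hmerge := hdec.merge hH hK hHK hlH hlK
  obtain ⟨s1, s2, s3⟩ := isSplit_glue (hdec.node_conn hH) (hdec.node_conn hK) hlH hlK
    (hdec.node_big' hDn hH _) (hdec.node_big' hDn hK _) hd
  refine hmin ⟨_, ⟨hmerge.isSplitDecomposition, ?_⟩, .single ?_⟩
  · rintro L (hL | rfl)
    · exact hgood L hL.1
    · exact Or.inr (Or.inr ⟨c, sH.glue sK hlH hcl hd⟩)
  · have hM : glue H K (Sum.inr m) ∉ D := by
      intro hM
      obtain ⟨a, ha, b, hb, hab⟩ := hdec.node_big' hDn hH (Sum.inr m)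
      refine hab (hdec.shared_unique hM hH ?_ ⟨Or.inl ha.1, ha.2⟩ ha.1 ⟨Or.inl hb.1, hb.2⟩ hb.1)
      intro h
      rw [← h] at hlH
      exact hlH.2 rfl
    refine ⟨_, Or.inr rfl, _, _, s1, m, ?_, ?_⟩
    · rintro L (⟨hL, hL'⟩ | rfl) hm
      · rcases hdec.marker_two hH hK hL hlH hlK hm with h | h | h
        · exact hHK h
        · exact hL' (Or.inl h.symm)
        · exact hL' (Or.inr h.symm)
      · exact hm.2 rfl
    · rw [s2, s3, Set.union_sdiff_distrib, Set.sdiff_self, Set.union_empty,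
        Set.sdiff_singleton_eq_self fun h => hM h.1, Set.sdiff_union_self,
        Set.union_eq_left.2 (Set.insert_subset hH (Set.singleton_subset_iff.2 hK))]

lemma SplitStep.ncard {D D' : Set (Node V)} (h : SplitStep D D') (hD : D.Finite) :
    D'.Finite ∧ D'.ncard = D.ncard + 1 := by
  obtain ⟨H, hH, A, B, hs, m, hm, rfl⟩ := h
  have hA : addMarker H A (Sum.inr m) (nbhd H B) ∉ D := fun h => hm _ h (Set.mem_insert _ _)
  have hB : addMarker H B (Sum.inr m) (nbhd H A) ∉ D := fun h => hm _ h (Set.mem_insert _ _)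
  have hne : addMarker H A (Sum.inr m) (nbhd H B) ≠ addMarker H B (Sum.inr m) (nbhd H A) := by
    intro h
    obtain ⟨a, ha⟩ := hs.left_nontrivial.nonempty
    have h1 : a ∈ (addMarker H A (Sum.inr m) (nbhd H B)).verts := by
      rw [hs.addMarker_verts]; exact Or.inr ha
    rw [h, hs.symm.addMarker_verts] at h1
    rcases h1 with h1 | h1
    · exact hm H hH (h1 ▸ hs.left_subset ha)
    · exact hs.not_mem_right ha h1
  have hf : (D \ {H}).Finite := hD.sdiff
  refine ⟨hf.union (Set.toFinite _), ?_⟩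
  rw [Set.ncard_union_eq _ hf (Set.toFinite _), Set.ncard_pair hne,
    ← Set.ncard_sdiff_singleton_add_one hH hD]
  rw [Set.disjoint_right]
  rintro _ (rfl | rfl) h
  exacts [hA h.1, hB h.1]

lemma ncard_lt_of_transGen {D D' : Set (Node V)} (h : Relation.TransGen SplitStep D D')
    (hD : D.Finite) : D'.Finite ∧ D.ncard < D'.ncard := by
  induction h with
  | single h =>
    obtain ⟨h1, h2⟩ := h.ncard hD
    exact ⟨h1, by omega⟩
  | tail _ h ih =>
    obtain ⟨h1, h2⟩ := h.ncard ih.1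
    exact ⟨h1, by omega⟩

lemma one_lt_ncard_of_nontrivial {α : Type*} {s : Set α} (hs : s.Finite) (h : s.Nontrivial) :
    1 < s.ncard := by
  have := hs.to_subtype
  exact Set.one_lt_ncard_iff_nontrivial.2 h

/-- Each gluing adds up the numbers of vertices, each at least three, and subtracts two. -/
lemma Dec.ncard_add_two_le {N : Node V} {D : Set (Node V)} (h : Dec N D) (hN : Big N) :
    D.ncard + 2 ≤ N.verts.ncard := by
  revert hN
  apply Dec.rec' ?_ ?_ h
  · intro N hf _ hN
    obtain ⟨x, hx, -⟩ := hN (Sum.inr 0)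
    have h1 : 1 < (N.verts \ {x}).ncard := one_lt_ncard_of_nontrivial hf.sdiff (hN x)
    have := Set.ncard_sdiff_singleton_add_one hx.1 hf
    rw [Set.ncard_singleton]
    omega
  · intro N₁ N₂ D₁ D₂ m c ih₁ ih₂ _
    have h1 := ih₁ c.big₁
    have h2 := ih₂ c.symm.big₁
    have e : (glue N₁ N₂ (Sum.inr m)).verts =
        N₁.verts \ {Sum.inr m} ∪ N₂.verts \ {Sum.inr m} := Set.union_sdiff_distrib ..
    have f1 := c.h₁.verts_finite
    have f2 := c.h₂.verts_finite
    have e1 := Set.ncard_sdiff_singleton_add_one c.m₁ f1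
    have e2 := Set.ncard_sdiff_singleton_add_one c.m₂ f2
    have hdis : Disjoint (N₁.verts \ {Sum.inr m}) (N₂.verts \ {Sum.inr m}) :=
      Set.disjoint_left.2 fun x hx hx' => hx.2 (c.hd' x hx.1 hx'.1)
    rw [e, Set.ncard_union_eq hdis f1.sdiff f2.sdiff]
    have := Set.ncard_union_le D₁ D₂
    omega

lemma exists_isStandardDecomposition [Finite V] {G : SimpleGraph V} (hG : G.Connected) :
    ∃ D, IsStandardDecomposition G D := by
  -- a decomposition with as many graphs as possible contains only prime graphs
  have hgood : ∃ D, IsGoodDecomposition G D := by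
    obtain ⟨S, hS⟩ : ∃ S : Set ℕ, S = {n | ∃ D, IsSplitDecomposition G D ∧ D.ncard = n} := ⟨_, rfl⟩
    have hbdd : BddAbove S := by
      refine ⟨(toNode G).verts.ncard + 1, ?_⟩
      rw [hS]
      rintro n ⟨D, hD, rfl⟩
      have hdec := hD.dec hG
      by_cases hb : Big (toNode G)
      · have := hdec.ncard_add_two_le hb
        omega
      · have : D.Subsingleton := by
          rw [← Set.not_nontrivial_iff]
          intro hDn
          refine hb fun x => ?_
          obtain ⟨H, hH⟩ := hdec.nonempty
          obtain ⟨φ, h1, h2, -⟩ := hdec.node_emb hH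
          have hfin := hdec.verts_finite
          have h3 : 2 < (toNode G).verts.ncard := by
            have h4 := Set.ncard_le_ncard_of_injOn φ h1 (fun x hx y hy h => h2 x hx y hy h) hfin
            obtain ⟨y, hy, -⟩ := hdec.node_big' hDn hH (Sum.inr 0)
            have h5 := one_lt_ncard_of_nontrivial (hdec.node_finite hH).sdiff
              (hdec.node_big' hDn hH y)
            have := Set.ncard_sdiff_singleton_add_one hy.1 (hdec.node_finite hH)
            omega
          have := hfin.sdiff (t := {x}) |>.to_subtype
          rw [← Set.one_lt_ncard_iff_nontrivial]
          have := Set.pred_ncard_le_ncard_sdiff_singleton (toNode G).verts x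
          omega
        have := Set.ncard_le_one_iff_eq hdec.finite |>.2 this.eq_empty_or_singleton
        omega
    have hne : S.Nonempty := by
      rw [hS]
      exact ⟨_, {toNode G}, .refl, rfl⟩
    have hmem := Nat.sSup_mem hne hbdd
    have hmax := fun n (hn : n ∈ S) => le_csSup hbdd hn
    generalize sSup S = M at hmem hmax
    rw [hS] at hmem hmax
    obtain ⟨D, hD, rfl⟩ := hmem
    refine ⟨D, hD, fun H hH => Or.inl ?_⟩
    rintro ⟨A, B, hs⟩
    have hdec := hD.dec hG
    have hfin : (carrier D).Finite := by
      have : carrier D = ⋃ H ∈ D, H.verts := by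
        ext x
        simp [carrier]
      rw [this]
      exact hdec.finite.biUnion fun H hH => hdec.node_finite hH
    obtain ⟨m, hm⟩ := (hfin.preimage (f := (Sum.inr : ℕ → V ⊕ ℕ))
      Sum.inr_injective.injOn).infinite_compl.nonempty
    have hstep : SplitStep D _ := ⟨H, hH, A, B, hs, m, fun K hK h => hm ⟨K, hK, h⟩, rfl⟩
    have h1 := hmax _ ⟨_, hD.tail hstep, rfl⟩
    rw [(hstep.ncard hdec.finite).2] at h1
    omega
  -- a good decomposition with as few graphs as possible is not a refinement of another one
  obtain ⟨D₀, hD₀⟩ := hgood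
  obtain ⟨S, hS⟩ : ∃ S : Set ℕ, S = {n | ∃ D, IsGoodDecomposition G D ∧ D.ncard = n} := ⟨_, rfl⟩
  have hne : S.Nonempty := by
    rw [hS]
    exact ⟨_, D₀, hD₀, rfl⟩
  have hmem := Nat.sInf_mem hne
  have hmin := fun n (hn : n ∈ S) => Nat.sInf_le hn
  generalize sInf S = M at hmem hmin
  rw [hS] at hmem hmin
  obtain ⟨D, hD, rfl⟩ := hmem
  refine ⟨D, hD, ?_⟩
  rintro ⟨D', hD', h⟩
  have h1 := hmin _ ⟨D', hD', rfl⟩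
  have h2 := (ncard_lt_of_transGen h (hD'.1.dec hG).finite).2
  omega

end Split

/-! ### Distance hereditary graphs have splits -/

section DistanceHereditary

open SimpleGraph

variable {V : Type*} {G : SimpleGraph V}

lemma connected_insert {S : Set V} (h : (G.induce S).Connected) {x y : V} (hy : y ∈ S)
    (hxy : G.Adj x y) : (G.induce (insert x S)).Connected := by
  have : insert x S = {x, y} ∪ S := by
    ext z
    simp only [Set.mem_insert_iff, Set.mem_union, Set.mem_singleton_iff]
    constructor
    · rintro (h | h)
      exacts [Or.inl (Or.inl h), Or.inr h]
    · rintro ((h | rfl) | h)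
      exacts [Or.inl h, Or.inr hy, Or.inr h]
  rw [this]
  exact induce_union_connected (induce_pair_connected_of_adj hxy).preconnected h.preconnected
    ⟨y, by simp, hy⟩

lemma connected_induce_singleton (x : V) : (G.induce {x}).Connected := by
  have : Subsingleton ({x} : Set V) := Set.subsingleton_coe _ |>.2 Set.subsingleton_singleton
  have : Nonempty ({x} : Set V) := ⟨⟨x, rfl⟩⟩
  exact ⟨fun a b => by rw [Subsingleton.elim a b]⟩

lemma dist_le_dist_add_one (hG : G.Connected) (v : V) {x y : V} (h : G.Adj x y) :
    G.dist x v ≤ G.dist y v + 1 := by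
  have := hG.dist_triangle (u := x) (v := y) (w := v)
  rw [dist_eq_one_iff_adj.2 h] at this
  omega

lemma exists_adj_closer (hG : G.Connected) {x v : V} (h : x ≠ v) :
    ∃ y, G.Adj x y ∧ G.dist y v + 1 = G.dist x v := by
  obtain ⟨p, hp⟩ := hG.exists_walk_length_eq_dist x v
  cases p with
  | nil => exact absurd rfl h
  | @cons _ y _ hxy q =>
    refine ⟨y, hxy, ?_⟩
    have h1 := dist_le q
    have h2 := dist_le_dist_add_one hG v hxy
    rw [Walk.length_cons] at hp
    omega

/-- The vertices of a shortest path from `z` to `v`. -/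
lemma exists_geodesic (hG : G.Connected) (v z : V) :
    ∃ C : Set V, (G.induce C).Connected ∧ z ∈ C ∧ v ∈ C ∧
      ∀ u ∈ C, u ≠ z → G.dist u v < G.dist z v := by
  obtain ⟨n, hn⟩ : ∃ n, G.dist z v = n := ⟨_, rfl⟩
  induction n generalizing z with
  | zero =>
    rw [hG.dist_eq_zero_iff] at hn
    subst hn
    exact ⟨{z}, connected_induce_singleton z, rfl, rfl, fun u hu h => absurd hu h⟩
  | succ n ih =>
    have hzv : z ≠ v := by
      rintro rfl
      simp at hn
    obtain ⟨y, hzy, hy⟩ := exists_adj_closer hG hzv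
    obtain ⟨C, h1, h2, h3, h4⟩ := ih y (by omega)
    refine ⟨insert z C, connected_insert h1 h2 hzy, Or.inl rfl, Or.inr h3, ?_⟩
    rintro u (rfl | hu) huz
    · exact absurd rfl huz
    · by_cases huy : u = y
      · rw [huy]; omega
      · have := h4 u hu huy
        omega

lemma IsDistanceHereditary.exists_closer (hdh : IsDistanceHereditary G) {S : Set V}
    (hS : (G.induce S).Connected) {y v : V} (hy : y ∈ S) (hv : v ∈ S) (hyv : y ≠ v) :
    ∃ x ∈ S, G.Adj y x ∧ G.dist x v + 1 = G.dist y v := by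
  obtain ⟨x, h1, h2⟩ := exists_adj_closer hS (x := ⟨y, hy⟩) (v := ⟨v, hv⟩) fun h =>
    hyv (congrArg Subtype.val h)
  rw [hdh S hS, hdh S hS] at h2
  exact ⟨x, x.2, h1, h2⟩

/-- Two vertices at distance two have a common neighbour in every connected induced subgraph. -/
lemma IsDistanceHereditary.exists_common (hdh : IsDistanceHereditary G) {S : Set V}
    (hS : (G.induce S).Connected) {x y s : V} (hx : x ∈ S) (hy : y ∈ S) (hxy : x ≠ y)
    (hn : ¬ G.Adj x y) (h1 : G.Adj x s) (h2 : G.Adj s y) : ∃ c ∈ S, G.Adj x c ∧ G.Adj c y := by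
  obtain ⟨c, hc, h3, h4⟩ := hdh.exists_closer hS hx hy hxy
  refine ⟨c, hc, h3, ?_⟩
  have h5 : G.dist x y ≤ 2 := dist_le (Walk.cons h1 (Walk.cons h2 Walk.nil))
  by_cases hcy : c = y
  · exact absurd (hcy ▸ h3) hn
  · have h6 : G.dist c y ≠ 0 := by
      intro h
      obtain ⟨t, ht, h7⟩ := hdh.exists_closer hS hc hy hcy
      omega
    exact dist_eq_one_iff_adj.1 (by omega)

/-- Let `z` be one step closer to `v` than `y`. If `y` is joined to `z` by a path `y, a, b, z` where
`a` and `b` are not closer to `v` than `y`, then `y` and `z` are adjacent. -/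
lemma IsDistanceHereditary.adj_of_path (hdh : IsDistanceHereditary G) (hG : G.Connected)
    {v y a b z : V} (hz : G.dist z v + 1 = G.dist y v) (hya : G.Adj y a) (hab : a = b ∨ G.Adj a b)
    (hbz : G.Adj b z) (ha : G.dist y v ≤ G.dist a v) (hb : G.dist y v ≤ G.dist b v) :
    G.Adj y z := by
  obtain ⟨C, h1, h2, h3, h4⟩ := exists_geodesic hG v z
  have hc : (G.induce (insert y (insert a (insert b C)))).Connected := by
    refine connected_insert ?_ (Set.mem_insert _ _) hya
    have hb := connected_insert h1 h2 hbz
    rcases hab with rfl | hab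
    · rwa [Set.insert_eq_of_mem (Set.mem_insert _ _)]
    · exact connected_insert hb (Set.mem_insert _ _) hab
  have hyv : y ≠ v := by
    rintro rfl
    simp at hz
  obtain ⟨x, hx, hyx, h5⟩ := hdh.exists_closer hc (Set.mem_insert _ _)
    (Or.inr (Or.inr (Or.inr h3))) hyv
  rcases hx with rfl | rfl | rfl | hx
  · exact absurd hyx G.irrefl
  · omega
  · omega
  · by_cases hxz : x = z
    · exact hxz ▸ hyx
    · have := h4 x hx hxz
      omega

/-- A split of `G` in terms of one of its parts. -/
def IsSplitPart (G : SimpleGraph V) (A : Set V) : Prop :=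
  A.Nontrivial ∧ Aᶜ.Nontrivial ∧
    ∀ a ∈ A, ∀ a' ∈ A, ∀ b ∉ A, ∀ b' ∉ A, G.Adj a b → G.Adj a' b' → G.Adj a b'

/-- Let `x` be a vertex at the greatest distance from `v` with as few neighbours as possible, and
suppose that the vertices at this distance are pairwise nonadjacent. Then the neighbours of `x` have
the same neighbours outside of this set. -/
lemma IsDistanceHereditary.nbhd_module [Finite V] (hdh : IsDistanceHereditary G)
    (hG : G.Connected) {v x : V} {k : ℕ} (hk : 2 ≤ k) (hmax : ∀ u, G.dist u v ≤ k)
    (hind : ∀ a b, G.dist a v = k → G.dist b v = k → ¬ G.Adj a b) (hx : G.dist x v = k)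
    (hmin : ∀ y, G.dist y v = k → (G.neighborSet x).ncard ≤ (G.neighborSet y).ncard)
    {s s' w : V} (hs : G.Adj x s) (hs' : G.Adj x s') (hw : ¬ G.Adj x w) (hsw : G.Adj s w) :
    G.Adj s' w := by
  have nx : ∀ y u, G.dist y v = k → G.Adj y u → G.dist u v + 1 = k := by
    intro y u hy h
    have h1 := dist_le_dist_add_one hG v h
    have h2 := hmax u
    have h3 : G.dist u v ≠ k := fun h' => hind y u hy h' h
    omega
  have ls := nx x s hx hs
  have ls' := nx x s' hx hs'
  by_cases hwx : w = x
  · exact hwx ▸ hs'.symm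
  by_contra hcon
  -- a common neighbour `z` of `s` and `s'` that is closer to `v`
  obtain ⟨z, hsz, hz⟩ := exists_adj_closer hG (x := s) (v := v) (by
    rintro rfl
    rw [dist_self] at ls
    omega)
  have hs'z : G.Adj s' z :=
    hdh.adj_of_path hG (v := v) (by omega) hs'.symm (Or.inr hs) hsz (by omega) (by omega)
  have hxz : ¬ G.Adj x z := fun h => by
    have := nx x z hx h
    omega
  have l1 := dist_le_dist_add_one hG v hsw
  have l2 := dist_le_dist_add_one hG v hsw.symm
  have l3 := hmax w
  obtain h | h | h : G.dist w v + 2 = k ∨ G.dist w v + 1 = k ∨ G.dist w v = k := by omega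
  · exact hcon (hdh.adj_of_path hG (v := v) (by omega) hs'.symm (Or.inr hs) hsw (by omega) (by omega))
  · have hwz : G.Adj w z :=
      hdh.adj_of_path hG (v := v) (by omega) hsw.symm (Or.inl rfl) hsz (by omega) (by omega)
    have hc : (G.induce {x, s', z, w}).Connected :=
      connected_insert (connected_insert (connected_insert (connected_induce_singleton w) rfl
        hwz.symm) (Set.mem_insert _ _) hs'z) (Set.mem_insert _ _) hs'
    obtain ⟨c, hcS, h1, h2⟩ := hdh.exists_common hc (Or.inl rfl) (by simp) (Ne.symm hwx) hw hs hsw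
    rcases hcS with rfl | rfl | rfl | rfl
    exacts [G.irrefl h1, hcon h2, hxz h1, hw h1]
  · -- as `w` has at least as many neighbours as `x`, it has one that `x` does not have
    obtain ⟨u, hwu, hxu⟩ : ∃ u, G.Adj w u ∧ ¬ G.Adj x u := by
      by_contra! hsub
      have hss : G.neighborSet w ⊂ G.neighborSet x :=
        ⟨fun u hu => hsub u hu, fun h' => hcon ((show G.Adj w s' from h' hs').symm)⟩
      have := Set.ncard_lt_ncard hss
      have := hmin w h
      omega
    have lu := nx w u h hwu
    have huz : G.Adj u z :=
      hdh.adj_of_path hG (v := v) (by omega) hwu.symm (Or.inr hsw.symm) hsz (by omega) (by omega)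
    have hwz : ¬ G.Adj w z := fun h' => by
      have := nx w z h h'
      omega
    have hc : (G.induce {x, s', z, u, w}).Connected :=
      connected_insert (connected_insert (connected_insert (connected_insert
        (connected_induce_singleton w) rfl hwu.symm) (Set.mem_insert _ _) huz.symm)
        (Set.mem_insert _ _) hs'z) (Set.mem_insert _ _) hs'
    obtain ⟨c, hcS, h1, h2⟩ := hdh.exists_common hc (Or.inl rfl) (by simp) (Ne.symm hwx) hw hs hsw
    rcases hcS with rfl | rfl | rfl | rfl | rfl
    exacts [G.irrefl h1, hcon h2, hxz h1, hxu h1, hw h1]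

lemma isSplitPart_pair [Finite V] (hcard : 4 ≤ Nat.card V) {a b : V} (hab : a ≠ b)
    (h : ∀ y ∉ ({a, b} : Set V), ∀ z ∉ ({a, b} : Set V), ∀ x ∈ ({a, b} : Set V),
      ∀ x' ∈ ({a, b} : Set V), G.Adj x y → G.Adj x' z → G.Adj x z) :
    IsSplitPart G {a, b} := by
  refine ⟨Set.nontrivial_pair hab, ?_, fun x hx x' hx' y hy z hz => h y hy z hz x hx x' hx'⟩
  rw [← Set.one_lt_ncard_iff_nontrivial]
  have h1 := Set.ncard_add_ncard_compl ({a, b} : Set V)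
  rw [Set.ncard_pair hab] at h1
  omega

/-- A connected distance hereditary graph with at least four vertices has a split. -/
theorem IsDistanceHereditary.exists_split [Finite V] (hdh : IsDistanceHereditary G)
    (hG : G.Connected) (hcard : 4 ≤ Nat.card V) : ∃ A, IsSplitPart G A := by
  by_cases htop : ∀ v u, v ≠ u → G.Adj v u
  -- every partition of a clique is a split
  · have : Nontrivial V := Finite.one_lt_card_iff_nontrivial.1 (by omega)
    obtain ⟨a, b, hab⟩ := exists_pair_ne V
    refine ⟨_, isSplitPart_pair hcard hab fun y _ z hz x hx _ _ _ _ => htop x z ?_⟩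
    rintro rfl
    exact hz hx
  push Not at htop
  obtain ⟨v, u₀, hvu, hvu'⟩ := htop
  have : Nonempty V := ⟨v⟩
  obtain ⟨t, ht⟩ := Finite.exists_max fun u => G.dist u v
  obtain ⟨k, hk⟩ : ∃ k, G.dist t v = k := ⟨_, rfl⟩
  have hmax : ∀ u, G.dist u v ≤ k := fun u => hk ▸ ht u
  have hk2 : 2 ≤ k := by
    have h1 := hG.one_lt_dist_of_ne_of_not_adj (u := u₀) (v := v) hvu.symm fun h => hvu' h.symm
    have := hmax u₀
    omega
  have hconn1 : ∀ x, G.dist x v = k → ∃ s, G.Adj x s ∧ G.dist s v + 1 = k := by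
    intro x hx
    have hxv : x ≠ v := by
      rintro rfl
      rw [SimpleGraph.dist_self] at hx
      omega
    obtain ⟨s, h1, h2⟩ := exists_adj_closer hG hxv
    exact ⟨s, h1, by omega⟩
  by_cases hind : ∀ a b, G.dist a v = k → G.dist b v = k → ¬ G.Adj a b
  · obtain ⟨S, hS⟩ : ∃ S : Set V, S = {x | G.dist x v = k} := ⟨_, rfl⟩
    obtain ⟨x, hx, hmin⟩ := Set.exists_min_image S (fun y => (G.neighborSet y).ncard)
      (Set.toFinite _) ⟨t, by rw [hS]; exact hk⟩
    rw [hS] at hx hmin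
    obtain ⟨s, hs, ls⟩ := hconn1 x hx
    by_cases hone : ∀ s', G.Adj x s' → s' = s
    -- if `x` is pendant, then it forms a part together with its neighbour
    · refine ⟨_, isSplitPart_pair hcard (a := x) (b := s) hs.ne ?_⟩
      rintro y hy z hz a ha a' ha' hay ha'z
      rcases ha with rfl | rfl
      · exact absurd (Or.inr (hone y hay)) hy
      · rcases ha' with rfl | rfl
        · exact absurd (Or.inr (hone z ha'z)) hz
        · exact ha'z
    · push Not at hone
      obtain ⟨s', hs', hne⟩ := hone
      have hxv : ¬ G.Adj x v := by
        intro h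
        rw [Set.mem_ofPred_eq, dist_eq_one_iff_adj.2 h] at hx
        omega
      have hne' : x ≠ v := by
        rintro rfl
        rw [Set.mem_ofPred_eq, SimpleGraph.dist_self] at hx
        omega
      exact ⟨G.neighborSet x, ⟨s, hs, s', hs', hne.symm⟩, ⟨x, G.irrefl, v, hxv, hne'⟩,
        fun a ha a' ha' b _ b' hb' _ h =>
          hdh.nbhd_module hG hk2 hmax hind hx hmin ha' ha hb' h⟩
  · push Not at hind
    obtain ⟨a, b, ha, hb, hab⟩ := hind
    -- the component of `a` in the subgraph of the vertices at greatest distance from `v`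
    obtain ⟨R, hR⟩ : ∃ R : Set V, R = {x | Relation.ReflTransGen
      (fun p q => G.dist p v = k ∧ G.dist q v = k ∧ G.Adj p q) a x} := ⟨_, rfl⟩
    have hRk : ∀ x ∈ R, G.dist x v = k := by
      intro x hx
      rw [hR] at hx
      rcases Relation.ReflTransGen.cases_tail hx with rfl | ⟨_, -, h⟩
      exacts [ha, h.2.1]
    have hRs : ∀ x ∈ R, ∀ y, G.Adj x y → y ∉ R → G.dist y v + 1 = k := by
      intro x hx y hxy hy
      have h1 := hRk x hx
      have h2 := dist_le_dist_add_one hG v hxy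
      have h3 := hmax y
      have h4 : G.dist y v ≠ k := by
        intro h
        rw [hR] at hx hy
        exact hy (Relation.ReflTransGen.tail hx ⟨h1, h, hxy⟩)
      omega
    have haR : a ∈ R := by rw [hR]; exact .refl
    have hbR : b ∈ R := by rw [hR]; exact .single ⟨ha, hb, hab⟩
    have hsame : ∀ x ∈ R, ∀ z, G.dist z v + 1 = k → (G.Adj x z ↔ G.Adj a z) := by
      intro x hx z hz
      rw [hR] at hx
      induction hx with
      | refl => rfl
      | tail _ h ih =>
        rw [← ih]
        exact ⟨
          fun h' => hdh.adj_of_path hG (v := v) (by omega) h.2.2 (Or.inl rfl) h' (by omega)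
            (by omega),
          fun h' => hdh.adj_of_path hG (v := v) (by omega) h.2.2.symm (Or.inl rfl) h' (by omega)
            (by omega)⟩
    refine ⟨R, ⟨a, haR, b, hbR, hab.ne⟩, ?_, ?_⟩
    · obtain ⟨s, -, ls⟩ := hconn1 a ha
      refine ⟨v, fun h => ?_, s, fun h => ?_, ?_⟩
      · have := hRk v h
        rw [SimpleGraph.dist_self] at this
        omega
      · have := hRk s h
        omega
      · rintro rfl
        rw [SimpleGraph.dist_self] at ls
        omega
    · intro x hx x' hx' y hy z hz _ h
      have lz := hRs x' hx' z h hz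
      exact (hsame x hx z lz).2 ((hsame x' hx' z lz).1 h)

lemma dist_map_le {U U' : Type*} {A : SimpleGraph U}
    {B : SimpleGraph U'} (hA : A.Connected) (g : A →g B) (x y : U) :
    B.dist (g x) (g y) ≤ A.dist x y := by
  obtain ⟨p, hp⟩ := hA.exists_walk_length_eq_dist x y
  rw [← hp, ← Walk.length_map g p]
  exact dist_le _

/-- The distances in a connected graph that embeds into a distance hereditary one. -/
lemma IsDistanceHereditary.dist_embedding {W : Type*} {G' : SimpleGraph W}
    (hdh : IsDistanceHereditary G) (hG' : G'.Connected) (f : G' ↪g G) (x y : W) :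
    G'.dist x y = G.dist (f x) (f y) := by
  let e : G' ≃g G.induce (Set.range f) :=
    ⟨Equiv.ofInjective f f.injective, fun {a b} => f.map_adj_iff⟩
  have hc : (G.induce (Set.range f)).Connected := e.connected_iff.1 hG'
  refine le_antisymm ?_ (dist_map_le hG' f.toHom x y)
  have h1 := dist_map_le hc e.symm.toHom (e x) (e y)
  rw [hdh _ hc] at h1
  have e1 : ∀ x, e.symm.toHom (e x) = x := e.symm_apply_apply
  rw [e1, e1] at h1
  exact h1

lemma IsDistanceHereditary.of_embedding {W : Type*} {G' : SimpleGraph W}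
    (hdh : IsDistanceHereditary G) (hG' : G'.Connected) (f : G' ↪g G) : IsDistanceHereditary G' := by
  intro S hS x y
  rw [hdh.dist_embedding hS ((Embedding.induce S).trans f), hdh.dist_embedding hG' f]
  rfl

end DistanceHereditary

section NodeSplit

variable {V : Type*} {G : SimpleGraph V}

lemma Conn.coe_connected {H : Node V} (h : Conn H) (hne : H.verts.Nonempty) :
    H.coe.Connected := by
  have key : ∀ x (hx : x ∈ H.verts) y, Relation.ReflTransGen H.Adj x y →
      ∃ hy : y ∈ H.verts, H.coe.Reachable ⟨x, hx⟩ ⟨y, hy⟩ := by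
    intro x hx y hxy
    induction hxy with
    | refl => exact ⟨hx, .rfl⟩
    | tail _ h ih =>
      obtain ⟨hb, h'⟩ := ih
      exact ⟨h.snd_mem, h'.trans (SimpleGraph.Adj.reachable (by exact h))⟩
  have : Nonempty H.verts := hne.to_subtype
  exact ⟨fun x y => (key x x.2 y (h x x.2 y y.2)).2⟩

lemma toNode_adj {u v : V} : (toNode G).Adj (Sum.inl u) (Sum.inl v) ↔ G.Adj u v := by
  constructor
  · rintro ⟨a, b, h, ha, hb⟩
    rwa [Sum.inl_injective ha, Sum.inl_injective hb] at h
  · exact fun h => ⟨u, v, h, rfl, rfl⟩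

lemma exists_isSplit_of_emb (hdh : IsDistanceHereditary G) {H : Node V} (hH : Conn H)
    (hf : H.verts.Finite) (he : Emb H (toNode G)) (hcard : 4 ≤ H.verts.ncard) :
    ∃ A B, IsSplit H A B := by
  obtain ⟨φ, h1, h2, h3⟩ := he
  choose f hfφ using h1
  have hne : H.verts.Nonempty := Set.nonempty_of_ncard_ne_zero (by omega)
  have hc := hH.coe_connected hne
  have : Finite H.verts := hf.to_subtype
  let g : H.coe ↪g G :=
    { toFun := fun x => f x x.2
      inj' := fun x y h => Subtype.ext (h2 x x.2 y y.2 (by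
        rw [← hfφ x x.2, ← hfφ y y.2]
        exact congrArg Sum.inl h))
      map_rel_iff' := fun {x y} => by
        have := h3 x x.2 y y.2
        rw [← hfφ x x.2, ← hfφ y y.2] at this
        exact toNode_adj.symm.trans this }
  obtain ⟨A, ⟨a, ha, a', ha', haa⟩, ⟨b, hb, b', hb', hbb⟩, hA⟩ :=
    (hdh.of_embedding hc g).exists_split hc hcard
  have inj : Function.Injective (Subtype.val : H.verts → V ⊕ ℕ) := Subtype.val_injective
  refine ⟨Subtype.val '' A, Subtype.val '' Aᶜ, ?_, ?_, ?_, ?_, ?_⟩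
  · rw [← Set.image_union, Set.union_compl_self, Set.image_univ, Subtype.range_coe]
  · exact (Set.disjoint_image_iff inj).2 disjoint_compl_right
  · exact ⟨a, ⟨a, ha, rfl⟩, a', ⟨a', ha', rfl⟩, fun h => haa (inj h)⟩
  · exact ⟨b, ⟨b, hb, rfl⟩, b', ⟨b', hb', rfl⟩, fun h => hbb (inj h)⟩
  · rintro _ ⟨x, hx, rfl⟩ _ ⟨y, hy, rfl⟩
    constructor
    · intro h
      refine ⟨⟨⟨x.2, ?_⟩, y, ⟨y, hy, rfl⟩, h.symm⟩, ⟨⟨y.2, ?_⟩, x, ⟨x, hx, rfl⟩, h⟩⟩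
      · rintro ⟨z, hz, hzx⟩
        exact hz (inj hzx ▸ hx)
      · rintro ⟨z, hz, hzy⟩
        exact hy (inj hzy ▸ hz)
    · rintro ⟨⟨-, _, ⟨w, hw, rfl⟩, hwx⟩, -, _, ⟨z, hz, rfl⟩, hzy⟩
      exact hA x hx z hz w hw y hy hwx.symm hzy

/-- `H` is a clique or a star. -/
def IsSimple (H : Node V) : Prop := IsCliqueNode H ∨ ∃ c, StarAt H c

lemma Conn.isSimple_of_ncard_le_three {H : Node V} (hH : Conn H) (hf : H.verts.Finite)
    (hcard : H.verts.ncard ≤ 3) : IsSimple H := by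
  by_cases hcl : IsCliqueNode H
  · exact Or.inl hcl
  unfold IsCliqueNode at hcl
  push Not at hcl
  obtain ⟨a, ha, b, hb, hab, hn⟩ := hcl
  obtain ⟨c, hc⟩ := hH.exists_adj ha ⟨b, hb, hab.symm⟩
  obtain ⟨c', hc'⟩ := hH.exists_adj hb ⟨a, ha, hab⟩
  have hca : c ≠ a := hc.ne.symm
  have hcb : c ≠ b := by
    rintro rfl
    exact hn hc
  have hv : ({a, b, c} : Set (V ⊕ ℕ)) = H.verts := by
    refine Set.eq_of_subset_of_ncard_le ?_ ?_ hf
    · rintro x (rfl | rfl | rfl)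
      exacts [ha, hb, hc.snd_mem]
    · rw [Set.ncard_insert_of_notMem (by simp [hab, hca.symm]), Set.ncard_pair hcb.symm]
      exact hcard
  have hcc : H.Adj b c := by
    have := hc'.snd_mem
    rw [← hv] at this
    rcases this with rfl | rfl | rfl
    exacts [absurd hc'.symm hn, absurd rfl hc'.ne, hc']
  refine Or.inr ⟨c, hc.snd_mem, fun x hx y hy => ?_⟩
  rw [← hv] at hx hy
  have hn' : ¬ H.Adj b a := fun h => hn h.symm
  have ir : ∀ x, ¬ H.Adj x x := fun x h => h.ne rfl
  rcases hx with rfl | rfl | rfl <;> rcases hy with rfl | rfl | rfl <;>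
    simp [hn, hn', hc, hc.symm, hcc, hcc.symm, hca, hca.symm, hcb, hcb.symm, hab, hab.symm, ir]

/-- The graphs of a good decomposition of a distance hereditary graph are cliques and stars. -/
lemma IsGoodDecomposition.isSimple [Finite V] (hG : G.Connected) (hdh : IsDistanceHereditary G)
    {D : Set (Node V)} (h : IsGoodDecomposition G D) {H : Node V} (hH : H ∈ D) : IsSimple H := by
  have hdec := h.1.dec hG
  rcases h.2 H hH with hp | hp | ⟨c, hc, hp⟩
  · by_cases hcard : H.verts.ncard ≤ 3
    · exact (hdec.node_conn hH).isSimple_of_ncard_le_three (hdec.node_finite hH) hcard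
    · exact absurd (exists_isSplit_of_emb hdh (hdec.node_conn hH) (hdec.node_finite hH)
        (hdec.node_emb hH) (by omega)) hp
  · exact Or.inl hp
  · exact Or.inr ⟨c, hc, hp⟩

end NodeSplit

/-! ### Chord diagrams from decompositions into cliques and stars -/

section Build

variable {V : Type*}

lemma glue_adj_left {N H : Node V} {l : V ⊕ ℕ} (hd : ∀ x ∈ N.verts, x ∈ H.verts → x = l)
    {u v : V ⊕ ℕ} (hu : u ∈ N.verts) (hul : u ≠ l) (hv : v ∈ N.verts) (hvl : v ≠ l) :
    (glue N H l).Adj u v ↔ N.Adj u v := by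
  constructor
  · rintro ⟨-, -, -, h | h | h | h⟩
    · exact h
    · exact absurd (hd u hu h.fst_mem) hul
    · exact absurd (hd v hv h.2.snd_mem) hvl
    · exact absurd (hd u hu h.1.fst_mem) hul
  · exact fun h => ⟨h.ne, hul, hvl, Or.inl h⟩

lemma glue_adj_right {N H : Node V} {l : V ⊕ ℕ} (hd : ∀ x ∈ N.verts, x ∈ H.verts → x = l)
    {u v : V ⊕ ℕ} (hu : u ∈ H.verts) (hul : u ≠ l) (hv : v ∈ H.verts) (hvl : v ≠ l) :
    (glue N H l).Adj u v ↔ H.Adj u v := by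
  rw [glue_comm]
  exact glue_adj_left (fun x hx hx' => hd x hx' hx) hu hul hv hvl

lemma glue_adj_cross {N H : Node V} {l : V ⊕ ℕ} (hd : ∀ x ∈ N.verts, x ∈ H.verts → x = l)
    {h u : V ⊕ ℕ} (hh : h ∈ H.verts) (hhl : h ≠ l) (hu : u ∈ N.verts) (hul : u ≠ l) :
    (glue N H l).Adj h u ↔ H.Adj h l ∧ N.Adj l u := by
  constructor
  · rintro ⟨-, -, -, h1 | h1 | h1 | h1⟩
    · exact absurd (hd h h1.fst_mem hh) hhl
    · exact absurd (hd u hu h1.snd_mem) hul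
    · exact absurd (hd u hu h1.2.snd_mem) hul
    · exact h1
  · intro h1
    refine ⟨?_, hhl, hul, Or.inr (Or.inr (Or.inr h1))⟩
    rintro rfl
    exact hhl (hd h hu hh)

/-- The set of tags after the tag at `l` (if there is one) has moved to `h`. -/
def moveTag {α : Type*} (l h : α) (X : Set α) : Set α := {x | (x = h ∧ l ∈ X) ∨ (x ∈ X ∧ x ≠ l)}

lemma moveTag_insert {α : Type*} {l h : α} {Y : Set α} (hl : l ∉ Y) :
    moveTag l h (insert l Y) = insert h Y := by
  ext x
  constructor
  · rintro (⟨rfl, -⟩ | ⟨rfl | hx, hxl⟩)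
    exacts [Or.inl rfl, absurd rfl hxl, Or.inr hx]
  · rintro (rfl | hx)
    · exact Or.inl ⟨rfl, Or.inl rfl⟩
    · exact Or.inr ⟨Or.inr hx, fun h' => hl (h' ▸ hx)⟩

lemma ncard_moveTag {α : Type*} {l h : α} {X : Set α} (hX : X.Finite) (hh : h ∉ X) :
    (moveTag l h X).ncard = X.ncard := by
  by_cases hl : l ∈ X
  · have hl' : l ∉ X \ {l} := fun h => h.2 rfl
    obtain ⟨Y, hY, rfl⟩ : ∃ Y, l ∉ Y ∧ insert l Y = X :=
      ⟨_, hl', Set.insert_sdiff_self_of_mem hl⟩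
    have hYf := hX.subset (Set.subset_insert l Y)
    rw [moveTag_insert hY, Set.ncard_insert_of_notMem hY hYf,
      Set.ncard_insert_of_notMem (fun h' => hh (Or.inr h')) hYf]
  · congr 1
    ext x
    constructor
    · rintro (h | h)
      exacts [absurd h.2 hl, h.1]
    · exact fun h => Or.inr ⟨h, fun h' => hl (h' ▸ h)⟩

/-- A vertex of `H` adjacent to the marker takes over the chord of the marker. -/
lemma HasDiagram.rename_marker {N H : Node V} {l h : V ⊕ ℕ} {X : Set (V ⊕ ℕ)}
    (hdia : HasDiagram N.verts N.Adj X) (hd : ∀ x ∈ N.verts, x ∈ H.verts → x = l)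
    (hl : l ∈ N.verts) (hh : H.Adj h l) :
    HasDiagram (insert h (N.verts \ {l})) (glue N H l).Adj (moveTag l h X) := by
  have hhl : h ≠ l := hh.ne
  have hhN : h ∉ N.verts := fun h' => hhl (hd h h' hh.fst_mem)
  have h2 : ∀ u ∈ N.verts, u ≠ l → ((glue N H l).Adj h u ↔ N.Adj l u) := fun u hu hul =>
    (glue_adj_cross hd hh.fst_mem hhl hu hul).trans (and_iff_right hh)
  refine hdia.rename hl hhN (fun u hu hul v hv hvl => glue_adj_left hd hu hul hv hvl) h2 ?_
  exact fun u hu hul => (SimpleGraph.Subgraph.adj_comm ..).trans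
    ((h2 u hu hul).trans (SimpleGraph.Subgraph.adj_comm ..))

/-- If `l` is universal in a clique or star with at least three vertices, then any two other
vertices are twins. -/
lemma IsSimple.twins {H : Node V} {l : V ⊕ ℕ} (hH : IsSimple H) (hbig : Big H)
    (huniv : ∀ y ∈ H.verts, y ≠ l → H.Adj y l) {x y z : V ⊕ ℕ} (hx : x ∈ H.verts)
    (hy : y ∈ H.verts) (hz : z ∈ H.verts) (hxl : x ≠ l) (hyl : y ≠ l) (hzl : z ≠ l) (hxz : x ≠ z)
    (hyz : y ≠ z) : H.Adj x z ↔ H.Adj y z := by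
  rcases hH with hH | ⟨c, hc, hH⟩
  · exact iff_of_true (hH x hx z hz hxz) (hH y hy z hz hyz)
  · have hcl : c = l := by
      by_contra hcl
      obtain ⟨a, ha, hac, hal⟩ : ∃ a ∈ H.verts, a ≠ c ∧ a ≠ l := by
        obtain ⟨a, ha, b, hb, hab⟩ := hbig l
        by_cases hac : a = c
        · exact ⟨b, hb.1, fun h => hab (hac.trans h.symm), hb.2⟩
        · exact ⟨a, ha.1, hac, ha.2⟩
      have h := huniv a ha hal
      exact ((hH a ha l h.snd_mem).1 h).2.elim hac fun h => hcl h.symm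
    subst hcl
    rw [hH x hx z hz, hH y hy z hz]
    exact iff_of_false (fun h => h.2.elim hxl hzl) fun h => h.2.elim hyl hzl

/-- A clique or star is attached at a universal vertex `l`. -/
lemma HasDiagram.attach_universal {N H : Node V} {l x : V ⊕ ℕ} {X : Set (V ⊕ ℕ)}
    (hdia : HasDiagram N.verts N.Adj X) (hd : ∀ x ∈ N.verts, x ∈ H.verts → x = l)
    (hl : l ∈ N.verts) (hH : IsSimple H) (hf : H.verts.Finite) (hbig : Big H)
    (huniv : ∀ y ∈ H.verts, y ≠ l → H.Adj y l) (hx : x ∈ H.verts) (hxl : x ≠ l) :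
    HasDiagram (glue N H l).verts (glue N H l).Adj (moveTag l x X) := by
  have hsymm : ∀ u v, (glue N H l).Adj u v ↔ (glue N H l).Adj v u := fun u v =>
    SimpleGraph.Subgraph.adj_comm ..
  -- the other vertices of `H` are twins of `x`
  have h3 := (hdia.rename_marker hd hl (huniv x hx hxl)).union_twins hsymm
    (Z := H.verts \ {l}) hf.sdiff (l := x) (Or.inl rfl) ?_
  · convert h3 using 1
    ext z
    constructor
    · rintro ⟨hz | hz, hzl⟩
      exacts [Or.inl (Or.inr ⟨hz, hzl⟩), Or.inr ⟨hz, hzl⟩]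
    · rintro ((rfl | hz) | hz)
      exacts [⟨Or.inr hx, hxl⟩, ⟨Or.inl hz.1, hz.2⟩, ⟨Or.inr hz.1, hz.2⟩]
  · rintro y ⟨hy, hyl⟩ u hu hux huy
    rcases hu with (rfl | hu) | hu
    · exact absurd rfl hux
    · rw [glue_adj_cross hd hy hyl hu.1 hu.2, glue_adj_cross hd hx hxl hu.1 hu.2]
      exact and_congr_left fun _ => iff_of_true (huniv y hy hyl) (huniv x hx hxl)
    · rw [glue_adj_right hd hy hyl hu.1 hu.2, glue_adj_right hd hx hxl hu.1 hu.2]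
      exact hH.twins hbig huniv hy hx hu.1 hyl hxl hu.2 huy.symm hux.symm

/-- A clique or star is attached at its marker `l`. The corner at `l` moves to an arbitrary vertex
`x` of the clique or star. -/
lemma HasDiagram.attach {N H : Node V} {l x : V ⊕ ℕ} {Y : Set (V ⊕ ℕ)}
    (hdia : HasDiagram N.verts N.Adj (insert l Y)) (hd : ∀ x ∈ N.verts, x ∈ H.verts → x = l)
    (hl : l ∈ N.verts) (hlH : l ∈ H.verts) (hlY : l ∉ Y) (hYN : Y ⊆ N.verts) (hH : IsSimple H)
    (hf : H.verts.Finite) (hbig : Big H) (hx : x ∈ H.verts) (hxl : x ≠ l) :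
    HasDiagram (glue N H l).verts (glue N H l).Adj (insert x Y) := by
  have hsymm : ∀ u v, (glue N H l).Adj u v ↔ (glue N H l).Adj v u := fun u v =>
    SimpleGraph.Subgraph.adj_comm ..
  by_cases huniv : ∀ y ∈ H.verts, y ≠ l → H.Adj y l
  · have := hdia.attach_universal hd hl hH hf hbig huniv hx hxl
    rwa [moveTag_insert hlY] at this
  · obtain ⟨c, hc⟩ : ∃ c, StarAt H c := by
      rcases hH with hH | hH
      · exact absurd (fun y hy hyl => hH y hy l hlH hyl) huniv
      · exact hH
    have hcl : c ≠ l := by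
      rintro rfl
      exact huniv fun y hy hyc => (hc.2 y hy c hlH).2 ⟨hyc, Or.inr rfl⟩
    have hcH := hc.1
    have hadj : H.Adj c l := (hc.2 c hcH l hlH).2 ⟨hcl, Or.inl rfl⟩
    have hcN : c ∉ N.verts := fun h => hcl (hd c h hcH)
    have hcY : c ∉ Y := fun h => hcN (hYN h)
    -- a leaf of the star is adjacent to the centre only
    have hleaf : ∀ y ∈ H.verts, y ≠ l → y ≠ c → ∀ u ∈ (glue N H l).verts,
        ((glue N H l).Adj y u ↔ u = c) := by
      rintro y hy hyl hyc u ⟨hu | hu, hul⟩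
      · rw [glue_adj_cross hd hy hyl hu hul, hc.2 y hy l hlH]
        refine iff_of_false (fun h => h.1.2.elim hyc hcl.symm) ?_
        rintro rfl
        exact hcN hu
      · rw [glue_adj_right hd hy hyl hu hul, hc.2 y hy u hu]
        refine ⟨fun h => h.2.resolve_left hyc, ?_⟩
        rintro rfl
        exact ⟨hyc, Or.inr rfl⟩
    -- the centre takes over the chord of `l`; a first leaf `z` is pendant there, and the other leaves
    -- are twins of `z`
    have h0 := hdia.rename_marker hd hl hadj
    rw [moveTag_insert hlY] at h0
    obtain ⟨z, hz, hzl, hzc, hzx⟩ : ∃ z ∈ H.verts, z ≠ l ∧ z ≠ c ∧ (x = c ∨ x = z) := by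
      by_cases hxc : x = c
      · obtain ⟨a, ha, b, hb, hab⟩ := hbig l
        by_cases hac : a = c
        · exact ⟨b, hb.1, hb.2, fun h => hab (hac.trans h.symm), Or.inl hxc⟩
        · exact ⟨a, ha.1, ha.2, hac, Or.inl hxc⟩
      · exact ⟨x, hx, hxl, hxc, Or.inr rfl⟩
    have hsub : insert c (N.verts \ {l}) ⊆ (glue N H l).verts := by
      rintro u (rfl | hu)
      exacts [⟨Or.inr hcH, hcl⟩, ⟨Or.inl hu.1, hu.2⟩]
    have hzM : z ∈ (glue N H l).verts := ⟨Or.inr hz, hzl⟩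
    have h1 := h0.insert_pendant hcY hsymm (y := z) (by
      rintro (h | h)
      · exact hzc h
      · exact hzl (hd z h.1 hz)) fun u hu => hleaf z hz hzl hzc u (hsub hu)
    have h2 : HasDiagram (insert z (insert c (N.verts \ {l}))) (glue N H l).Adj (insert x Y) := by
      rcases hzx with rfl | rfl
      exacts [h1.1, h1.2]
    have h3 := h2.union_twins hsymm (Z := H.verts \ {l, c}) hf.sdiff (l := z) (Or.inl rfl) ?_
    · convert h3 using 1
      ext u
      constructor
      · rintro ⟨hu | hu, hul⟩
        · exact Or.inl (Or.inr (Or.inr ⟨hu, hul⟩))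
        · by_cases huc : u = c
          · exact Or.inl (Or.inr (Or.inl huc))
          · exact Or.inr ⟨hu, fun h => h.elim hul huc⟩
      · rintro ((rfl | hu) | hu)
        · exact hzM
        · exact hsub hu
        · exact ⟨Or.inr hu.1, fun h => hu.2 (Or.inl h)⟩
    · rintro y ⟨hy, hy'⟩ u hu - -
      have hu' : u ∈ (glue N H l).verts := by
        rcases hu with (rfl | hu) | hu
        · exact hzM
        · exact hsub hu
        · exact ⟨Or.inr hu.1, fun h => hu.2 (Or.inl h)⟩
      rw [hleaf y hy (fun h => hy' (Or.inl h)) (fun h => hy' (Or.inr h)) u hu',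
        hleaf z hz hzl hzc u hu']

lemma IsSimple.hasDiagram {N : Node V} (hN : IsSimple N) (hf : N.verts.Finite) {X : Set (V ⊕ ℕ)}
    (hX : X ⊆ N.verts) (hX2 : X.Nontrivial) : HasDiagram N.verts N.Adj X := by
  obtain ⟨x, hx, y, hy, hxy⟩ := hX2
  have hsymm : ∀ u v, N.Adj u v ↔ N.Adj v u := fun u v => SimpleGraph.Subgraph.adj_comm ..
  suffices h : HasDiagram N.verts N.Adj {x, y} by
    have := h.union_tags hX
    rwa [Set.union_eq_right.2 (Set.insert_subset hx (Set.singleton_subset_iff.2 hy))] at this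
  rcases hN with hN | ⟨c, hc, hN⟩
  · have h1 := hN x (hX hx) y (hX hy) hxy
    have h2 := (hasDiagram_edge hxy h1 h1.symm).union_twins hsymm hf (l := x) (Or.inl rfl) ?_
    · rwa [Set.union_eq_right.2
        (Set.insert_subset (hX hx) (Set.singleton_subset_iff.2 (hX hy)))] at h2
    · intro z hz u hu hux huz
      have hu' : u ∈ N.verts := by
        rcases hu with (rfl | rfl) | hu
        exacts [hX hx, hX hy, hu]
      exact iff_of_true (hN z hz u hu' huz.symm) (hN x (hX hx) u hu' hux.symm)
  · -- the leaves other than `x` are twins of `x`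
    have key : ∀ x ∈ N.verts, x ≠ c → ∀ W ⊆ N.verts, c ∈ W → x ∈ W → ∀ T,
        HasDiagram W N.Adj T → HasDiagram N.verts N.Adj T := by
      intro x hx hxc W hW hcW hxW T h
      have h2 := h.union_twins hsymm (Z := N.verts \ {c}) hf.sdiff hxW ?_
      · convert h2 using 1
        ext u
        constructor
        · intro hu
          by_cases huc : u = c
          · exact Or.inl (huc ▸ hcW)
          · exact Or.inr ⟨hu, huc⟩
        · rintro (hu | hu)
          exacts [hW hu, hu.1]
      · rintro y ⟨hy, hyc⟩ u hu hux huy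
        have hu' : u ∈ N.verts := hu.elim (fun h => hW h) fun h => h.1
        rw [hN y hy u hu', hN x hx u hu']
        refine and_congr (iff_of_true huy.symm hux.symm) (or_congr ?_ Iff.rfl)
        exact iff_of_false hyc hxc
    have base : ∀ x ∈ N.verts, x ≠ c → HasDiagram {c, x} N.Adj {c, x} := by
      intro x hx hxc
      have := (hN c hc x hx).2 ⟨hxc.symm, Or.inl rfl⟩
      exact hasDiagram_edge hxc.symm this this.symm
    have sub : ∀ x ∈ N.verts, ({c, x} : Set (V ⊕ ℕ)) ⊆ N.verts := fun x hx =>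
      Set.insert_subset hc (Set.singleton_subset_iff.2 hx)
    by_cases hxc : x = c
    · subst hxc
      exact key y (hX hy) hxy.symm _ (sub y (hX hy)) (Or.inl rfl) (Or.inr rfl) _
        (base y (hX hy) hxy.symm)
    by_cases hyc : y = c
    · subst hyc
      rw [Set.pair_comm]
      exact key x (hX hx) hxc _ (sub x (hX hx)) (Or.inl rfl) (Or.inr rfl) _ (base x (hX hx) hxc)
    · have h1 := ((base x (hX hx) hxc).insert_pendant (fun h => hxc h.symm) hsymm (y := y) (by
        rintro (h | h)
        exacts [hyc h, hxy h.symm]) ?_).2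
      · rw [Set.pair_comm]
        exact key x (hX hx) hxc _ (Set.insert_subset (hX hy) (sub x (hX hx))) (Or.inr (Or.inl rfl))
          (Or.inr (Or.inr rfl)) _ h1
      · intro u hu
        rw [hN y (hX hy) u (sub x (hX hx) hu)]
        refine ⟨fun h => h.2.resolve_left hyc, ?_⟩
        rintro rfl
        exact ⟨hyc, Or.inr rfl⟩

/-- A graph that decomposes into cliques and stars has a chord diagram with corners at `X` if `X`
contains a vertex of each leaf of the decomposition tree. -/
lemma Dec.hasDiagram {N : Node V} {D : Set (Node V)} (h : Dec N D) (hs : ∀ H ∈ D, IsSimple H)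
    {X : Set (V ⊕ ℕ)} (hX : X ⊆ N.verts) (hX2 : X.Nontrivial)
    (hleaf : ∀ H ∈ D, (∀ x y, IsMarkerOf D H x → IsMarkerOf D H y → x = y) →
      ∃ x ∈ X, x ∈ H.verts) : HasDiagram N.verts N.Adj X := by
  obtain ⟨n, hn⟩ : ∃ n, D.ncard = n := ⟨_, rfl⟩
  induction n generalizing N D X with
  | zero =>
    rw [Set.ncard_eq_zero h.finite] at hn
    exact absurd hn h.nonempty.ne_empty
  | succ n ih =>
    by_cases hD : D.Nontrivial
    · obtain ⟨x₀, hx₀⟩ := hX2.nonempty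
      obtain ⟨H, l, hH, hx₀H⟩ := h.exists_end hD (hX hx₀)
      obtain ⟨N', m, rfl, rfl, c⟩ := h.peel hH
      have hlH : Sum.inr m ∈ H.verts := ((hH.2 _).2 rfl).1
      have hlX : Sum.inr m ∉ X := fun h => (hX h).2 rfl
      obtain ⟨x, hx, hxH⟩ := hleaf H hH.1 fun y z hy hz =>
        ((hH.2 y).1 hy).trans ((hH.2 z).1 hz).symm
      have hxl : x ≠ Sum.inr m := fun h => hlX (h ▸ hx)
      have hYN : X \ H.verts ⊆ N'.verts := fun y hy => (hX hy.1).1.resolve_right hy.2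
      have h1 : HasDiagram N'.verts N'.Adj (insert (Sum.inr m) (X \ H.verts)) := by
        refine ih c.h₁ (fun K hK => hs K hK.1) (Set.insert_subset c.m₁ hYN)
          ⟨_, Or.inl rfl, x₀, Or.inr ⟨hx₀, hx₀H⟩, fun h => hlX (h ▸ hx₀)⟩ ?_ ?_
        · rintro K ⟨hK, hKH⟩ hK1
          by_cases hlK : Sum.inr m ∈ K.verts
          · exact ⟨_, Or.inl rfl, hlK⟩
          · have hmark : ∀ y, IsMarkerOf D K y → IsMarkerOf (D \ {H}) K y := by
              rintro y ⟨hy, L, hL, hLK, hyL⟩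
              refine ⟨hy, L, ⟨hL, ?_⟩, hLK, hyL⟩
              rintro rfl
              have : IsMarkerOf D L y := ⟨hyL, K, hK, hKH, hy⟩
              exact hlK ((hH.2 y).1 this ▸ hy)
            obtain ⟨y, hy, hyK⟩ := hleaf K hK fun y z hy hz => hK1 y z (hmark y hy) (hmark z hz)
            exact ⟨y, Or.inr ⟨hy, fun h' => hKH (h.unique_node (hX hy) hK hH.1 hyK h')⟩, hyK⟩
        · have := Set.ncard_sdiff_singleton_add_one hH.1 h.finite
          omega
      have h2 := h1.attach c.hd' c.m₁ hlH (fun h => h.2 hlH) hYN (hs H hH.1)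
        (h.node_finite hH.1) (h.node_big' hD hH.1) hxH hxl
      have h3 := h2.union_tags hX
      rwa [Set.union_eq_right.2 (Set.insert_subset hx Set.sdiff_subset)] at h3
    · obtain ⟨H, hH⟩ := h.nonempty
      obtain rfl := (Set.not_nontrivial_iff.1 hD).eq_singleton_of_mem hH
      rw [h.eq_singleton] at hX ⊢
      exact (hs H hH).hasDiagram (h.node_finite hH) hX hX2

lemma isPolygonGraph_of_hasDiagram [Finite V] {G : SimpleGraph V} {X : Set (V ⊕ ℕ)}
    (h : HasDiagram (toNode G).verts (toNode G).Adj X) (hX : 2 ≤ X.ncard) :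
    IsPolygonGraph X.ncard G := by
  classical
  obtain ⟨f, g, κ, h⟩ := h
  have hfin := h.finite.subset h.subset
  have mem : ∀ v : V, Sum.inl v ∈ (toNode G).verts := fun v => ⟨v, rfl⟩
  have hcard : (hfin.toFinset.image κ).card = X.ncard := by
    rw [Finset.card_image_of_injOn, ← Set.ncard_eq_toFinset_card X hfin]
    intro x hx y hy hxy
    by_contra hne
    exact h.κ_inj x (hfin.mem_toFinset.1 hx) y (hfin.mem_toFinset.1 hy) hne hxy
  rw [← hcard] at hX ⊢
  have hne : ∀ u v : V, u ≠ v → (Sum.inl u : V ⊕ ℕ) ≠ Sum.inl v := fun u v huv h =>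
    huv (Sum.inl_injective h)
  refine isPolygonGraph_of_ends (f := fun v => f (Sum.inl v)) (g := fun v => g (Sum.inl v)) hX
    ?_ ?_ (fun u v => h.f_ne_g _ (mem u) _ (mem v)) ?_ ?_ ?_ ?_
  · intro u v huv
    by_contra hn
    exact h.f_inj _ (mem u) _ (mem v) (hne u v hn) huv
  · intro u v huv
    by_contra hn
    exact h.g_inj _ (mem u) _ (mem v) (hne u v hn) huv
  · intro v hv
    obtain ⟨x, hx, hxv⟩ := Finset.mem_image.1 hv
    exact h.κ_ne_f x (hfin.mem_toFinset.1 hx) _ (mem v) hxv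
  · intro v hv
    obtain ⟨x, hx, hxv⟩ := Finset.mem_image.1 hv
    exact h.κ_ne_g x (hfin.mem_toFinset.1 hx) _ (mem v) hxv
  · intro v
    obtain ⟨x, hx, y, hy, h1, h2⟩ := h.corner _ (mem v)
    exact ⟨κ x, Finset.mem_image_of_mem _ (hfin.mem_toFinset.2 hx), κ y,
      Finset.mem_image_of_mem _ (hfin.mem_toFinset.2 hy), h1, h2⟩
  · intro u v
    by_cases huv : u = v
    · subst huv
      simp
    · rw [← toNode_adj, h.adj_iff _ (mem u) _ (mem v) (hne u v huv)]
      exact (and_iff_right huv).symm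

end Build

/-! ### Leaves and pruning -/

section Prune

variable {V : Type*}

lemma Dec.isLeaf_iff {N : Node V} {D : Set (Node V)} (h : Dec N D) (H : D) :
    IsLeaf D H ↔ ∃ l, IsEnd D H.1 l := by
  obtain ⟨H, hH⟩ := H
  constructor
  · intro hl
    obtain ⟨⟨K, hK⟩, hKH⟩ := Set.ncard_eq_one.1 hl
    have h1 : (decompositionTree D).Adj ⟨H, hH⟩ ⟨K, hK⟩ := by
      have : (⟨K, hK⟩ : D) ∈ (decompositionTree D).neighborSet ⟨H, hH⟩ := by
        rw [hKH]
        rfl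
      exact this
    obtain ⟨hne, l, lH, lK⟩ := h1
    have hne' : H ≠ K := fun h => hne (Subtype.ext h)
    refine ⟨l, hH, fun x => ⟨?_, ?_⟩⟩
    · rintro ⟨xH, L, hL, hLH, xL⟩
      have h2 : (⟨L, hL⟩ : D) ∈ (decompositionTree D).neighborSet ⟨H, hH⟩ :=
        ⟨fun h => hLH (congrArg Subtype.val h).symm, x, xH, xL⟩
      rw [hKH] at h2
      obtain rfl : L = K := congrArg Subtype.val h2
      exact h.shared_unique hH hK hne' xH xL lH lK
    · rintro rfl
      exact ⟨lH, K, hK, hne'.symm, lK⟩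
  · rintro ⟨l, -, hl⟩
    obtain ⟨lH, K, hK, hKH, lK⟩ := (hl l).2 rfl
    refine Set.ncard_eq_one.2 ⟨⟨K, hK⟩, Set.eq_singleton_iff_unique_mem.2 ⟨?_, ?_⟩⟩
    · exact ⟨fun h => hKH (congrArg Subtype.val h).symm, l, lH, lK⟩
    · rintro ⟨L, hL⟩ ⟨hne, x, xH, xL⟩
      have hne' : H ≠ L := fun h => hne (Subtype.ext h)
      obtain rfl := (hl x).1 ⟨xH, L, hL, hne'.symm, xL⟩
      refine Subtype.ext ?_
      rcases h.marker_two hH hK hL lH lK xL with h | h | h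
      exacts [absurd h.symm hKH, absurd h hne', h.symm]

lemma Dec.numLeaves_eq {N : Node V} {D : Set (Node V)} (h : Dec N D) :
    numLeaves D = {H | ∃ l, IsEnd D H l}.ncard := by
  rw [numLeaves, ← Set.ncard_image_of_injective _ Subtype.val_injective]
  congr 1
  ext H
  constructor
  · rintro ⟨H, hH, rfl⟩
    exact (h.isLeaf_iff H).1 hH
  · rintro ⟨l, hl⟩
    exact ⟨⟨H, hl.1⟩, (h.isLeaf_iff _).2 ⟨l, hl⟩, rfl⟩

/-- What survives of the relation between `G` and its standard decomposition `D₀` when the tree is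
pruned to `D`: the graph `N` that `D` describes is an induced subgraph of `G`, and a chord diagram of
`N` extends to one of `G` with as many corners. -/
structure IsPruned (G : SimpleGraph V) (D₀ D : Set (Node V)) (N : Node V) : Prop where
  subset : D ⊆ D₀
  dec : Dec N D
  emb : Emb N (toNode G)
  extend : ∀ X, HasDiagram N.verts N.Adj X →
    ∃ Y, Y.ncard = X.ncard ∧ HasDiagram (toNode G).verts (toNode G).Adj Y

lemma IsPruned.step {G : SimpleGraph V} {D₀ D D' : Set (Node V)} {N : Node V}
    (hs : ∀ H ∈ D₀, IsSimple H) (h : IsPruned G D₀ D N) (hD : PruneStep D D') :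
    ∃ N', IsPruned G D₀ D' N' := by
  obtain ⟨⟨H, hH⟩, hleaf, ⟨l', hl', huniv⟩, rfl⟩ := hD
  obtain ⟨l, hl⟩ := (h.dec.isLeaf_iff _).1 hleaf
  obtain rfl := (hl.2 l').1 hl'
  obtain ⟨N', m, rfl, rfl, c⟩ := h.dec.peel hl
  obtain ⟨b, hb⟩ := c.exists_adj₂
  refine ⟨N', fun K hK => h.subset hK.1, c.h₁, (emb_glue c.hd' hb).trans h.emb, fun X hX => ?_⟩
  have hbl : b ≠ Sum.inr m := hb.ne.symm
  have h1 := hX.attach_universal c.hd' c.m₁ (hs H (h.subset hH)) (h.dec.node_finite hH)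
    c.symm.big₁ (fun y hy hyl => (huniv y hy hyl).symm) hb.snd_mem hbl
  obtain ⟨Y, hY, hdia⟩ := h.extend _ h1
  refine ⟨Y, hY.trans ?_, hdia⟩
  obtain ⟨f, g, κ, hX⟩ := hX
  exact ncard_moveTag (hX.finite.subset hX.subset) fun h => hbl (c.hd' b (hX.subset h) hb.snd_mem)

lemma exists_isPruned [Finite V] {G : SimpleGraph V} (hG : G.Connected) {D₀ D : Set (Node V)}
    (h₀ : IsSplitDecomposition G D₀) (hs : ∀ H ∈ D₀, IsSimple H)
    (h : Relation.ReflTransGen PruneStep D₀ D) : ∃ N, IsPruned G D₀ D N := by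
  induction h with
  | refl => exact ⟨toNode G, subset_rfl, h₀.dec hG, .refl _, fun X hX => ⟨X, rfl, hX⟩⟩
  | tail _ hstep ih =>
    obtain ⟨N, hN⟩ := ih
    exact hN.step hs hstep

lemma exists_isPrunedDecomposition [Finite V] {G : SimpleGraph V} (hG : G.Connected) :
    ∃ D, IsPrunedDecomposition G D := by
  obtain ⟨D₀, h₀⟩ := exists_isStandardDecomposition hG
  have hfin : D₀.Finite := (h₀.1.1.dec hG).finite
  have key : ∀ n, ∀ D : Set (Node V), D.Finite → D.ncard ≤ n →
      ∃ D', Relation.ReflTransGen PruneStep D D' ∧ ¬ ∃ D'', PruneStep D' D'' := by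
    intro n
    induction n with
    | zero =>
      intro D hD hn
      refine ⟨D, .refl, ?_⟩
      rintro ⟨_, H, -⟩
      have := Set.ncard_pos hD |>.2 ⟨H.1, H.2⟩
      omega
    | succ n ih =>
      intro D hD hn
      by_cases hstep : ∃ D'', PruneStep D D''
      · obtain ⟨_, hstep⟩ := hstep
        have hstep' := hstep
        obtain ⟨H, -, -, rfl⟩ := hstep'
        have := Set.ncard_sdiff_singleton_add_one H.2 hD
        obtain ⟨D', h1, h2⟩ := ih (D \ {H.1}) hD.sdiff (by omega)
        exact ⟨D', .head hstep h1, h2⟩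
      · exact ⟨D, .refl, hstep⟩
  obtain ⟨D, h1, h2⟩ := key _ D₀ hfin le_rfl
  exact ⟨D, ⟨D₀, h₀, h1⟩, h2⟩

end Prune

/-! ### An asteroidal set with one vertex in each leaf -/

section Lower

variable {V : Type*}

lemma IsAsteroidal.ncard_le [Finite V] {G : SimpleGraph V} {A : Set V} (h : IsAsteroidal G A) :
    A.ncard ≤ asteroidalNumber G := by
  refine le_csSup ⟨Nat.card V, ?_⟩ ⟨A, h, rfl⟩
  rintro n ⟨B, -, rfl⟩
  exact Set.ncard_le_card B

lemma two_le_asteroidalNumber [Finite V] {G : SimpleGraph V} {u v : V} (huv : u ≠ v)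
    (hn : ¬ G.Adj u v) : 2 ≤ asteroidalNumber G := by
  rw [← Set.ncard_pair huv]
  apply IsAsteroidal.ncard_le
  have key : ∀ {u v : V}, u ≠ v → ¬ G.Adj u v → ∀ x ∈ ({u, v} : Set V) \ {u},
      ∀ y ∈ ({u, v} : Set V) \ {u}, ∃ (hx : x ∈ outside G u) (hy : y ∈ outside G u),
        (G.induce (outside G u)).Reachable ⟨x, hx⟩ ⟨y, hy⟩ := by
    rintro u v huv hn x ⟨rfl | rfl, hxu⟩ y ⟨rfl | rfl, hyu⟩
    · exact absurd rfl hxu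
    · exact absurd rfl hxu
    · exact absurd rfl hyu
    · exact ⟨⟨hxu, hn⟩, ⟨hxu, hn⟩, .rfl⟩
  rintro a (rfl | rfl)
  · exact key huv hn
  · rw [Set.pair_comm]
    exact key huv.symm fun h => hn h.symm

/-- The vertices `p` and `q` are adjacent in `N - N[a]`. -/
def AdjOutside (N : Node V) (a p q : V ⊕ ℕ) : Prop :=
  N.Adj p q ∧ (p ≠ a ∧ ¬ N.Adj a p) ∧ (q ≠ a ∧ ¬ N.Adj a q)

lemma ncard_le_asteroidalNumber_of_emb [Finite V] [Nonempty V] {G : SimpleGraph V} {N : Node V}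
    (he : Emb N (toNode G)) {A : Set (V ⊕ ℕ)} (hAN : A ⊆ N.verts)
    (hA : ∀ a ∈ A, ∀ x ∈ A, x ≠ a → ¬ N.Adj a x ∧
      ∀ y ∈ A, y ≠ a → Relation.ReflTransGen (AdjOutside N a) x y) :
    A.ncard ≤ asteroidalNumber G := by
  obtain ⟨φ, h1, h2, h3⟩ := he
  choose! g hg using h1
  have inj : ∀ x ∈ N.verts, ∀ y ∈ N.verts, g x = g y → x = y := fun x hx y hy h => by
    refine h2 x hx y hy ?_
    rw [← hg x hx, ← hg y hy, h]
  have adj : ∀ x ∈ N.verts, ∀ y ∈ N.verts, (G.Adj (g x) (g y) ↔ N.Adj x y) := fun x hx y hy => by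
    rw [← h3 x hx y hy, ← hg x hx, ← hg y hy, toNode_adj]
  have out : ∀ a ∈ N.verts, ∀ x ∈ N.verts, x ≠ a → ¬ N.Adj a x → g x ∈ outside G (g a) :=
    fun a ha x hx hxa hn => ⟨fun h => hxa (inj x hx a ha h), fun h => hn ((adj a ha x hx).1 h)⟩
  rw [← Set.InjOn.ncard_image (f := g) fun x hx y hy h => inj x (hAN hx) y (hAN hy) h]
  apply IsAsteroidal.ncard_le
  rintro _ ⟨a, ha, rfl⟩ _ ⟨⟨x, hx, rfl⟩, hxa⟩ _ ⟨⟨y, hy, rfl⟩, hya⟩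
  have hxa' : x ≠ a := fun h => hxa (congrArg g h)
  have hya' : y ≠ a := fun h => hya (congrArg g h)
  have path : ∀ y, Relation.ReflTransGen (AdjOutside N a) x y →
      ∃ (hx : g x ∈ outside G (g a)) (hy : g y ∈ outside G (g a)),
        (G.induce (outside G (g a))).Reachable ⟨g x, hx⟩ ⟨g y, hy⟩ := by
    intro y h
    induction h with
    | refl => exact ⟨out a (hAN ha) x (hAN hx) hxa' (hA a ha x hx hxa').1,
        out a (hAN ha) x (hAN hx) hxa' (hA a ha x hx hxa').1, .rfl⟩
    | @tail p q _ h ih =>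
      obtain ⟨i1, i2, i3⟩ := ih
      refine ⟨i1, out a (hAN ha) q h.1.snd_mem h.2.2.1 h.2.2.2, i3.trans ?_⟩
      exact SimpleGraph.Adj.reachable (by exact (adj p h.1.fst_mem q h.1.snd_mem).2 h.1)
  exact path y ((hA a ha x hx hxa').2 y hy hya')

lemma IsSimple.conn_deleteVerts {K : Node V} (hK : IsSimple K) {l : V ⊕ ℕ} (hl : ¬ StarAt K l) :
    Conn (K.deleteVerts {l}) := by
  rintro x ⟨hx, hxl⟩ y ⟨hy, hyl⟩
  by_cases hxy : x = y
  · rw [hxy]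
  rcases hK with hK | ⟨c, hc⟩
  · exact .single (SimpleGraph.Subgraph.deleteVerts_adj.2 ⟨hx, hxl, hy, hyl, hK x hx y hy hxy⟩)
  · have hcl : c ≠ l := by
      rintro rfl
      exact hl hc
    have key : ∀ x ∈ K.verts, x ∉ ({l} : Set (V ⊕ ℕ)) → x ≠ c → (K.deleteVerts {l}).Adj x c :=
      fun x hx hxl hxc => SimpleGraph.Subgraph.deleteVerts_adj.2
        ⟨hx, hxl, hc.1, hcl, (hc.2 x hx c hc.1).2 ⟨hxc, Or.inr rfl⟩⟩
    by_cases hxc : x = c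
    · subst hxc
      exact .single (key y hy hyl (Ne.symm hxy)).symm
    · by_cases hyc : y = c
      · subst hyc
        exact .single (key x hx hxl hxc)
      · exact .head (key x hx hxl hxc) (.single (key y hy hyl hyc).symm)

/-- A leaf `a` of a star at the end of the decomposition tree does not separate the vertices outside
of the star, provided that the neighbouring graph is not a star centred at the common marker. -/
lemma Dec.reflTransGen_adjOutside {N : Node V} {D : Set (Node V)} (h : Dec N D) {H K : Node V}
    {l c a : V ⊕ ℕ} (hH : IsEnd D H l) (hc : StarAt H c) (hcl : c ≠ l) (ha : a ∈ H.verts)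
    (hal : a ≠ l) (hac : a ≠ c) (hK : K ∈ D) (hKH : K ≠ H) (hlK : l ∈ K.verts) (hsK : IsSimple K)
    (hnK : ¬ StarAt K l) {x y : V ⊕ ℕ} (hx : x ∈ N.verts) (hxH : x ∉ H.verts) (hy : y ∈ N.verts)
    (hyH : y ∉ H.verts) : ¬ N.Adj a x ∧ Relation.ReflTransGen (AdjOutside N a) x y := by
  obtain ⟨N', m, rfl, rfl, cp⟩ := h.peel hH
  have hlH : Sum.inr m ∈ H.verts := ((hH.2 _).2 rfl).1
  have hout : ∀ u ∈ N'.verts, u ≠ Sum.inr m → u ≠ a ∧ ¬ (glue N' H (Sum.inr m)).Adj a u := by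
    intro u hu hul
    refine ⟨?_, ?_⟩
    · rintro rfl
      exact hul (cp.hd' u hu ha)
    · rw [glue_adj_cross cp.hd' ha hal hu hul, hc.2 a ha _ hlH]
      exact fun h => h.1.2.elim hac hcl.symm
  have hx' := hx.1.resolve_right hxH
  have hy' := hy.1.resolve_right hyH
  refine ⟨(hout x hx' hx.2).2, ?_⟩
  have h1 := cp.h₁.conn_deleteVerts ⟨hK, hKH⟩ cp.m₁ hlK (hsK.conn_deleteVerts hnK) x
    ⟨hx', hx.2⟩ y ⟨hy', hy.2⟩
  refine Relation.ReflTransGen.mono (fun p q hpq => ?_) x y h1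
  obtain ⟨hp, hpl, hq, hql, hpq⟩ := SimpleGraph.Subgraph.deleteVerts_adj.1 hpq
  exact ⟨(glue_adj_left cp.hd' hp hpl hq hql).2 hpq, hout p hp hpl, hout q hq hql⟩

lemma Dec.verts_nonempty {N : Node V} {D : Set (Node V)} (h : Dec N D) (hD : D.Nontrivial) :
    N.verts.Nonempty := by
  revert hD
  apply Dec.rec' ?_ ?_ h
  · exact fun N _ _ h => absurd h Set.not_nontrivial_singleton
  · rintro N₁ N₂ D₁ D₂ m c - - -
    obtain ⟨x, hx, hxm⟩ := c.t₁.nonempty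
    exact ⟨x, Or.inl hx, hxm⟩

end Lower

/-! ### The polygon number and the asteroidal number -/

section Main

variable {V : Type*} {G : SimpleGraph V}

/-- Each leaf of a pruned decomposition is a star whose marker is not the centre. Another vertex
`x` of this star that is not the centre is chosen. -/
lemma IsPruned.exists_leaf_vertex {D₀ D : Set (Node V)} {N : Node V} (h : IsPruned G D₀ D N)
    (hs : ∀ H ∈ D₀, IsSimple H) (hpr : ¬ ∃ D', PruneStep D D') (hD : D.Nontrivial) {H : Node V}
    {l : V ⊕ ℕ} (hH : IsEnd D H l) :
    ∃ x c, StarAt H c ∧ c ≠ l ∧ x ∈ H.verts ∧ x ≠ l ∧ x ≠ c := by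
  have hnu : ¬ ∀ x ∈ H.verts, x ≠ l → H.Adj l x := fun hu =>
    hpr ⟨_, ⟨H, hH.1⟩, (h.dec.isLeaf_iff _).2 ⟨l, hH⟩, ⟨l, (hH.2 l).2 rfl, hu⟩, rfl⟩
  have hlH : l ∈ H.verts := ((hH.2 l).2 rfl).1
  rcases hs H (h.subset hH.1) with hcl | ⟨c, hc⟩
  · exact absurd (fun x hx hxl => hcl l hlH x hx (Ne.symm hxl)) hnu
  have hcl : c ≠ l := by
    rintro rfl
    exact hnu fun x hx hxc => (hc.2 c hlH x hx).2 ⟨Ne.symm hxc, Or.inl rfl⟩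
  obtain ⟨a, ha, b, hb, hab⟩ := h.dec.node_big' hD hH.1 l
  by_cases hac : a = c
  · exact ⟨b, c, hc, hcl, hb.1, hb.2, fun h => hab (hac.trans h.symm)⟩
  · exact ⟨a, c, hc, hcl, ha.1, ha.2, hac⟩

/-- One vertex from each leaf gives both the corners of a polygon representation and an asteroidal
set. -/
lemma IsPruned.numLeaves_le [Finite V] (hG : G.Connected) {D₀ D : Set (Node V)} {N : Node V}
    (h₀ : IsStandardDecomposition G D₀) (h : IsPruned G D₀ D N) (hs : ∀ H ∈ D₀, IsSimple H)
    (hpr : ¬ ∃ D', PruneStep D D') (hD : D.Nontrivial) :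
    IsPolygonGraph (numLeaves D) G ∧ numLeaves D ≤ asteroidalNumber G := by
  have hne : Nonempty V := hG.nonempty
  obtain ⟨L, hL⟩ : ∃ L : Set (Node V), L = {H | ∃ l, IsEnd D H l} := ⟨_, rfl⟩
  have hdata : ∀ H, ∃ x l c, H ∈ L →
      IsEnd D H l ∧ StarAt H c ∧ c ≠ l ∧ x ∈ H.verts ∧ x ≠ l ∧ x ≠ c := by
    intro H
    by_cases hH : H ∈ L
    · have hH' := hH
      rw [hL] at hH'
      obtain ⟨l, hl⟩ := hH'
      obtain ⟨x, c, hx⟩ := h.exists_leaf_vertex hs hpr hD hl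
      exact ⟨x, l, c, fun _ => ⟨hl, hx⟩⟩
    · exact ⟨Sum.inr 0, Sum.inr 0, Sum.inr 0, fun h => absurd h hH⟩
  choose x l c hx using hdata
  have hxN : ∀ H ∈ L, x H ∈ N.verts := fun H hH => h.dec.mem_verts (hx H hH).1.1
    (hx H hH).2.2.2.1 fun hm => (hx H hH).2.2.2.2.1 (((hx H hH).1.2 _).1 hm)
  have hxH : ∀ H ∈ L, ∀ K ∈ L, x H ∈ K.verts → H = K := fun H hH K hK hHK =>
    h.dec.unique_node (hxN H hH) (hx H hH).1.1 (hx K hK).1.1 (hx H hH).2.2.2.1 hHK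
  have hinj : Set.InjOn x L := fun H hH K hK e => hxH H hH K hK (e ▸ (hx K hK).2.2.2.1)
  have hsub : x '' L ⊆ N.verts := by
    rintro _ ⟨H, hH, rfl⟩
    exact hxN H hH
  have hcard : (x '' L).ncard = numLeaves D := by
    rw [hinj.ncard_image, h.dec.numLeaves_eq, hL]
  have htwo : (x '' L).Nontrivial := by
    obtain ⟨z, hz⟩ := h.dec.verts_nonempty hD
    obtain ⟨H, l₁, hH, -⟩ := h.dec.exists_end hD hz
    have hHL : H ∈ L := by rw [hL]; exact ⟨l₁, hH⟩
    obtain ⟨K, l₂, hK, hKH⟩ := h.dec.exists_end hD (hxN H hHL)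
    have hKL : K ∈ L := by rw [hL]; exact ⟨l₂, hK⟩
    exact ⟨_, ⟨H, hHL, rfl⟩, _, ⟨K, hKL, rfl⟩, fun e => hKH (e ▸ (hx K hKL).2.2.2.1)⟩
  rw [← hcard]
  constructor
  · have hdia := h.dec.hasDiagram (fun H hH => hs H (h.subset hH)) hsub htwo (by
      intro H hH hone
      obtain ⟨l, hl⟩ := h.dec.exists_marker hH fun e => by
        rw [e] at hD
        exact Set.not_nontrivial_singleton hD
      have hHL : H ∈ L := by
        rw [hL]
        refine ⟨l, hH, fun y => ⟨fun hy => hone y l hy hl, ?_⟩⟩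
        rintro rfl
        exact hl
      exact ⟨x H, ⟨H, hHL, rfl⟩, (hx H hHL).2.2.2.1⟩)
    obtain ⟨Y, hY, hdia⟩ := h.extend _ hdia
    rw [← hY]
    refine isPolygonGraph_of_hasDiagram hdia ?_
    rw [hY]
    exact one_lt_ncard_of_nontrivial (h.dec.verts_finite.subset hsub) htwo
  · refine ncard_le_asteroidalNumber_of_emb h.emb hsub ?_
    have key : ∀ H ∈ L, ∀ y ∈ x '' L, y ≠ x H → y ∈ N.verts ∧ y ∉ H.verts := by
      rintro H hH _ ⟨K, hK, rfl⟩ hne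
      refine ⟨hxN K hK, fun h' => hne ?_⟩
      rw [hxH K hK H hH h']
    rintro _ ⟨H, hH, rfl⟩ y hy hyH
    obtain ⟨e1, e2, e3, e4, e5, e6⟩ := hx H hH
    obtain ⟨lH, K, hK, hKH, lK⟩ := (e1.2 (l H)).2 rfl
    have hnK := h₀.no_star_star hG (h.subset e1.1) (h.subset hK) hKH.symm lH e3 e2
    obtain ⟨y1, y2⟩ := key H hH y hy hyH
    have fin := fun z (z1 : z ∈ N.verts) (z2 : z ∉ H.verts) =>
      h.dec.reflTransGen_adjOutside e1 e2 e3 e4 e5 e6 hK hKH lK (hs K (h.subset hK)) hnK y1 y2 z1 z2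
    refine ⟨(fin y y1 y2).1, fun z hz hzH => ?_⟩
    obtain ⟨z1, z2⟩ := key H hH z hz hzH
    exact (fin z z1 z2).2

lemma IsPruned.isPolygonGraph_two [Finite V] (hG : G.Connected) (hV : Nontrivial V)
    {D₀ D : Set (Node V)}
    {N : Node V} (h₀ : IsSplitDecomposition G D₀) (h : IsPruned G D₀ D N)
    (hs : ∀ H ∈ D₀, IsSimple H) (hD : ¬ D.Nontrivial) : IsPolygonGraph 2 G := by
  obtain ⟨H, hH⟩ := h.dec.nonempty
  have hDH := (Set.not_nontrivial_iff.1 hD).eq_singleton_of_mem hH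
  have hdec := h.dec
  rw [hDH] at hdec
  have e : N = H := hdec.eq_singleton
  subst e
  have hdec₀ := h₀.dec hG
  have htwo : N.verts.Nontrivial := by
    by_cases hD₀ : D₀.Nontrivial
    · exact (hdec₀.node_big' hD₀ (h.subset hH) (Sum.inr 0)).mono Set.sdiff_subset
    · have e := (Set.not_nontrivial_iff.1 hD₀).eq_singleton_of_mem (h.subset hH)
      rw [e] at hdec₀
      rw [← hdec₀.eq_singleton]
      obtain ⟨a, b, hab⟩ := exists_pair_ne V
      exact ⟨_, ⟨a, rfl⟩, _, ⟨b, rfl⟩, fun h => hab (Sum.inl_injective h)⟩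
  obtain ⟨a, ha, b, hb, hab⟩ := htwo
  have hdia := (hs N (h.subset hH)).hasDiagram h.dec.verts_finite
    (Set.insert_subset ha (Set.singleton_subset_iff.2 hb)) (Set.nontrivial_pair hab)
  obtain ⟨Y, hY, hdia⟩ := h.extend _ hdia
  rw [Set.ncard_pair hab] at hY
  rw [← hY]
  exact isPolygonGraph_of_hasDiagram hdia hY.ge

end Main

end DHPolygon

theorem theorem3p9 {V : Type*} [Finite V] (G : SimpleGraph V) (hconn : G.Connected)
    (hclique : G ≠ ⊤) (hdh : DHPolygon.IsDistanceHereditary G) :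
    (∃ k, DHPolygon.IsPolygonGraph k G) ∧
    DHPolygon.polygonNumber G = DHPolygon.asteroidalNumber G ∧
    (∃ D, DHPolygon.IsPrunedDecomposition G D) ∧
    ∀ D, DHPolygon.IsPrunedDecomposition G D →
      (D.Nontrivial → DHPolygon.asteroidalNumber G = DHPolygon.numLeaves D) ∧
      (¬ D.Nontrivial → DHPolygon.asteroidalNumber G = 2) := by
  open DHPolygon in
  obtain ⟨u, v, huv, hn⟩ : ∃ u v, u ≠ v ∧ ¬ G.Adj u v := by
    by_contra! h
    refine hclique (SimpleGraph.ext ?_)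
    ext u v
    exact ⟨fun h => h.ne, fun h' => h u v h'⟩
  have key : ∀ D, IsPrunedDecomposition G D →
      (D.Nontrivial → IsPolygonGraph (numLeaves D) G ∧ numLeaves D ≤ asteroidalNumber G) ∧
      (¬ D.Nontrivial → IsPolygonGraph 2 G ∧ 2 ≤ asteroidalNumber G) := by
    rintro D ⟨⟨D₀, h₀, hchain⟩, hpr⟩
    have hs : ∀ H ∈ D₀, IsSimple H := fun H hH => h₀.1.isSimple hconn hdh hH
    obtain ⟨N, hN⟩ := exists_isPruned hconn h₀.1.1 hs hchain
    exact ⟨fun hD => hN.numLeaves_le hconn h₀ hs hpr hD,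
      fun hD => ⟨hN.isPolygonGraph_two hconn ⟨u, v, huv⟩ h₀.1.1 hs hD,
        two_le_asteroidalNumber huv hn⟩⟩
  have hlow : ∀ k, IsPolygonGraph k G → asteroidalNumber G ≤ k := fun k hk =>
    asteroidalNumber_le_of_isPolygonGraph hk
  obtain ⟨D, hD⟩ := exists_isPrunedDecomposition hconn
  obtain ⟨k, hk, hk'⟩ : ∃ k, IsPolygonGraph k G ∧ k ≤ asteroidalNumber G := by
    by_cases hDn : D.Nontrivial
    exacts [⟨_, (key D hD).1 hDn⟩, ⟨_, (key D hD).2 hDn⟩]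
  refine ⟨⟨k, hk⟩, ?_, ⟨D, hD⟩, fun D hD => ⟨fun hDn => ?_, fun hDn => ?_⟩⟩
  · exact le_antisymm ((Nat.sInf_le hk).trans hk')
      (hlow _ (Nat.sInf_mem (s := {k | IsPolygonGraph k G}) ⟨k, hk⟩))
  · obtain ⟨h1, h2⟩ := (key D hD).1 hDn
    exact le_antisymm (hlow _ h1) h2
  · obtain ⟨h1, h2⟩ := (key D hD).2 hDn
    exact le_antisymm (hlow _ h1) h2
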